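/- Let $k$ be a field of characteristic $0$. Cochain complexes over $k$ are graded by $\mathbb Z$ with differential of degree $+1$; $V\otimes W$ carries $d(x\otimes y)=dx\otimes y+(-1)^{|x|}x\otimes dy$. Let $B$ be a cdg-Hopf algebra over $k$ (a dg-Hopf algebra that is graded commutative as an algebra). A right dg-comodule over $B$ is a cochain complex $M$ with a coassociative and counital coaction $\gamma^M:M\to M\otimes B$ that is a cochain map. A morphism of degree $m$ from $M$ to $M'$ is a $k$-linear map $\psi$ of degree $m$ with $\gamma^{M'}\psi=(\psi\otimes 1)\gamma^M$. The tensor product of $M$ and $N$ has underlying complex $M\otimes N$ and coaction $(1\otimes 1\otimes m_B)(1\otimes\tau\otimes 1)(\gamma^M\otimes\gamma^N)$, with $m_B$ the multiplication of $B$ and $\tau$ the signed flip; the unit object is $k$ with coaction $1\mapsto 1\otimes 1_B$. Let $\omega$ be the forgetful functor to cochain complexes on all right dg-comodules over $B$, and $\omega_f$ the one on those that are finite-dimensional over $k$. Let $\alpha$ stand for $\omega$ or $\omega_f$, and let $M,N$ run through the comodules on which $\alpha$ is defined. Let $\mathit{cdgA}$ (resp. $\mathit{dgA}$) be the category of graded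 commutative (resp. all) unital dg-algebras over $k$, and $A\in\mathit{cdgA}$. **The functor $\mathcal E^{\alpha}:\mathit{cdgA}\to\mathit{dgA}$.** Let $\mathcal E^\alpha(A)=\mathrm{End}(\alpha\otimes A)=\bigoplus_n\mathrm{End}(\alpha\otimes A)^n$, where $\mathrm{End}(\alpha\otimes A)^n$ consists of the families $\eta=(\eta^M)_M$ of right $A$-linear maps $\eta^M:M\otimes A\to M\otimes A$ of degree $n$ with $(\psi\otimes 1)\,\eta^M=(-1)^{mn}\,\eta^{M'}(\psi\otimes 1)$ for every morphism $\psi:M\to M'$ of every degree $m$. The product is componentwise composition and $(\delta\eta)^M=d\,\eta^M-(-1)^n\eta^M d$ for $\eta$ of degree $n$. A morphism $f:A\to A'$ sends $\eta$ to the family whose component at $M$ is the $A'$-linear extension of $x\mapsto(1\otimes f)\,\eta^M(x\otimes 1)$. **The functor $\mathcal G^{\alpha}_\otimes$.** For $A$-linear $\varphi$ on $M\otimes A$ and $\varphi'$ on $N\otimes A$, with $\varphi'$ of degree $j$, let $\varphi\otimes_{m_A}\varphi'$ be the $A$-linear map on $(M\otimes N)\otimes A$ given by $$(x\otimes y)\otimes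 1\mapsto(-1)^{j|x|}\,\varphi(x\otimes 1)\cdot\varphi'(y\otimes 1),\qquad (x\otimes a)\cdot(y\otimes b):=(-1)^{|a||y|}(x\otimes y)\otimes ab .$$ Let $\mathcal G^\alpha_\otimes(A)=Z^0\mathrm{End}_\otimes(\alpha\otimes A)$ be the set of all $\eta\in\mathrm{End}(\alpha\otimes A)^0$ with $\delta\eta=0$, $\eta^{k}=\mathrm{id}$ and $\eta^{M\otimes N}=\eta^M\otimes_{m_A}\eta^N$ for all $M,N$, under composition, with the same action of morphisms as above. **Homotopy types.** A homotopy pair on $Z^0\mathrm{End}_\otimes(\alpha\otimes A)$ is a pair $(\eta(t),\lambda(t))$ of polynomials in $t$ with coefficients in $\mathrm{End}(\alpha\otimes A)^0$ and $\mathrm{End}(\alpha\otimes A)^{-1}$ such that $\frac{d}{dt}\eta(t)=\delta\lambda(t)$, $\eta(0)\in Z^0\mathrm{End}_\otimes(\alpha\otimes A)$, $\lambda(t)^k=0$ and $\lambda(t)^{M\otimes N}=\lambda(t)^M\otimes_{m_A}\eta(t)^N+\eta(t)^M\otimes_{m_A}\lambda(t)^N$. A homotopy pair on $\mathrm{Hom}_{\mathit{cdgA}}(A,A')$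 is a pair $(f(t),\xi(t))$ of polynomials in $t$ whose coefficients are $k$-linear maps $A\to A'$ of degrees $0$ and $-1$ such that $\frac{d}{dt}f(t)=d\,\xi(t)+\xi(t)\,d$, $f(0)$ is a morphism of $\mathit{cdgA}$, $\xi(t)(1)=0$ and $\xi(t)(ab)=\xi(t)(a)f(t)(b)+(-1)^{|a|}f(t)(a)\,\xi(t)(b)$. In both cases two elements are homotopic if they are the values at $t=0$ and $t=1$ of the first entry of a homotopy pair; homotopy types are the classes of the equivalence relation generated by this. They are compatible with composition, so that there is a homotopy category $\mathit{ho\,cdgA}$ of $\mathit{cdgA}$, and $A\mapsto\mathfrak G^\alpha_\otimes(A):=\{\text{homotopy types of elements of }\mathcal G^\alpha_\otimes(A)\}$ is a functor on $\mathit{ho\,cdgA}$. Finally let $\mathcal G^B(A)=\mathrm{Hom}_{\mathit{cdgA}}(B,A)$ with the convolution product $g*h=m_A(g\otimes h)\Delta_B$, and let $\mathfrak G^B(A)$ be the set of homotopy types of its elements, a functor on $\mathit{ho\,cdgA}$. **Theorem.** All monoids $\mathcal G^{\omega_f}_\otimes(A)$, $\mathcal G^{\omega}_\otimes(A)$, $\mathcal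 G^B(A)$, $\mathfrak G^{\omega_f}_\otimes(A)$, $\mathfrak G^{\omega}_\otimes(A)$, $\mathfrak G^B(A)$ are groups, so that one has functors $$\mathcal E^{\omega_f},\mathcal E^{\omega}:\mathit{cdgA}\to\mathit{dgA},\qquad \mathcal G^{\omega_f}_\otimes,\mathcal G^{\omega}_\otimes,\mathcal G^B:\mathit{cdgA}\to\mathit{Grp},\qquad \mathfrak G^{\omega_f}_\otimes,\mathfrak G^{\omega}_\otimes,\mathfrak G^B:\mathit{ho\,cdgA}\to\mathit{Grp},$$ and there are natural isomorphisms of functors $$\mathcal E^{\omega_f}\cong\mathcal E^{\omega},\qquad \mathcal G^{\omega_f}_\otimes\cong\mathcal G^{\omega}_\otimes,\qquad \mathfrak G^{\omega_f}_\otimes\cong\mathfrak G^{\omega}_\otimes .$$ Moreover, $\mathcal G^{\omega_f}_\otimes\cong\mathcal G^B$ and $\mathfrak G^{\omega_f}_\otimes\cong\mathfrak G^B$, so that $\mathfrak G^B$ is recovered from the finite-dimensional right dg-comodules over $B$. -/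

import Mathlib

open TensorProduct CategoryTheory

universe u v w

noncomputable section

namespace DGRec

/-! ### Signs and cochain complexes -/

/-- The sign `(-1)^n`, as a scalar. -/
def sg (k : Type u) [Field k] (n : ℤ) : k := (-1) ^ n

section sg

variable {k : Type u} [Field k]

theorem sg_add (m n : ℤ) : sg k (m + n) = sg k m * sg k n :=
  zpow_add₀ (neg_ne_zero.mpr one_ne_zero) m n

theorem sg_zero : sg k 0 = 1 := zpow_zero _

theorem sg_one : sg k 1 = -1 := zpow_one _

theorem sg_neg (n : ℤ) : sg k (-n) = sg k n := by
  rcases Int.even_or_odd n with h | h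
  · rw [sg, sg, h.neg.neg_one_zpow, h.neg_one_zpow]
  · rw [sg, sg, h.neg.neg_one_zpow, h.neg_one_zpow]

theorem sg_mul_self (n : ℤ) : sg k n * sg k n = 1 := by
  rw [← sg_add, sg, (Even.add_self n).neg_one_zpow]

theorem sg_eq {m n : ℤ} (l : ℤ) (h : m = n + (l + l)) : sg k m = sg k n := by
  rw [h, sg_add, sg_add l, sg_mul_self, mul_one]

end sg

/-- The structure of a cochain complex on a `k`-module `V`: a decomposition `V = ⨁ₙ Vⁿ` together with
a differential of degree `1`. -/
structure DGStr (k : Type u) [Field k] (V : Type v) [AddCommGroup V] [Module k V] where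
  /-- the homogeneous part of degree `n` -/
  gr : ℤ → Submodule k V
  internal : DirectSum.IsInternal gr
  /-- the differential -/
  d : V →ₗ[k] V
  d_mem : ∀ {n : ℤ} {x : V}, x ∈ gr n → d x ∈ gr (n + 1)
  d_d : ∀ x : V, d (d x) = 0

namespace DGStr

variable {k : Type u} [Field k]
variable {V : Type v} [AddCommGroup V] [Module k V]
variable {W : Type w} [AddCommGroup W] [Module k W]

theorem bijective (S : DGStr k V) : Function.Bijective (DirectSum.coeLinearMap S.gr) :=
  S.internal

/-- A linear map given on the homogeneous parts. -/
def lift (S : DGStr k V) (f : ∀ i : ℤ, S.gr i →ₗ[k] W) : V →ₗ[k] W :=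
  DirectSum.toModule k ℤ W f ∘ₗ
    (LinearEquiv.ofBijective (DirectSum.coeLinearMap S.gr) S.bijective).symm.toLinearMap

theorem lift_apply (S : DGStr k V) (f : ∀ i : ℤ, S.gr i →ₗ[k] W) {i : ℤ} {x : V}
    (hx : x ∈ S.gr i) : S.lift f x = f i ⟨x, hx⟩ := by
  have h : (LinearEquiv.ofBijective (DirectSum.coeLinearMap S.gr) S.bijective).symm x
      = DirectSum.lof k ℤ (fun i => S.gr i) i ⟨x, hx⟩ := by
    rw [LinearEquiv.symm_apply_eq]
    simp
  simp [lift, h]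

theorem induction (S : DGStr k V) {p : V → Prop} (hom : ∀ i x, x ∈ S.gr i → p x)
    (add : ∀ x y, p x → p y → p (x + y)) (x : V) : p x := by
  have hx : x ∈ ⨆ i, S.gr i := by
    rw [S.internal.submodule_iSup_eq_top]; trivial
  exact Submodule.iSup_induction S.gr (motive := p) hx hom (hom 0 0 (Submodule.zero_mem _)) add

theorem ext_hom (S : DGStr k V) {f g : V →ₗ[k] W} (h : ∀ i x, x ∈ S.gr i → f x = g x) :
    f = g := by
  ext x
  exact S.induction (p := fun x => f x = g x) h (fun x y hx hy => by simp [hx, hy]) x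

theorem ext_tmul {X : Type*} [AddCommGroup X] [Module k X] (S : DGStr k V) (T : DGStr k W)
    {f g : V ⊗[k] W →ₗ[k] X}
    (h : ∀ i j x y, x ∈ S.gr i → y ∈ T.gr j → f (x ⊗ₜ y) = g (x ⊗ₜ y)) : f = g := by
  refine TensorProduct.ext (S.ext_hom fun i x hx => T.ext_hom fun j y hy => ?_)
  exact h i j x y hx hy

/-- A sufficient criterion for a family of submodules to be a direct sum decomposition. -/
theorem isInternal_of {gr : ℤ → Submodule k V} (D : V →ₗ[k] DirectSum ℤ (fun _ => V))
    (hD : ∀ i x, x ∈ gr i → D x = DirectSum.lof k ℤ (fun _ => V) i x)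
    (htop : ∀ x : V, x ∈ ⨆ i, gr i) : DirectSum.IsInternal gr := by
  refine DirectSum.isInternal_submodule_of_iSupIndep_of_iSup_eq_top ?_ (by
    rw [eq_top_iff]; intro x _; exact htop x)
  refine iSupIndep_of_dfinsupp_lsum_injective _ ?_
  have key : D ∘ₗ (DFinsupp.lsum ℕ fun i => (gr i).subtype)
      = DirectSum.lmap (fun i => (gr i).subtype) := by
    refine DFinsupp.lhom_ext fun i x => ?_
    have := hD i x x.2
    simp only [LinearMap.comp_apply]
    rw [DFinsupp.lsum_single]
    refine this.trans ?_
    exact (DirectSum.lmap_lof (R := k) (fun i => (gr i).subtype) i x).symm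
  have hinj : Function.Injective (DirectSum.lmap (R := k) (fun i => (gr i).subtype)) :=
    (DirectSum.lmap_injective _).2 fun i => Subtype.val_injective
  intro a b hab
  apply hinj
  rw [← key]
  exact congrArg D hab

/-- The ground field, in degree zero, with zero differential. -/
def unit (k : Type u) [Field k] : DGStr k k where
  gr n := if n = 0 then ⊤ else ⊥
  internal := by
    refine isInternal_of (DirectSum.lof k ℤ (fun _ => k) 0) ?_ ?_
    · intro i x hx
      by_cases h : i = 0
      · subst h; rfl
      · rw [if_neg h, Submodule.mem_bot] at hx
        simp [hx]
    · intro x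
      exact Submodule.mem_iSup_of_mem 0 (by simp)
  d := 0
  d_mem _ := by simp
  d_d _ := by simp

/-- The operator `x ↦ (-1)^{n|x|} x`. -/
def sgn (S : DGStr k V) (n : ℤ) : V →ₗ[k] V :=
  S.lift fun i => sg k (n * i) • (S.gr i).subtype

theorem sgn_apply (S : DGStr k V) (n : ℤ) {i : ℤ} {x : V} (hx : x ∈ S.gr i) :
    S.sgn n x = sg k (n * i) • x := by
  simp [sgn, S.lift_apply _ hx]

/-- A bilinear map given on the homogeneous parts. -/
def lift₂ {X : Type*} [AddCommGroup X] [Module k X] (S : DGStr k V) (T : DGStr k W)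
    (F : ℤ → ℤ → V →ₗ[k] W →ₗ[k] X) : V →ₗ[k] W →ₗ[k] X :=
  S.lift fun i => (T.lift fun j => (F i j).flip ∘ₗ (T.gr j).subtype).flip ∘ₗ (S.gr i).subtype

theorem lift₂_apply {X : Type*} [AddCommGroup X] [Module k X] (S : DGStr k V) (T : DGStr k W)
    (F : ℤ → ℤ → V →ₗ[k] W →ₗ[k] X) {i j : ℤ} {x : V} {y : W} (hx : x ∈ S.gr i)
    (hy : y ∈ T.gr j) : S.lift₂ T F x y = F i j x y := by
  simp [lift₂, S.lift_apply _ hx, T.lift_apply _ hy]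

/-- The Koszul symmetry `τ(x ⊗ y) = (-1)^{|x||y|} y ⊗ x`. -/
def tau (S : DGStr k V) (T : DGStr k W) : V ⊗[k] W →ₗ[k] W ⊗[k] V :=
  TensorProduct.lift <| S.lift₂ T fun i j => sg k (i * j) • (TensorProduct.mk k W V).flip

theorem tau_apply (S : DGStr k V) (T : DGStr k W) {i j : ℤ} {x : V} {y : W}
    (hx : x ∈ S.gr i) (hy : y ∈ T.gr j) :
    S.tau T (x ⊗ₜ y) = sg k (i * j) • (y ⊗ₜ[k] x) := by
  simp [tau, S.lift₂_apply T _ hx hy]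

/-- The homogeneous part of degree `n` of a tensor product is the span of the `x ⊗ y` with
`|x| + |y| = n`. -/
def tensorGr (S : DGStr k V) (T : DGStr k W) (n : ℤ) : Submodule k (V ⊗[k] W) :=
  Submodule.span k {z | ∃ i j x y, i + j = n ∧ x ∈ S.gr i ∧ y ∈ T.gr j ∧ x ⊗ₜ[k] y = z}

theorem tmul_mem (S : DGStr k V) (T : DGStr k W) {i j n : ℤ} (h : i + j = n) {x : V} {y : W}
    (hx : x ∈ S.gr i) (hy : y ∈ T.gr j) : x ⊗ₜ[k] y ∈ S.tensorGr T n :=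
  Submodule.subset_span ⟨i, j, x, y, h, hx, hy, rfl⟩

theorem tensorGr_induction (S : DGStr k V) (T : DGStr k W) {n : ℤ} {p : V ⊗[k] W → Prop}
    (hom : ∀ i j x y, i + j = n → x ∈ S.gr i → y ∈ T.gr j → p (x ⊗ₜ y))
    (zero : p 0) (add : ∀ x y, p x → p y → p (x + y)) (smul : ∀ (c : k) x, p x → p (c • x))
    {z : V ⊗[k] W} (hz : z ∈ S.tensorGr T n) : p z := by
  refine Submodule.span_induction ?_ zero (fun x y _ _ => add x y) (fun c x _ => smul c x) hz
  rintro _ ⟨i, j, x, y, h, hx, hy, rfl⟩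
  exact hom i j x y h hx hy

/-- A linear map sending the `x ⊗ y` with `|x| + |y| = n` into a submodule sends the whole
homogeneous part of degree `n` there. -/
theorem tensorGr_map (S : DGStr k V) (T : DGStr k W) {n : ℤ} {X : Type*} [AddCommGroup X]
    [Module k X] (f : V ⊗[k] W →ₗ[k] X) (P : Submodule k X)
    (hom : ∀ i j x y, i + j = n → x ∈ S.gr i → y ∈ T.gr j → f (x ⊗ₜ y) ∈ P)
    {z : V ⊗[k] W} (hz : z ∈ S.tensorGr T n) : f z ∈ P :=
  S.tensorGr_induction T (p := fun z => f z ∈ P) hom (by simp)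
    (fun x y hx hy => by rw [map_add]; exact P.add_mem hx hy)
    (fun c x hx => by rw [map_smul]; exact P.smul_mem c hx) hz

/-- Two linear maps agree on the homogeneous part of degree `n` if they agree on the `x ⊗ y`. -/
theorem tensorGr_ext (S : DGStr k V) (T : DGStr k W) {n : ℤ} {X : Type*} [AddCommMonoid X]
    [Module k X] {f g : V ⊗[k] W →ₗ[k] X}
    (hom : ∀ i j x y, i + j = n → x ∈ S.gr i → y ∈ T.gr j → f (x ⊗ₜ y) = g (x ⊗ₜ y))
    {z : V ⊗[k] W} (hz : z ∈ S.tensorGr T n) : f z = g z :=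
  S.tensorGr_induction T (p := fun z => f z = g z) hom (by simp)
    (fun x y hx hy => by rw [map_add, map_add, hx, hy])
    (fun c x hx => by rw [map_smul, map_smul, hx]) hz

theorem tensor_internal (S : DGStr k V) (T : DGStr k W) :
    DirectSum.IsInternal (S.tensorGr T) := by
  let D : V ⊗[k] W →ₗ[k] DirectSum ℤ (fun _ => V ⊗[k] W) := TensorProduct.lift <| S.lift₂ T
    fun i j => (TensorProduct.mk k V W).compr₂ (DirectSum.lof k ℤ (fun _ => V ⊗[k] W) (i + j))
  have hD : ∀ i j x y, x ∈ S.gr i → y ∈ T.gr j →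
      D (x ⊗ₜ y) = DirectSum.lof k ℤ (fun _ => V ⊗[k] W) (i + j) (x ⊗ₜ y) := by
    intro i j x y hx hy
    simp [D, S.lift₂_apply T _ hx hy]
  refine isInternal_of D ?_ ?_
  · intro n z hz
    refine S.tensorGr_ext T ?_ hz
    rintro i j x y rfl hx hy
    exact hD i j x y hx hy
  · intro z
    induction z with
    | zero => exact Submodule.zero_mem _
    | add a b ha hb => exact Submodule.add_mem _ ha hb
    | tmul x y =>
      refine S.induction (p := fun x => x ⊗ₜ[k] y ∈ ⨆ i, S.tensorGr T i) ?_ ?_ x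
      · intro i x hx
        refine T.induction (p := fun y => x ⊗ₜ[k] y ∈ ⨆ i, S.tensorGr T i) ?_ ?_ y
        · intro j y hy
          exact Submodule.mem_iSup_of_mem (i + j) (S.tmul_mem T rfl hx hy)
        · intro a b ha hb
          rw [TensorProduct.tmul_add]; exact Submodule.add_mem _ ha hb
      · intro a b ha hb
        rw [TensorProduct.add_tmul]; exact Submodule.add_mem _ ha hb

/-- The differential `d ⊗ 𝕀 + 𝕀 ⊗ d`, that is `x ⊗ y ↦ dx ⊗ y + (-1)^{|x|} x ⊗ dy`. -/
def tensorD (S : DGStr k V) (T : DGStr k W) : V ⊗[k] W →ₗ[k] V ⊗[k] W :=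
  TensorProduct.map S.d LinearMap.id + TensorProduct.map (S.sgn 1) T.d

theorem tensorD_apply (S : DGStr k V) (T : DGStr k W) {i : ℤ} {x : V} (hx : x ∈ S.gr i) (y : W) :
    S.tensorD T (x ⊗ₜ y) = S.d x ⊗ₜ y + sg k i • (x ⊗ₜ T.d y) := by
  simp [tensorD, S.sgn_apply 1 hx, TensorProduct.smul_tmul']

/-- The tensor product of cochain complexes. -/
def tensor (S : DGStr k V) (T : DGStr k W) : DGStr k (V ⊗[k] W) where
  gr := S.tensorGr T
  internal := S.tensor_internal T
  d := S.tensorD T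
  d_mem {n z} hz := by
    refine S.tensorGr_map T _ _ ?_ hz
    rintro i j x y rfl hx hy
    rw [S.tensorD_apply T hx]
    exact Submodule.add_mem _ (S.tmul_mem T (by ring) (S.d_mem hx) hy)
      (Submodule.smul_mem _ _ (S.tmul_mem T (by ring) hx (T.d_mem hy)))
  d_d z := by
    have h : S.tensorD T ∘ₗ S.tensorD T = 0 := by
      refine S.ext_tmul T fun i j x y hx hy => ?_
      simp [S.tensorD_apply T hx, S.tensorD_apply T (S.d_mem hx), S.d_d, T.d_d, sg_add, sg_one]
    exact LinearMap.congr_fun h z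

@[simp] theorem tensor_gr (S : DGStr k V) (T : DGStr k W) : (S.tensor T).gr = S.tensorGr T := rfl

@[simp] theorem tensor_d (S : DGStr k V) (T : DGStr k W) : (S.tensor T).d = S.tensorD T := rfl

/-- `Hom(V, W)ⁿ`: the linear maps of degree `n`. -/
def homDeg (S : DGStr k V) (T : DGStr k W) (n : ℤ) : Submodule k (V →ₗ[k] W) where
  carrier := {f | ∀ i x, x ∈ S.gr i → f x ∈ T.gr (i + n)}
  add_mem' hf hg i x hx := Submodule.add_mem _ (hf i x hx) (hg i x hx)
  zero_mem' _ _ _ := Submodule.zero_mem _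
  smul_mem' c _ hf i x hx := Submodule.smul_mem _ c (hf i x hx)

/-- The differential of `Hom(V, W)`, sending `f` of degree `n` to `d ∘ f - (-1)ⁿ f ∘ d`. In terms of
the operators `σ = (-1)^{|x|}` it is `f ↦ d ∘ f - σ ∘ f ∘ σ ∘ d`. -/
def homD (S : DGStr k V) (T : DGStr k W) : (V →ₗ[k] W) →ₗ[k] (V →ₗ[k] W) :=
  LinearMap.llcomp k V W W T.d
    - LinearMap.llcomp k V W W (T.sgn 1) ∘ₗ LinearMap.lcomp k W (S.sgn 1 ∘ₗ S.d)

theorem homD_eq (S : DGStr k V) (T : DGStr k W) (f : V →ₗ[k] W) :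
    S.homD T f = T.d ∘ₗ f - T.sgn 1 ∘ₗ f ∘ₗ S.sgn 1 ∘ₗ S.d := rfl

theorem sgn_comp (S : DGStr k V) (T : DGStr k W) (m : ℤ) {n : ℤ} {f : V →ₗ[k] W}
    (hf : f ∈ S.homDeg T n) : T.sgn m ∘ₗ f = sg k (m * n) • f ∘ₗ S.sgn m := by
  refine S.ext_hom fun i x hx => ?_
  simp only [LinearMap.comp_apply, LinearMap.smul_apply, S.sgn_apply m hx,
    T.sgn_apply m (hf i x hx), map_smul, smul_smul, ← sg_add]
  congr 2
  ring

theorem sgn_sgn (S : DGStr k V) (m : ℤ) (x : V) : S.sgn m (S.sgn m x) = x := by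
  refine S.induction (p := fun x => S.sgn m (S.sgn m x) = x) ?_ ?_ x
  · intro i x hx
    simp [S.sgn_apply m hx, smul_smul, sg_mul_self]
  · intro x y hx hy
    simp [hx, hy]

theorem sgn_zero (S : DGStr k V) : S.sgn 0 = LinearMap.id := by
  refine S.ext_hom fun i x hx => ?_
  simp [S.sgn_apply 0 hx, sg_zero]

theorem homD_apply (S : DGStr k V) (T : DGStr k W) {n : ℤ} {f : V →ₗ[k] W}
    (hf : f ∈ S.homDeg T n) (x : V) :
    S.homD T f x = T.d (f x) - sg k n • f (S.d x) := by
  have h := LinearMap.congr_fun (S.sgn_comp T 1 hf) (S.sgn 1 (S.d x))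
  simp only [LinearMap.comp_apply, LinearMap.smul_apply, sgn_sgn, one_mul] at h
  simp [homD_eq, h]

theorem homD_mem (S : DGStr k V) (T : DGStr k W) {n : ℤ} {f : V →ₗ[k] W}
    (hf : f ∈ S.homDeg T n) : S.homD T f ∈ S.homDeg T (n + 1) := by
  intro i x hx
  rw [S.homD_apply T hf]
  refine Submodule.sub_mem _ ?_ (Submodule.smul_mem _ _ ?_)
  · have := T.d_mem (hf i x hx)
    rwa [add_assoc] at this
  · have := hf _ _ (S.d_mem hx)
    rwa [add_assoc, add_comm 1 n] at this

theorem d_sgn (S : DGStr k V) (x : V) : S.sgn 1 (S.d x) = - S.d (S.sgn 1 x) := by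
  have h : S.d ∈ S.homDeg S 1 := fun i x hx => S.d_mem hx
  have := LinearMap.congr_fun (S.sgn_comp S 1 h) x
  simpa [sg_one] using this

theorem homD_homD (S : DGStr k V) (T : DGStr k W) (f : V →ₗ[k] W) :
    S.homD T (S.homD T f) = 0 := by
  ext x
  simp [homD_eq, T.d_d, S.d_d, d_sgn]

theorem homD_comp {X : Type*} [AddCommGroup X] [Module k X] (S : DGStr k V) (T : DGStr k W)
    (U : DGStr k X) {n : ℤ} {g : W →ₗ[k] X} (hg : g ∈ T.homDeg U n) (f : V →ₗ[k] W) :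
    S.homD U (g ∘ₗ f) = T.homD U g ∘ₗ f + sg k n • g ∘ₗ S.homD T f := by
  ext x
  have h := LinearMap.congr_fun (T.sgn_comp U 1 hg) (f (S.sgn 1 (S.d x)))
  simp only [LinearMap.comp_apply, LinearMap.smul_apply, one_mul] at h
  simp [homD_apply T U hg, homD_eq S, smul_sub, h]

theorem comp_mem {X : Type*} [AddCommGroup X] [Module k X] (S : DGStr k V) (T : DGStr k W)
    (U : DGStr k X) {m n l : ℤ} (h : m + n = l) {g : W →ₗ[k] X} {f : V →ₗ[k] W}
    (hg : g ∈ T.homDeg U m) (hf : f ∈ S.homDeg T n) : g ∘ₗ f ∈ S.homDeg U l := by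
  intro i x hx
  have := hg _ _ (hf i x hx)
  rwa [add_assoc, add_comm n m, h] at this

theorem homD_id (S : DGStr k V) : S.homD S LinearMap.id = 0 := by
  ext x
  simp [homD_eq, sgn_sgn]

theorem id_mem (S : DGStr k V) : LinearMap.id ∈ S.homDeg S 0 := by
  intro i x hx
  simpa using hx

/-- The projection to the homogeneous part of degree `n`. -/
def proj (S : DGStr k V) (n : ℤ) : V →ₗ[k] V :=
  S.lift fun i => if i = n then (S.gr i).subtype else 0

theorem proj_apply (S : DGStr k V) (n : ℤ) {i : ℤ} {x : V} (hx : x ∈ S.gr i) :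
    S.proj n x = if i = n then x else 0 := by
  rw [proj, S.lift_apply _ hx]
  split_ifs <;> rfl

end DGStr

/-! ### Dg-algebras, cdg-algebras and cdg-Hopf algebras -/

/-- A dg-algebra over `k`. -/
structure DGAlg (k : Type u) [Field k] where
  carrier : Type v
  [ring : Ring carrier]
  [alg : Algebra k carrier]
  /-- the underlying cochain complex -/
  str : DGStr k carrier
  one_mem : 1 ∈ str.gr 0
  mul_mem : ∀ {i j : ℤ} {x y : carrier}, x ∈ str.gr i → y ∈ str.gr j → x * y ∈ str.gr (i + j)
  leibniz : ∀ {i : ℤ} {x : carrier} (y : carrier), x ∈ str.gr i →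
    str.d (x * y) = str.d x * y + sg k i • (x * str.d y)

instance (k : Type u) [Field k] : CoeSort (DGAlg.{u, v} k) (Type v) := ⟨DGAlg.carrier⟩

attribute [instance] DGAlg.ring DGAlg.alg

/-- A cdg-algebra over `k`: a dg-algebra that is commutative in the graded sense. -/
structure CDGAlg (k : Type u) [Field k] extends DGAlg.{u, v} k where
  comm : ∀ {i j : ℤ} {x y : carrier}, x ∈ str.gr i → y ∈ str.gr j →
    x * y = sg k (i * j) • (y * x)

instance (k : Type u) [Field k] : CoeSort (CDGAlg.{u, v} k) (Type v) := ⟨fun A => A.carrier⟩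

section Alg

variable {k : Type u} [Field k]

/-- Morphisms of dg-algebras: algebra maps of degree `0` commuting with the differentials. -/
@[ext]
structure DGAlg.Hom (A : DGAlg.{u, v} k) (A' : DGAlg.{u, w} k) where
  toFun : A →ₐ[k] A'
  map_gr : ∀ (i : ℤ) (x : A), x ∈ A.str.gr i → toFun x ∈ A'.str.gr i
  map_d : ∀ x : A, toFun (A.str.d x) = A'.str.d (toFun x)

/-- The category `dgA(k)` of dg-algebras. -/
instance : Category (DGAlg.{u, v} k) where
  Hom A A' := DGAlg.Hom A A'
  id A := ⟨AlgHom.id k A, fun _ _ h => h, fun _ => rfl⟩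
  comp f g := ⟨g.toFun.comp f.toFun, fun i x h => g.map_gr i _ (f.map_gr i x h),
    fun x => by simp [f.map_d, g.map_d]⟩

/-- The category `cdgA(k)` of cdg-algebras, a full subcategory of `dgA(k)`. -/
instance : Category (CDGAlg.{u, v} k) where
  Hom A A' := DGAlg.Hom A.toDGAlg A'.toDGAlg
  id A := ⟨AlgHom.id k A, fun _ _ h => h, fun _ => rfl⟩
  comp f g := ⟨g.toFun.comp f.toFun, fun i x h => g.map_gr i _ (f.map_gr i x h),
    fun x => by simp [f.map_d, g.map_d]⟩

@[ext]
theorem CDGAlg.hom_ext {A A' : CDGAlg.{u, v} k} {f g : A ⟶ A'}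
    (h : ∀ x, f.toFun x = g.toFun x) : f = g :=
  DGAlg.Hom.ext (AlgHom.ext h)

@[ext]
theorem DGAlg.hom_ext {A A' : DGAlg.{u, v} k} {f g : A ⟶ A'}
    (h : ∀ x, f.toFun x = g.toFun x) : f = g :=
  DGAlg.Hom.ext (AlgHom.ext h)

/-- The underlying linear map of a morphism of cdg-algebras. -/
def CDGAlg.lin {A A' : CDGAlg.{u, v} k} (f : A ⟶ A') : A →ₗ[k] A' := f.toFun.toLinearMap

@[simp] theorem CDGAlg.lin_id (A : CDGAlg.{u, v} k) : CDGAlg.lin (𝟙 A) = LinearMap.id := rfl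

@[simp] theorem CDGAlg.lin_comp {A A' A'' : CDGAlg.{u, v} k} (f : A ⟶ A') (g : A' ⟶ A'') :
    CDGAlg.lin (f ≫ g) = CDGAlg.lin g ∘ₗ CDGAlg.lin f := rfl

@[simp] theorem CDGAlg.lin_one {A A' : CDGAlg.{u, v} k} (f : A ⟶ A') : CDGAlg.lin f 1 = 1 :=
  map_one f.toFun

@[simp] theorem CDGAlg.lin_mul {A A' : CDGAlg.{u, v} k} (f : A ⟶ A') (x y : A) :
    CDGAlg.lin f (x * y) = CDGAlg.lin f x * CDGAlg.lin f y :=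
  map_mul f.toFun x y

theorem CDGAlg.lin_gr {A A' : CDGAlg.{u, v} k} (f : A ⟶ A') {i : ℤ} {x : A}
    (hx : x ∈ A.str.gr i) : CDGAlg.lin f x ∈ A'.str.gr i :=
  f.map_gr i x hx

theorem CDGAlg.lin_d {A A' : CDGAlg.{u, v} k} (f : A ⟶ A') (x : A) :
    CDGAlg.lin f (A.str.d x) = A'.str.d (CDGAlg.lin f x) :=
  f.map_d x

theorem DGAlg.d_one (A : DGAlg.{u, v} k) : A.str.d 1 = 0 := by
  have h := A.leibniz 1 A.one_mem
  simp only [mul_one, one_mul, sg_zero, one_smul] at h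
  simpa using h

end Alg

section Mul

variable {k : Type u} [Field k]
variable {M : Type*} [AddCommGroup M] [Module k M] {N : Type*} [AddCommGroup N] [Module k N]
variable {A : Type*} [Ring A] [Algebra k A]

/-- The composite `(𝕀 ⊗ 𝕀 ⊗ m_A) ∘ (𝕀 ⊗ τ ⊗ 𝕀)`, that is
`(x ⊗ a) ⊗ (y ⊗ b) ↦ (-1)^{|a||y|} (x ⊗ y) ⊗ ab`. -/
def twMul (M : Type*) [AddCommGroup M] [Module k M] (S : DGStr k A) (T : DGStr k N) :
    (M ⊗[k] A) ⊗[k] (N ⊗[k] A) →ₗ[k] (M ⊗[k] N) ⊗[k] A :=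
  LinearMap.lTensor (M ⊗[k] N) (LinearMap.mul' k A)
    ∘ₗ (TensorProduct.assoc k (M ⊗[k] N) A A).toLinearMap
    ∘ₗ LinearMap.rTensor A ((TensorProduct.assoc k M N A).symm.toLinearMap
      ∘ₗ LinearMap.lTensor M (S.tau T) ∘ₗ (TensorProduct.assoc k M A N).toLinearMap)
    ∘ₗ (TensorProduct.assoc k (M ⊗[k] A) N A).symm.toLinearMap

theorem twMul_apply (S : DGStr k A) (T : DGStr k N) {i j : ℤ} (x : M) {a : A} {y : N} (b : A)
    (ha : a ∈ S.gr i) (hy : y ∈ T.gr j) :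
    twMul M S T ((x ⊗ₜ a) ⊗ₜ (y ⊗ₜ b)) = sg k (i * j) • ((x ⊗ₜ y) ⊗ₜ (a * b)) := by
  simp [twMul, S.tau_apply T ha hy, TensorProduct.tmul_smul, TensorProduct.smul_tmul']

/-- The multiplication `m_{A ⊗ A} = (m_A ⊗ m_A) ∘ (𝕀 ⊗ τ ⊗ 𝕀)` of `A ⊗ A`, that is
`(a ⊗ a') ⊗ (b ⊗ b') ↦ (-1)^{|a'||b|} ab ⊗ a'b'`. -/
def tensorMul (S : DGStr k A) : (A ⊗[k] A) ⊗[k] (A ⊗[k] A) →ₗ[k] A ⊗[k] A :=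
  LinearMap.rTensor A (LinearMap.mul' k A) ∘ₗ twMul A S S

theorem tensorMul_apply (S : DGStr k A) {i j : ℤ} (a : A) {a' b : A} (b' : A)
    (ha : a' ∈ S.gr i) (hb : b ∈ S.gr j) :
    tensorMul S ((a ⊗ₜ a') ⊗ₜ (b ⊗ₜ b')) = sg k (i * j) • ((a * b) ⊗ₜ (a' * b')) := by
  simp [tensorMul, twMul_apply S S a b' ha hb]

end Mul

/-- A cdg-Hopf algebra over `k`. -/
structure CDGHopf (k : Type u) [Field k] extends CDGAlg.{u, u} k where
  [coalg : Coalgebra k carrier]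
  counit_gr : ∀ {i : ℤ} {x : carrier}, i ≠ 0 → x ∈ str.gr i → Coalgebra.counit (R := k) x = 0
  counit_d : ∀ x : carrier, Coalgebra.counit (R := k) (str.d x) = 0
  comul_gr : ∀ {i : ℤ} {x : carrier}, x ∈ str.gr i →
    Coalgebra.comul (R := k) x ∈ (str.tensor str).gr i
  comul_d : ∀ x : carrier,
    Coalgebra.comul (R := k) (str.d x) = (str.tensor str).d (Coalgebra.comul x)
  counit_one : Coalgebra.counit (R := k) (1 : carrier) = 1
  counit_mul : ∀ x y : carrier, Coalgebra.counit (R := k) (x * y)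
    = Coalgebra.counit (R := k) x * Coalgebra.counit (R := k) y
  comul_one : Coalgebra.comul (R := k) (1 : carrier) = 1 ⊗ₜ 1
  comul_mul : ∀ x y : carrier, Coalgebra.comul (R := k) (x * y)
    = tensorMul str (Coalgebra.comul x ⊗ₜ Coalgebra.comul y)
  /-- the antipode -/
  antipode : carrier →ₗ[k] carrier
  antipode_gr : ∀ {i : ℤ} {x : carrier}, x ∈ str.gr i → antipode x ∈ str.gr i
  antipode_d : ∀ x : carrier, antipode (str.d x) = str.d (antipode x)
  mul_antipode_left : ∀ x : carrier, LinearMap.mul' k carrier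
    (LinearMap.rTensor carrier antipode (Coalgebra.comul x))
      = algebraMap k carrier (Coalgebra.counit x)
  mul_antipode_right : ∀ x : carrier, LinearMap.mul' k carrier
    (LinearMap.lTensor carrier antipode (Coalgebra.comul x))
      = algebraMap k carrier (Coalgebra.counit x)

instance (k : Type u) [Field k] : CoeSort (CDGHopf k) (Type u) := ⟨fun B => B.carrier⟩

attribute [instance] CDGHopf.coalg

/-! ### Dg-comodules -/

/-- A right dg-comodule over `B`. -/
structure DGComod {k : Type u} [Field k] (B : CDGHopf k) where
  carrier : Type u
  [acg : AddCommGroup carrier]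
  [mod : Module k carrier]
  /-- the underlying cochain complex -/
  str : DGStr k carrier
  /-- the coaction -/
  coact : carrier →ₗ[k] carrier ⊗[k] B
  coact_gr : ∀ {i : ℤ} {x : carrier}, x ∈ str.gr i → coact x ∈ (str.tensor B.str).gr i
  coact_d : ∀ x : carrier, coact (str.d x) = (str.tensor B.str).d (coact x)
  coact_coact : ∀ x : carrier, TensorProduct.assoc k carrier B B
    (LinearMap.rTensor B coact (coact x)) = LinearMap.lTensor carrier Coalgebra.comul (coact x)
  counit_coact : ∀ x : carrier, LinearMap.lTensor carrier Coalgebra.counit (coact x) = x ⊗ₜ (1 : k)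

instance {k : Type u} [Field k] (B : CDGHopf k) : CoeSort (DGComod B) (Type u) :=
  ⟨DGComod.carrier⟩

attribute [instance] DGComod.acg DGComod.mod

section TensorLemmas

variable {k : Type u} [Field k]
variable {M : Type*} [AddCommGroup M] [Module k M] {N : Type*} [AddCommGroup N] [Module k N]
variable {M' : Type*} [AddCommGroup M'] [Module k M'] {N' : Type*} [AddCommGroup N'] [Module k N']
variable {A : DGAlg.{u, v} k}

theorem ext_four {C D X : Type*} [AddCommGroup C] [Module k C] [AddCommGroup D] [Module k D]
    [AddCommGroup X] [Module k X] (R : DGStr k M) (S : DGStr k C) (T : DGStr k N) (U : DGStr k D)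
    {f g : (M ⊗[k] C) ⊗[k] (N ⊗[k] D) →ₗ[k] X}
    (h : ∀ i1 i2 j1 j2 x a y b, x ∈ R.gr i1 → a ∈ S.gr i2 → y ∈ T.gr j1 → b ∈ U.gr j2 →
      f ((x ⊗ₜ a) ⊗ₜ (y ⊗ₜ b)) = g ((x ⊗ₜ a) ⊗ₜ (y ⊗ₜ b))) : f = g := by
  refine TensorProduct.ext (R.ext_tmul S fun i1 i2 x a hx ha =>
    T.ext_tmul U fun j1 j2 y b hy hb => ?_)
  exact h i1 i2 j1 j2 x a y b hx ha hy hb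

theorem twMul_mem (R : DGStr k M) (T : DGStr k N) {i j n : ℤ} (hn : i + j = n) {z : M ⊗[k] A}
    {w : N ⊗[k] A} (hz : z ∈ (R.tensor A.str).gr i) (hw : w ∈ (T.tensor A.str).gr j) :
    twMul M A.str T (z ⊗ₜ w) ∈ ((R.tensor T).tensor A.str).gr n := by
  refine R.tensorGr_map A.str (twMul M A.str T ∘ₗ (TensorProduct.mk k _ _).flip w) _ ?_ hz
  intro i1 i2 x a h1 hx ha
  refine T.tensorGr_map A.str (twMul M A.str T ∘ₗ (TensorProduct.mk k _ _ (x ⊗ₜ a))) _ ?_ hw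
  intro j1 j2 y b h2 hy hb
  simp only [LinearMap.comp_apply, TensorProduct.mk_apply]
  rw [twMul_apply A.str T x b ha hy]
  exact Submodule.smul_mem _ _ (DGStr.tmul_mem _ _ (by rw [← hn, ← h1, ← h2]; ring)
    (R.tmul_mem T rfl hx hy) (A.mul_mem ha hb))

/-- `twMul` is a cochain map. -/
theorem tensorD_twMul (R : DGStr k M) (T : DGStr k N) :
    (R.tensor T).tensorD A.str ∘ₗ twMul M A.str T
      = twMul M A.str T ∘ₗ (R.tensor A.str).tensorD (T.tensor A.str) := by
  refine ext_four R A.str T A.str fun i1 i2 j1 j2 x a y b hx ha hy hb => ?_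
  have hxa : x ⊗ₜ[k] a ∈ (R.tensor A.str).gr (i1 + i2) := R.tmul_mem A.str rfl hx ha
  have hxy : x ⊗ₜ[k] y ∈ (R.tensor T).gr (i1 + j1) := R.tmul_mem T rfl hx hy
  simp only [LinearMap.comp_apply, twMul_apply A.str T _ _ ha hy, map_smul,
    DGStr.tensorD_apply _ _ hxy, DGStr.tensorD_apply _ _ hxa, DGStr.tensor_d,
    DGStr.tensorD_apply _ _ hx, DGStr.tensorD_apply _ _ hy, A.leibniz b ha,
    TensorProduct.add_tmul, TensorProduct.tmul_add, TensorProduct.tmul_smul, map_add,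
    ← TensorProduct.smul_tmul', twMul_apply A.str T _ _ (A.str.d_mem ha) hy,
    twMul_apply A.str T _ _ ha (T.d_mem hy), smul_add, smul_smul]
  simp only [sg_add, mul_add, add_mul, one_mul, mul_one]
  have h1 := sg_mul_self (k := k) i2
  match_scalars
  · ring
  · linear_combination (-sg k i1 * sg k (i2 * j1)) * h1
  · ring
  · ring

/-- The tensor product of two cochain maps is a cochain map. -/
theorem tensorD_map (R : DGStr k M) (T : DGStr k N) (R' : DGStr k M') (T' : DGStr k N')
    (f : M →ₗ[k] M') (g : N →ₗ[k] N') (hf : ∀ i x, x ∈ R.gr i → f x ∈ R'.gr i)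
    (hfd : ∀ x, f (R.d x) = R'.d (f x)) (hgd : ∀ x, g (T.d x) = T'.d (g x)) :
    R'.tensorD T' ∘ₗ TensorProduct.map f g = TensorProduct.map f g ∘ₗ R.tensorD T := by
  refine R.ext_tmul T fun i j x y hx hy => ?_
  simp [R.tensorD_apply T hx, R'.tensorD_apply T' (hf i x hx), hfd, hgd]

end TensorLemmas

section Comod

variable {k : Type u} [Field k] {B : CDGHopf k}

/-- The coaction `(𝕀 ⊗ 𝕀 ⊗ m_B) ∘ (𝕀 ⊗ τ ⊗ 𝕀) ∘ (γ ⊗ γ')` on a tensor product. -/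
def tensorCoact (M N : DGComod B) : M ⊗[k] N →ₗ[k] (M ⊗[k] N) ⊗[k] B :=
  twMul M B.str N.str ∘ₗ TensorProduct.map M.coact N.coact

theorem tensorCoact_aux₁ (M N : DGComod B) :
    LinearMap.rTensor B (tensorCoact M N) ∘ₗ twMul M B.str N.str
      = LinearMap.rTensor B (twMul M B.str N.str)
        ∘ₗ twMul (M ⊗[k] B) B.str (N.str.tensor B.str)
        ∘ₗ TensorProduct.map (LinearMap.rTensor B M.coact) (LinearMap.rTensor B N.coact) := by
  refine ext_four (C := B) (D := B) (X := ((M ⊗[k] N) ⊗[k] B) ⊗[k] B) M.str B.str N.str B.str fun i1 i2 j1 j2 x a y b hx ha hy hb => ?_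
  simp [twMul_apply B.str N.str _ _ ha hy,
    twMul_apply B.str (N.str.tensor B.str) _ _ ha (N.coact_gr hy), tensorCoact]

theorem tensorCoact_aux₂ (M N : DGComod B) {i j : ℤ} {x : M} {y : N} (u v : B ⊗[k] B)
    (hy : y ∈ N.str.gr j) (hu : u ∈ (B.str.tensor B.str).gr i) :
    TensorProduct.assoc k (M ⊗[k] N) B B (LinearMap.rTensor B (twMul M B.str N.str)
      (twMul (M ⊗[k] B) B.str (N.str.tensor B.str)
        ((TensorProduct.assoc k M B B).symm (x ⊗ₜ u) ⊗ₜ (TensorProduct.assoc k N B B).symm (y ⊗ₜ v))))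
      = sg k (i * j) • ((x ⊗ₜ y) ⊗ₜ tensorMul B.str (u ⊗ₜ v)) := by
  let G : B ⊗[k] B →ₗ[k] B ⊗[k] B →ₗ[k] (M ⊗[k] N) ⊗[k] (B ⊗[k] B) :=
    (((TensorProduct.mk k ((M ⊗[k] B) ⊗[k] B) ((N ⊗[k] B) ⊗[k] B)).compr₂ ((TensorProduct.assoc k (M ⊗[k] N) B B).toLinearMap
      ∘ₗ LinearMap.rTensor B (twMul M B.str N.str)
      ∘ₗ twMul (M ⊗[k] B) B.str (N.str.tensor B.str))).compl₂
        ((TensorProduct.assoc k N B B).symm.toLinearMap ∘ₗ TensorProduct.mk k N (B ⊗[k] B) y))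
      ∘ₗ (TensorProduct.assoc k M B B).symm.toLinearMap ∘ₗ TensorProduct.mk k M (B ⊗[k] B) x
  let H : B ⊗[k] B →ₗ[k] B ⊗[k] B →ₗ[k] (M ⊗[k] N) ⊗[k] (B ⊗[k] B) :=
    sg k (i * j) • (TensorProduct.mk k (B ⊗[k] B) (B ⊗[k] B)).compr₂
      (TensorProduct.mk k (M ⊗[k] N) (B ⊗[k] B) (x ⊗ₜ y) ∘ₗ tensorMul B.str)
  have key : G u = H u := by
    refine B.str.tensorGr_ext B.str (f := G) (g := H) ?_ hu
    rintro i1 i2 b b' rfl hb hb'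
    refine B.str.ext_tmul B.str fun j1 j2 c c' hc hc' => ?_
    simp only [G, H, LinearMap.comp_apply, LinearMap.compl₂_apply, LinearMap.compr₂_apply,
      TensorProduct.mk_apply, LinearEquiv.coe_coe, TensorProduct.assoc_symm_tmul,
      LinearMap.smul_apply]
    rw [twMul_apply B.str (N.str.tensor B.str) (x ⊗ₜ b) c' hb' (N.str.tmul_mem B.str rfl hy hc),
      tensorMul_apply B.str b c' hb' hc]
    simp only [map_smul, LinearMap.rTensor_tmul, twMul_apply B.str N.str x c hb hy,
      ← TensorProduct.smul_tmul', TensorProduct.tmul_smul, TensorProduct.assoc_tmul, smul_smul,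
      ← sg_add]
    congr 2
    ring
  exact LinearMap.congr_fun key v

theorem tensorCoact_aux₃ (M N : DGComod B) :
    (TensorProduct.assoc k (M ⊗[k] N) B B).toLinearMap
      ∘ₗ LinearMap.rTensor B (twMul M B.str N.str)
      ∘ₗ twMul (M ⊗[k] B) B.str (N.str.tensor B.str)
      ∘ₗ TensorProduct.map
        ((TensorProduct.assoc k M B B).symm.toLinearMap ∘ₗ LinearMap.lTensor M Coalgebra.comul)
        ((TensorProduct.assoc k N B B).symm.toLinearMap ∘ₗ LinearMap.lTensor N Coalgebra.comul)
      = LinearMap.lTensor (M ⊗[k] N) Coalgebra.comul ∘ₗ twMul M B.str N.str := by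
  refine ext_four (C := B) (D := B) M.str B.str N.str B.str fun i1 i2 j1 j2 x a y b hx ha hy hb => ?_
  have := tensorCoact_aux₂ M N (x := x) (y := y) _ (Coalgebra.comul b) hy (B.comul_gr ha)
  simp only [LinearMap.comp_apply, TensorProduct.map_tmul, LinearMap.lTensor_tmul,
    LinearEquiv.coe_coe, twMul_apply B.str N.str x b ha hy, map_smul, B.comul_mul]
  exact this

theorem tensorCoact_aux₄ (M N : DGComod B) :
    LinearMap.lTensor (M ⊗[k] N) Coalgebra.counit ∘ₗ twMul M B.str N.str
      = twMul M (DGStr.unit k) N.str ∘ₗ TensorProduct.map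
        (LinearMap.lTensor M Coalgebra.counit) (LinearMap.lTensor N Coalgebra.counit) := by
  refine ext_four (C := B) (D := B) M.str B.str N.str B.str fun i1 i2 j1 j2 x a y b hx ha hy hb => ?_
  by_cases h : i2 = 0
  · subst h
    have h0 : Coalgebra.counit (R := k) a ∈ (DGStr.unit k).gr 0 := by simp [DGStr.unit]
    simp [twMul_apply B.str N.str x b ha hy, twMul_apply (DGStr.unit k) N.str x _ h0 hy,
      B.counit_mul]
  · simp [twMul_apply B.str N.str x b ha hy, B.counit_mul, B.counit_gr h ha]

/-- The tensor product `M ⊗_{m_B} N` of right dg-comodules over `B`. -/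
def tensorComod (M N : DGComod B) : DGComod B where
  carrier := M ⊗[k] N
  str := M.str.tensor N.str
  coact := tensorCoact M N
  coact_gr {n z} hz := by
    refine M.str.tensorGr_map N.str _ _ ?_ hz
    intro i j x y h hx hy
    exact twMul_mem (A := B.toDGAlg) M.str N.str h (M.coact_gr hx) (N.coact_gr hy)
  coact_d z := by
    have h1 := LinearMap.congr_fun (tensorD_twMul (A := B.toDGAlg) M.str N.str)
      (TensorProduct.map M.coact N.coact z)
    have h2 := LinearMap.congr_fun (tensorD_map M.str N.str (M.str.tensor B.str)
      (N.str.tensor B.str) M.coact N.coact (fun i x hx => M.coact_gr hx) M.coact_d N.coact_d) z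
    simp only [LinearMap.comp_apply] at h1 h2
    simp only [tensorCoact, LinearMap.comp_apply, DGStr.tensor_d]
    rw [h1, h2]
  coact_coact z := by
    have h1 := LinearMap.congr_fun (tensorCoact_aux₁ M N) (TensorProduct.map M.coact N.coact z)
    have h3 := LinearMap.congr_fun (tensorCoact_aux₃ M N) (TensorProduct.map M.coact N.coact z)
    have hM : (LinearMap.rTensor B M.coact) ∘ₗ M.coact
        = ((TensorProduct.assoc k M B B).symm.toLinearMap
          ∘ₗ LinearMap.lTensor M Coalgebra.comul) ∘ₗ M.coact := by
      ext x
      simp [← M.coact_coact x]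
    have hN : (LinearMap.rTensor B N.coact) ∘ₗ N.coact
        = ((TensorProduct.assoc k N B B).symm.toLinearMap
          ∘ₗ LinearMap.lTensor N Coalgebra.comul) ∘ₗ N.coact := by
      ext x
      simp [← N.coact_coact x]
    have h2 : TensorProduct.map (LinearMap.rTensor B M.coact) (LinearMap.rTensor B N.coact)
        (TensorProduct.map M.coact N.coact z)
        = TensorProduct.map
          ((TensorProduct.assoc k M B B).symm.toLinearMap ∘ₗ LinearMap.lTensor M Coalgebra.comul)
          ((TensorProduct.assoc k N B B).symm.toLinearMap ∘ₗ LinearMap.lTensor N Coalgebra.comul)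
          (TensorProduct.map M.coact N.coact z) := by
      rw [← LinearMap.comp_apply, ← LinearMap.comp_apply, ← TensorProduct.map_comp,
        ← TensorProduct.map_comp, hM, hN]
    simp only [LinearMap.comp_apply] at h1 h3
    rw [h2] at h1
    rw [tensorCoact, LinearMap.comp_apply, ← h3, ← tensorCoact, h1]
    rfl
  counit_coact z := by
    have h1 := LinearMap.congr_fun (tensorCoact_aux₄ M N) (TensorProduct.map M.coact N.coact z)
    have h2 : LinearMap.lTensor (M ⊗[k] N) Coalgebra.counit ∘ₗ tensorCoact M N
        = (TensorProduct.mk k (M ⊗[k] N) k).flip 1 := by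
      rw [tensorCoact, ← LinearMap.comp_assoc, tensorCoact_aux₄, LinearMap.comp_assoc,
        ← TensorProduct.map_comp]
      refine M.str.ext_tmul N.str fun i j x y hx hy => ?_
      have h0 : (1 : k) ∈ (DGStr.unit k).gr 0 := by simp [DGStr.unit]
      simp [M.counit_coact, N.counit_coact, twMul_apply (DGStr.unit k) N.str x _ h0 hy, sg_zero]
    exact LinearMap.congr_fun h2 z

/-- The ground field as a right dg-comodule, with coaction `c ↦ 1 ⊗ u_B(c)`. -/
def unitComod (B : CDGHopf k) : DGComod B where
  carrier := k
  str := DGStr.unit k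
  coact := TensorProduct.mk k k B 1 ∘ₗ Algebra.linearMap k B
  coact_gr {i x} hx := by
    by_cases h : i = 0
    · subst h
      refine DGStr.tmul_mem _ _ (i := 0) (j := 0) (by simp) (by simp [DGStr.unit]) ?_
      rw [Algebra.linearMap_apply, Algebra.algebraMap_eq_smul_one]
      exact Submodule.smul_mem _ _ B.one_mem
    · have : x = 0 := by simpa [DGStr.unit, h] using hx
      rw [this, map_zero]; exact Submodule.zero_mem _
  coact_d x := by
    have h0 : (1 : k) ∈ (DGStr.unit k).gr 0 := by simp [DGStr.unit]
    have hd : (DGStr.unit k).d = 0 := rfl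
    simp [DGStr.tensorD_apply _ _ h0, Algebra.algebraMap_eq_smul_one, hd,
      DGAlg.d_one B.toDGAlg]
  coact_coact x := by
    simp [Algebra.algebraMap_eq_smul_one, B.comul_one]
  counit_coact x := by
    simp [Algebra.algebraMap_eq_smul_one, B.counit_one, TensorProduct.smul_tmul']

end Comod

/-! ### Linear maps over a dg-algebra -/

section ALin

variable {k : Type u} [Field k]
variable {M : Type*} [AddCommGroup M] [Module k M] {N : Type*} [AddCommGroup N] [Module k N]
variable {L : Type*} [AddCommGroup L] [Module k L]
variable {A : Type*} [Ring A] [Algebra k A] {A' : Type*} [Ring A'] [Algebra k A']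

/-- The right multiplication `z ↦ z · a` on the right `A`-module `M ⊗ A`. -/
def rmul (M : Type*) [AddCommGroup M] [Module k M] (a : A) : M ⊗[k] A →ₗ[k] M ⊗[k] A :=
  LinearMap.lTensor M (LinearMap.mulRight k a)

@[simp] theorem rmul_tmul (a b : A) (x : M) : rmul M a (x ⊗ₜ[k] b) = x ⊗ₜ (b * a) := rfl

theorem rmul_one (z : M ⊗[k] A) : rmul M (1 : A) z = z := by
  have : rmul (k := k) M (1 : A) = LinearMap.id := by ext; simp
  rw [this]; rfl

theorem rmul_rmul (a b : A) (z : M ⊗[k] A) : rmul M b (rmul M a z) = rmul M (a * b) z := by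
  have : rmul M b ∘ₗ rmul M a = rmul (k := k) M (a * b) := by
    ext; simp [mul_assoc]
  exact LinearMap.congr_fun this z

theorem rmul_add (a b : A) (z : M ⊗[k] A) : rmul M (a + b) z = rmul M a z + rmul M b z := by
  have : rmul M (a + b) = rmul M a + rmul (k := k) M b := by
    ext; simp [mul_add, TensorProduct.tmul_add]
  exact LinearMap.congr_fun this z

theorem rmul_smul (c : k) (a : A) (z : M ⊗[k] A) : rmul M (c • a) z = c • rmul M a z := by
  have : rmul M (c • a) = c • rmul (k := k) M a := by
    ext; simp
  exact LinearMap.congr_fun this z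

theorem rTensor_rmul (ψ : M →ₗ[k] N) (a : A) (z : M ⊗[k] A) :
    LinearMap.rTensor A ψ (rmul M a z) = rmul N a (LinearMap.rTensor A ψ z) := by
  have : LinearMap.rTensor A ψ ∘ₗ rmul M a = rmul N a ∘ₗ LinearMap.rTensor A ψ := by
    ext; simp
  exact LinearMap.congr_fun this z

theorem lTensor_rmul (f : A →ₐ[k] A') (a : A) (z : M ⊗[k] A) :
    LinearMap.lTensor M f.toLinearMap (rmul M a z)
      = rmul M (f a) (LinearMap.lTensor M f.toLinearMap z) := by
  have : LinearMap.lTensor M f.toLinearMap ∘ₗ rmul M a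
      = rmul M (f a) ∘ₗ LinearMap.lTensor M f.toLinearMap := by
    ext; simp
  exact LinearMap.congr_fun this z

variable (k A) in
/-- The `k`-linear maps `M ⊗ A → N ⊗ A` that are linear over `A`. -/
def aLin (M N : Type*) [AddCommGroup M] [Module k M] [AddCommGroup N] [Module k N] :
    Submodule k (M ⊗[k] A →ₗ[k] N ⊗[k] A) where
  carrier := {φ | ∀ a z, φ (rmul M a z) = rmul N a (φ z)}
  add_mem' hf hg a z := by simp [hf a z, hg a z]
  zero_mem' a z := by simp
  smul_mem' c f hf a z := by simp [hf a z]

theorem aLin_ext {φ ψ : M ⊗[k] A →ₗ[k] N ⊗[k] A} (hφ : φ ∈ aLin k A M N) (hψ : ψ ∈ aLin k A M N)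
    (h : ∀ x, φ (x ⊗ₜ 1) = ψ (x ⊗ₜ 1)) : φ = ψ := by
  ext x a
  have h1 := hφ a (x ⊗ₜ 1)
  have h2 := hψ a (x ⊗ₜ 1)
  simp only [rmul_tmul, one_mul] at h1 h2
  simp [h1, h2, h]

theorem aLin_comp {φ : N ⊗[k] A →ₗ[k] L ⊗[k] A} {ψ : M ⊗[k] A →ₗ[k] N ⊗[k] A}
    (hφ : φ ∈ aLin k A N L) (hψ : ψ ∈ aLin k A M N) : φ ∘ₗ ψ ∈ aLin k A M L := by
  intro a z
  simp [hψ a z, hφ a]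

theorem aLin_rTensor (ψ : M →ₗ[k] N) : LinearMap.rTensor A ψ ∈ aLin k A M N :=
  fun a z => rTensor_rmul ψ a z

theorem aLin_id : LinearMap.id ∈ aLin k A M M := fun _ _ => rfl

/-- The restriction `x ↦ φ(x ⊗ 1)` of a map defined on `M ⊗ A`. -/
def res (φ : M ⊗[k] A →ₗ[k] N) : M →ₗ[k] N := φ ∘ₗ (TensorProduct.mk k M A).flip 1

@[simp] theorem res_apply (φ : M ⊗[k] A →ₗ[k] N) (x : M) : res φ x = φ (x ⊗ₜ 1) := rfl

/-- The extension by linearity over `A'` of the map `x ↦ β(φ(x ⊗ 1))`. -/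
def baseChange (β : N ⊗[k] A →ₗ[k] N ⊗[k] A') :
    (M ⊗[k] A →ₗ[k] N ⊗[k] A) →ₗ[k] (M ⊗[k] A' →ₗ[k] N ⊗[k] A') where
  toFun φ := LinearMap.lTensor N (LinearMap.mul' k A')
    ∘ₗ (TensorProduct.assoc k N A' A').toLinearMap ∘ₗ LinearMap.rTensor A' (β ∘ₗ res φ)
  map_add' φ ψ := by
    ext; simp [TensorProduct.add_tmul]
  map_smul' c φ := by
    ext; simp [← TensorProduct.smul_tmul']

theorem baseChange_apply (β : N ⊗[k] A →ₗ[k] N ⊗[k] A') (φ : M ⊗[k] A →ₗ[k] N ⊗[k] A) (x : M)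
    (a : A') : baseChange β φ (x ⊗ₜ a) = rmul N a (β (φ (x ⊗ₜ 1))) := by
  have : LinearMap.lTensor N (LinearMap.mul' k A') ∘ₗ (TensorProduct.assoc k N A' A').toLinearMap
      ∘ₗ (TensorProduct.mk k (N ⊗[k] A') A').flip a = rmul N a := by
    ext; simp
  have h2 := LinearMap.congr_fun this (β (φ (x ⊗ₜ 1)))
  simpa [baseChange] using h2

theorem baseChange_one (β : N ⊗[k] A →ₗ[k] N ⊗[k] A') (φ : M ⊗[k] A →ₗ[k] N ⊗[k] A) (x : M) :
    baseChange β φ (x ⊗ₜ 1) = β (φ (x ⊗ₜ 1)) := by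
  rw [baseChange_apply, rmul_one]

theorem baseChange_aLin (β : N ⊗[k] A →ₗ[k] N ⊗[k] A') (φ : M ⊗[k] A →ₗ[k] N ⊗[k] A) :
    baseChange β φ ∈ aLin k A' M N := by
  intro a z
  induction z with
  | zero => simp
  | add x y hx hy => simp [hx, hy]
  | tmul x b => rw [rmul_tmul, baseChange_apply, baseChange_apply, rmul_rmul]

/-- The base change of an `A`-linear map along `f` is compatible with the map `𝕀 ⊗ f`. -/
theorem baseChange_lTensor (f : A →ₐ[k] A') {φ : M ⊗[k] A →ₗ[k] N ⊗[k] A}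
    (hφ : φ ∈ aLin k A M N) (z : M ⊗[k] A) :
    baseChange (LinearMap.lTensor N f.toLinearMap) φ (LinearMap.lTensor M f.toLinearMap z)
      = LinearMap.lTensor N f.toLinearMap (φ z) := by
  induction z with
  | zero => simp
  | add x y hx hy => simp [hx, hy]
  | tmul x b =>
    have h := hφ b (x ⊗ₜ 1)
    rw [rmul_tmul, one_mul] at h
    rw [h, lTensor_rmul, LinearMap.lTensor_tmul, baseChange_apply]
    rfl

end ALin

section ALinDG

variable {k : Type u} [Field k]
variable {M : Type*} [AddCommGroup M] [Module k M] {N : Type*} [AddCommGroup N] [Module k N]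
variable {A : DGAlg.{u, v} k}

theorem rmul_mem (S : DGStr k M) {i j : ℤ} {a : A} (ha : a ∈ A.str.gr j) {z : M ⊗[k] A}
    (hz : z ∈ S.tensorGr A.str i) : rmul M a z ∈ S.tensorGr A.str (i + j) := by
  refine S.tensorGr_map A.str (rmul M a) _ ?_ hz
  intro i1 i2 x b h hx hb
  exact S.tmul_mem A.str (by rw [← h]; ring) hx (A.mul_mem hb ha)

theorem d_rmul (S : DGStr k M) {i : ℤ} (a : A) {z : M ⊗[k] A}
    (hz : z ∈ S.tensorGr A.str i) : S.tensorD A.str (rmul M a z)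
      = rmul M a (S.tensorD A.str z) + sg k i • rmul M (A.str.d a) z := by
  refine S.tensorGr_ext A.str (f := S.tensorD A.str ∘ₗ rmul M a)
    (g := rmul M a ∘ₗ S.tensorD A.str + sg k i • rmul M (A.str.d a)) ?_ hz
  rintro i1 i2 x b rfl hx hb
  simp [S.tensorD_apply A.str hx, A.leibniz a hb, TensorProduct.tmul_add, sg_add, smul_smul,
    add_assoc]

theorem rTensor_mem (S : DGStr k M) (T : DGStr k N) (U : DGStr k A) {n : ℤ} {ψ : M →ₗ[k] N}
    (hψ : ψ ∈ S.homDeg T n) : LinearMap.rTensor A ψ ∈ (S.tensor U).homDeg (T.tensor U) n := by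
  intro i z hz
  refine S.tensorGr_map U (LinearMap.rTensor A ψ) _ ?_ hz
  intro i1 i2 x b h hx hb
  exact T.tmul_mem U (by rw [← h]; ring) (hψ i1 x hx) hb

/-- `d(ψ ⊗ 𝕀) = dψ ⊗ 𝕀`. -/
theorem homD_rTensor (S : DGStr k M) (T : DGStr k N) (U : DGStr k A) {n : ℤ} {ψ : M →ₗ[k] N}
    (hψ : ψ ∈ S.homDeg T n) : (S.tensor U).homD (T.tensor U) (LinearMap.rTensor A ψ)
      = LinearMap.rTensor A (S.homD T ψ) := by
  refine S.ext_tmul U fun i j x a hx ha => ?_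
  rw [DGStr.homD_apply _ _ (rTensor_mem S T U hψ)]
  simp [S.tensorD_apply U hx, T.tensorD_apply U (hψ i x hx), S.homD_apply T hψ, sg_add,
    TensorProduct.sub_tmul, smul_smul, TensorProduct.smul_tmul', mul_comm]

theorem aLin_homD (S : DGStr k M) (T : DGStr k N) {n : ℤ} {φ : M ⊗[k] A →ₗ[k] N ⊗[k] A}
    (hφ : φ ∈ aLin k A M N) (hn : φ ∈ (S.tensor A.str).homDeg (T.tensor A.str) n) :
    (S.tensor A.str).homD (T.tensor A.str) φ ∈ aLin k A M N := by
  intro a z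
  refine (S.tensor A.str).induction
    (p := fun z => (S.tensor A.str).homD (T.tensor A.str) φ (rmul M a z)
      = rmul N a ((S.tensor A.str).homD (T.tensor A.str) φ z)) ?_ ?_ z
  · intro i z hz
    simp only [DGStr.homD_apply _ _ hn, hφ a z, DGStr.tensor_d, d_rmul S a hz,
      d_rmul T a (hn i z hz), map_add, map_smul, hφ _ _, map_sub, sg_add, smul_add, smul_smul]
    rw [mul_comm]
    abel
  · intro x y hx hy
    simp only [map_add, hx, hy]

end ALinDG

/-! ### The tensor product of linear maps over a cdg-algebra -/

section TensorLin

variable {k : Type u} [Field k]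
variable {M : Type*} [AddCommGroup M] [Module k M] {N : Type*} [AddCommGroup N] [Module k N]
variable {M' : Type*} [AddCommGroup M'] [Module k M'] {N' : Type*} [AddCommGroup N'] [Module k N']
variable {A : CDGAlg.{u, v} k} {A' : CDGAlg.{u, v} k}

theorem ext_three {C X : Type*} [AddCommGroup C] [Module k C] [AddCommGroup X] [Module k X]
    (S : DGStr k M) (T : DGStr k N) {f g : (M ⊗[k] N) ⊗[k] C →ₗ[k] X}
    (h : ∀ i j x y c, x ∈ S.gr i → y ∈ T.gr j →
      f ((x ⊗ₜ y) ⊗ₜ c) = g ((x ⊗ₜ y) ⊗ₜ c)) : f = g := by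
  refine TensorProduct.ext' fun z c => ?_
  refine LinearMap.congr_fun (f := f ∘ₗ (TensorProduct.mk k (M ⊗[k] N) C).flip c)
    (g := g ∘ₗ (TensorProduct.mk k (M ⊗[k] N) C).flip c) ?_ z
  exact S.ext_tmul T fun i j x y hx hy => h i j x y c hx hy

/-- The tensor product `φ ⊗_{m_A} φ'` of a map `φ : M ⊗ A → M ⊗ A` with a map `φ' : N ⊗ A → N ⊗ A`
of degree `j`, both linear over `A`. It is the map of `(M ⊗ N) ⊗ A` that is linear over `A` and sends
`(x ⊗ y) ⊗ 1` to `(-1)^{j|x|}` times the product of `φ(x ⊗ 1)` and `φ'(y ⊗ 1)`. -/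
def tensorLin (A : CDGAlg.{u, v} k) (S : DGStr k M) (T : DGStr k N) (j : ℤ)
    (φ : M ⊗[k] A →ₗ[k] M ⊗[k] A) (φ' : N ⊗[k] A →ₗ[k] N ⊗[k] A) :
    (M ⊗[k] N) ⊗[k] A →ₗ[k] (M ⊗[k] N) ⊗[k] A :=
  twMul M A.str T ∘ₗ TensorProduct.map (res φ ∘ₗ S.sgn j) φ'
    ∘ₗ (TensorProduct.assoc k M N A).toLinearMap

theorem tensorLin_apply (S : DGStr k M) (T : DGStr k N) (j : ℤ)
    (φ : M ⊗[k] A →ₗ[k] M ⊗[k] A) (φ' : N ⊗[k] A →ₗ[k] N ⊗[k] A) {i : ℤ} {x : M}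
    (hx : x ∈ S.gr i) (y : N) (a : A) :
    tensorLin A S T j φ φ' ((x ⊗ₜ y) ⊗ₜ a)
      = sg k (j * i) • twMul M A.str T (φ (x ⊗ₜ 1) ⊗ₜ φ' (y ⊗ₜ a)) := by
  simp [tensorLin, S.sgn_apply j hx, ← TensorProduct.smul_tmul']

theorem twMul_rmul_right (T : DGStr k N) (z : M ⊗[k] A) (a : A) (w : N ⊗[k] A) :
    twMul M A.str T (z ⊗ₜ rmul N a w) = rmul (M ⊗[k] N) a (twMul M A.str T (z ⊗ₜ w)) := by
  have : twMul M A.str T ∘ₗ LinearMap.lTensor (M ⊗[k] A) (rmul N a)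
      = rmul (M ⊗[k] N) a ∘ₗ twMul M A.str T := by
    refine TensorProduct.ext (TensorProduct.ext (LinearMap.ext fun x => A.str.ext_hom
      fun i c hc => T.ext_tmul A.str fun i' j y b hy hb => ?_))
    simp [twMul_apply A.str T x _ hc hy, mul_assoc]
  exact LinearMap.congr_fun this (z ⊗ₜ w)

theorem twMul_rmul_left (T : DGStr k N) {i n : ℤ} (z : M ⊗[k] A) {a : A} (ha : a ∈ A.str.gr i)
    {w : N ⊗[k] A} (hw : w ∈ T.tensorGr A.str n) :
    twMul M A.str T (rmul M a z ⊗ₜ w)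
      = sg k (i * n) • rmul (M ⊗[k] N) a (twMul M A.str T (z ⊗ₜ w)) := by
  induction z with
  | zero => simp
  | add z z' hz hz' => simp [TensorProduct.add_tmul, hz, hz']
  | tmul x c =>
    refine A.str.induction (p := fun c => twMul M A.str T (rmul M a (x ⊗ₜ c) ⊗ₜ w)
      = sg k (i * n) • rmul (M ⊗[k] N) a (twMul M A.str T ((x ⊗ₜ c) ⊗ₜ w))) ?_ ?_ c
    · intro l c hc
      refine T.tensorGr_ext A.str
        (f := twMul M A.str T ∘ₗ TensorProduct.mk k (M ⊗[k] A) (N ⊗[k] A) (rmul M a (x ⊗ₜ c)))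
        (g := sg k (i * n) • rmul (M ⊗[k] N) a ∘ₗ twMul M A.str T
          ∘ₗ TensorProduct.mk k (M ⊗[k] A) (N ⊗[k] A) (x ⊗ₜ c)) ?_ hw
      rintro j1 j2 y b rfl hy hb
      simp only [LinearMap.comp_apply, TensorProduct.mk_apply, rmul_tmul, LinearMap.smul_apply,
        twMul_apply A.str T x b (A.mul_mem hc ha) hy, twMul_apply A.str T x b hc hy, map_smul,
        mul_assoc, A.comm ha hb, TensorProduct.tmul_smul, mul_smul_comm, smul_smul, ← sg_add]
      congr 2
      ring
    · intro c c' h h'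
      simp only [TensorProduct.tmul_add, TensorProduct.add_tmul, map_add, h, h', smul_add]

theorem tensorLin_aLin (S : DGStr k M) (T : DGStr k N) (j : ℤ)
    (φ : M ⊗[k] A →ₗ[k] M ⊗[k] A) {φ' : N ⊗[k] A →ₗ[k] N ⊗[k] A} (hφ' : φ' ∈ aLin k A N N) :
    tensorLin A S T j φ φ' ∈ aLin k A (M ⊗[k] N) (M ⊗[k] N) := by
  intro a z
  refine LinearMap.congr_fun (f := tensorLin A S T j φ φ' ∘ₗ rmul (M ⊗[k] N) a)
    (g := rmul (M ⊗[k] N) a ∘ₗ tensorLin A S T j φ φ') ?_ z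
  refine ext_three S T fun i i' x y b hx hy => ?_
  have h := hφ' a (y ⊗ₜ b)
  rw [rmul_tmul] at h
  simp [tensorLin_apply S T j φ φ' hx, h, twMul_rmul_right]

/-- The defining property of `φ ⊗_{m_A} φ'`, on all of `(M ⊗ A) ⊗ (N ⊗ A)`. -/
theorem tensorLin_twMul (S : DGStr k M) (T : DGStr k N) {j : ℤ}
    {φ : M ⊗[k] A →ₗ[k] M ⊗[k] A} {φ' : N ⊗[k] A →ₗ[k] N ⊗[k] A} (hφ : φ ∈ aLin k A M M)
    (hφ' : φ' ∈ aLin k A N N) (hj : φ' ∈ (T.tensor A.str).homDeg (T.tensor A.str) j)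
    (z : M ⊗[k] A) (w : N ⊗[k] A) :
    tensorLin A S T j φ φ' (twMul M A.str T (z ⊗ₜ w))
      = twMul M A.str T (φ ((S.tensor A.str).sgn j z) ⊗ₜ φ' w) := by
  refine LinearMap.congr_fun (f := tensorLin A S T j φ φ' ∘ₗ twMul M A.str T)
    (g := twMul M A.str T ∘ₗ TensorProduct.map (φ ∘ₗ (S.tensor A.str).sgn j) φ') ?_ (z ⊗ₜ w)
  refine ext_four S A.str T A.str fun i1 i2 j1 j2 x a y b hx ha hy hb => ?_
  have h1 := hφ a (x ⊗ₜ 1)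
  rw [rmul_tmul, one_mul] at h1
  have h2 := hφ' a (y ⊗ₜ b)
  rw [rmul_tmul] at h2
  have hw : φ' (y ⊗ₜ b) ∈ T.tensorGr A.str (j1 + j2 + j) := hj _ _ (T.tmul_mem A.str rfl hy hb)
  have h3 : (S.tensor A.str).sgn j (x ⊗ₜ[k] a) = sg k (j * (i1 + i2)) • (x ⊗ₜ[k] a) :=
    DGStr.sgn_apply _ j (S.tmul_mem A.str rfl hx ha)
  simp only [LinearMap.comp_apply, TensorProduct.map_tmul, twMul_apply A.str T x b ha hy, map_smul,
    tensorLin_apply S T j φ φ' hx, h3,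
    ← TensorProduct.smul_tmul', h1, twMul_rmul_left T _ ha hw, A.comm ha hb,
    TensorProduct.tmul_smul, h2, twMul_rmul_right, smul_smul, ← sg_add]
  rw [show j * (i1 + i2) + i2 * (j1 + j2 + j) = (i2 * j1 + j * i1 + i2 * j2) + (j * i2 + j * i2) by
    ring, sg_add _ (j * i2 + j * i2), sg_add (j * i2), sg_mul_self, mul_one]
  congr 2
  ring

theorem tensorLin_mem (S : DGStr k M) (T : DGStr k N) {i j n : ℤ} (hn : i + j = n)
    {φ : M ⊗[k] A →ₗ[k] M ⊗[k] A} {φ' : N ⊗[k] A →ₗ[k] N ⊗[k] A}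
    (hi : φ ∈ (S.tensor A.str).homDeg (S.tensor A.str) i)
    (hj : φ' ∈ (T.tensor A.str).homDeg (T.tensor A.str) j) :
    tensorLin A S T j φ φ'
      ∈ ((S.tensor T).tensor A.str).homDeg ((S.tensor T).tensor A.str) n := by
  intro l z hz
  refine (S.tensor T).tensorGr_map A.str (tensorLin A S T j φ φ') _ ?_ hz
  intro l1 l2 z a hl hz ha
  refine S.tensorGr_map T (tensorLin A S T j φ φ' ∘ₗ
    (TensorProduct.mk k (M ⊗[k] N) A).flip a) _ ?_ hz
  intro i1 i2 x y h hx hy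
  simp only [LinearMap.comp_apply, LinearMap.flip_apply, TensorProduct.mk_apply,
    tensorLin_apply S T j φ φ' hx]
  refine Submodule.smul_mem _ _ (twMul_mem (A := A.toDGAlg) S T ?_
    (hi _ _ (S.tmul_mem A.str rfl hx A.one_mem)) (hj _ _ (T.tmul_mem A.str rfl hy ha)))
  rw [← hl, ← h, ← hn]; ring

/-- The interchange law. -/
theorem tensorLin_comp (S : DGStr k M) (T : DGStr k N) {j i' j' : ℤ}
    {φ ψ : M ⊗[k] A →ₗ[k] M ⊗[k] A} {φ' ψ' : N ⊗[k] A →ₗ[k] N ⊗[k] A} (hφ : φ ∈ aLin k A M M)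
    (hφ' : φ' ∈ aLin k A N N) (hj : φ' ∈ (T.tensor A.str).homDeg (T.tensor A.str) j)
    (hi' : ψ ∈ (S.tensor A.str).homDeg (S.tensor A.str) i') :
    tensorLin A S T j φ φ' ∘ₗ tensorLin A S T j' ψ ψ'
      = sg k (j * i') • tensorLin A S T (j + j') (φ ∘ₗ ψ) (φ' ∘ₗ ψ') := by
  refine ext_three S T fun l l' x y a hx hy => ?_
  have h1 : ψ (x ⊗ₜ 1) ∈ (S.tensor A.str).gr (l + i') := by
    have := hi' _ _ (S.tmul_mem A.str (i := l) (j := 0) rfl hx A.one_mem)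
    rwa [add_zero] at this
  simp only [LinearMap.comp_apply, LinearMap.smul_apply, tensorLin_apply S T _ _ _ hx, map_smul,
    tensorLin_twMul S T hφ hφ' hj, DGStr.sgn_apply _ j h1, ← TensorProduct.smul_tmul', smul_smul,
    ← sg_add]
  congr 2
  ring

theorem tensorLin_id (S : DGStr k M) (T : DGStr k N) :
    tensorLin A S T 0 LinearMap.id LinearMap.id = LinearMap.id := by
  refine ext_three S T fun l l' x y a hx hy => ?_
  simp [tensorLin_apply S T _ _ _ hx, twMul_apply A.str T x a A.one_mem hy, sg_zero]

/-- Morphisms of cdg-algebras are compatible with `twMul`. -/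
theorem lTensor_twMul (T : DGStr k N) (f : A ⟶ A') (z : M ⊗[k] A) (w : N ⊗[k] A) :
    LinearMap.lTensor (M ⊗[k] N) (CDGAlg.lin f) (twMul M A.str T (z ⊗ₜ w))
      = twMul M A'.str T (LinearMap.lTensor M (CDGAlg.lin f) z
        ⊗ₜ LinearMap.lTensor N (CDGAlg.lin f) w) := by
  refine LinearMap.congr_fun
    (f := LinearMap.lTensor (M ⊗[k] N) (CDGAlg.lin f) ∘ₗ twMul M A.str T)
    (g := twMul M A'.str T ∘ₗ TensorProduct.map (LinearMap.lTensor M (CDGAlg.lin f))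
        (LinearMap.lTensor N (CDGAlg.lin f))) ?_ (z ⊗ₜ w)
  refine TensorProduct.ext (TensorProduct.ext (LinearMap.ext fun x => A.str.ext_hom
      fun i c hc => T.ext_tmul A.str fun i' j y b hy hb => ?_))
  simp [twMul_apply A.str T x b hc hy, twMul_apply A'.str T x _ (CDGAlg.lin_gr f hc) hy]

theorem baseChange_tensorLin (S : DGStr k M) (T : DGStr k N) (f : A ⟶ A') (j : ℤ)
    (φ : M ⊗[k] A →ₗ[k] M ⊗[k] A) (φ' : N ⊗[k] A →ₗ[k] N ⊗[k] A) :
    baseChange (LinearMap.lTensor (M ⊗[k] N) (CDGAlg.lin f)) (tensorLin A S T j φ φ')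
      = tensorLin A' S T j (baseChange (LinearMap.lTensor M (CDGAlg.lin f)) φ)
        (baseChange (LinearMap.lTensor N (CDGAlg.lin f)) φ') := by
  refine aLin_ext (baseChange_aLin _ _) (tensorLin_aLin S T j _ (baseChange_aLin _ _)) fun z => ?_
  refine LinearMap.congr_fun (f := res (baseChange (LinearMap.lTensor (M ⊗[k] N) (CDGAlg.lin f))
    (tensorLin A S T j φ φ'))) (g := res (tensorLin A' S T j
      (baseChange (LinearMap.lTensor M (CDGAlg.lin f)) φ)
        (baseChange (LinearMap.lTensor N (CDGAlg.lin f)) φ'))) ?_ z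
  refine S.ext_tmul T fun l l' x y hx hy => ?_
  simp only [res_apply, baseChange_one, tensorLin_apply S T _ _ _ hx, map_smul, lTensor_twMul]

end TensorLin

/-! ### Natural endomorphisms of the functors `M ↦ M ⊗ A` -/

section Nat

variable {k : Type u} [Field k] {B : CDGHopf k}

/-- The morphisms of degree `n` of the dg-category of right dg-comodules over `B`. -/
def comodHom (M M' : DGComod B) (n : ℤ) : Submodule k (M →ₗ[k] M') where
  carrier := {ψ | ψ ∈ M.str.homDeg M'.str n ∧
    ∀ x, M'.coact (ψ x) = LinearMap.rTensor B ψ (M.coact x)}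
  add_mem' h h' := ⟨Submodule.add_mem _ h.1 h'.1, fun x => by
    simp [LinearMap.rTensor_add, h.2 x, h'.2 x]⟩
  zero_mem' := ⟨Submodule.zero_mem _, fun x => by simp⟩
  smul_mem' c ψ h := ⟨Submodule.smul_mem _ c h.1, fun x => by
    simp [LinearMap.rTensor_smul, h.2 x]⟩

theorem comodHom_homD {M M' : DGComod B} {n : ℤ} {ψ : M →ₗ[k] M'} (h : ψ ∈ comodHom M M' n) :
    M.str.homD M'.str ψ ∈ comodHom M M' (n + 1) := by
  refine ⟨DGStr.homD_mem _ _ h.1, fun x => ?_⟩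
  rw [← homD_rTensor M.str M'.str B.str h.1, DGStr.homD_apply _ _ h.1,
    DGStr.homD_apply _ _ (rTensor_mem M.str M'.str B.str h.1), map_sub, map_smul, M'.coact_d,
    h.2, h.2, M.coact_d]

/-- A full dg-subcategory of the dg-category of right dg-comodules over `B` that contains the unit
object and is closed under tensor products. -/
structure TensorSub (B : CDGHopf k) where
  mem : DGComod B → Prop
  unit_mem : mem (unitComod B)
  tensor_mem : ∀ {M N : DGComod B}, mem M → mem N → mem (tensorComod M N)

/-- All right dg-comodules over `B`. -/
def allComod (B : CDGHopf k) : TensorSub B where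
  mem _ := True
  unit_mem := trivial
  tensor_mem _ _ := trivial

/-- The right dg-comodules over `B` that are finite-dimensional over `k`. -/
def finComod (B : CDGHopf k) : TensorSub B where
  mem M := FiniteDimensional k M
  unit_mem := inferInstanceAs (FiniteDimensional k k)
  tensor_mem {M N} hM hN := by
    have : FiniteDimensional k M := hM
    have : FiniteDimensional k N := hN
    exact inferInstanceAs (FiniteDimensional k (M ⊗[k] N))

/-- The objects of the subcategory. -/
abbrev TensorSub.Obj (C : TensorSub B) : Type (u + 1) := {M : DGComod B // C.mem M}

/-- The unit object. -/
def TensorSub.one (C : TensorSub B) : C.Obj := ⟨unitComod B, C.unit_mem⟩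

/-- The tensor product of objects. -/
def TensorSub.mul {C : TensorSub B} (M N : C.Obj) : C.Obj :=
  ⟨tensorComod M.1 N.1, C.tensor_mem M.2 N.2⟩

variable (C : TensorSub B) (A A' : CDGAlg.{u, u} k)

/-- The families of `k`-linear maps `η^M : M ⊗ A → M ⊗ A`, with componentwise composition. -/
def Fam : Type (u + 1) := ∀ M : C.Obj, Module.End k (M.1 ⊗[k] A)

instance : Ring (Fam C A) := inferInstanceAs (Ring (∀ M : C.Obj, Module.End k (M.1 ⊗[k] A)))

instance : Algebra k (Fam C A) :=
  inferInstanceAs (Algebra k (∀ M : C.Obj, Module.End k (M.1 ⊗[k] A)))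

section

variable {C A}

@[ext] theorem Fam.ext {η η' : Fam C A} (h : ∀ M, η M = η' M) : η = η' := funext h

@[simp] theorem Fam.add_apply (η η' : Fam C A) (M : C.Obj) : (η + η') M = η M + η' M := rfl

@[simp] theorem Fam.smul_apply (c : k) (η : Fam C A) (M : C.Obj) : (c • η) M = c • η M := rfl

@[simp] theorem Fam.zero_apply (M : C.Obj) : (0 : Fam C A) M = 0 := rfl

@[simp] theorem Fam.one_apply (M : C.Obj) : (1 : Fam C A) M = LinearMap.id := rfl

@[simp] theorem Fam.mul_apply (η η' : Fam C A) (M : C.Obj) : (η * η') M = η M ∘ₗ η' M := rfl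

/-- The component of a family at an object. -/
def Fam.comp (M : C.Obj) : Fam C A →ₗ[k] (M.1 ⊗[k] A →ₗ[k] M.1 ⊗[k] A) where
  toFun η := η M
  map_add' _ _ := rfl
  map_smul' _ _ := rfl

end

/-- The cochain complex `M ⊗ A`. -/
abbrev fib {C : TensorSub B} (M : C.Obj) (A : CDGAlg.{u, u} k) : DGStr k (M.1 ⊗[k] A) :=
  M.1.str.tensor A.str

/-- The homogeneous part `End(ω ⊗ A)ⁿ`: the natural transformations of degree `n` from the dg-functor
`M ↦ M ⊗ A`, with values in right dg-modules over `A`, to itself. -/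
def natDeg (n : ℤ) : Submodule k (Fam C A) where
  carrier := {η | (∀ M, η M ∈ (fib M A).homDeg (fib M A) n) ∧ (∀ M, η M ∈ aLin k A M.1 M.1) ∧
    ∀ (m : ℤ) (M M' : C.Obj) (ψ : M.1 →ₗ[k] M'.1), ψ ∈ comodHom M.1 M'.1 m → ∀ z,
      LinearMap.rTensor A ψ (η M z) = sg k (m * n) • η M' (LinearMap.rTensor A ψ z)}
  add_mem' h h' := ⟨fun M => Submodule.add_mem _ (h.1 M) (h'.1 M),
    fun M => Submodule.add_mem _ (h.2.1 M) (h'.2.1 M), fun m M M' ψ hψ z => by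
      simp [h.2.2 m M M' ψ hψ z, h'.2.2 m M M' ψ hψ z]⟩
  zero_mem' := ⟨fun M => Submodule.zero_mem _, fun M => Submodule.zero_mem _,
    fun m M M' ψ hψ z => by simp⟩
  smul_mem' c η h := ⟨fun M => Submodule.smul_mem _ c (h.1 M),
    fun M => Submodule.smul_mem _ c (h.2.1 M), fun m M M' ψ hψ z => by
      simp [h.2.2 m M M' ψ hψ z, smul_comm c]⟩

/-- The differential on families, `(δη)^M = d ∘ η^M - (-1)ⁿ η^M ∘ d` for `η` of degree `n`. -/
def famD : Fam C A →ₗ[k] Fam C A where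
  toFun η M := (fib M A).homD (fib M A) (η M)
  map_add' η η' := Fam.ext fun M => ((fib M A).homD (fib M A)).map_add (η M) (η' M)
  map_smul' c η := Fam.ext fun M => ((fib M A).homD (fib M A)).map_smul c (η M)

variable {C A A'}

theorem famD_apply (η : Fam C A) (M : C.Obj) : famD C A η M = (fib M A).homD (fib M A) (η M) := rfl

theorem one_mem_natDeg : (1 : Fam C A) ∈ natDeg C A 0 :=
  ⟨fun M => (fib M A).id_mem, fun M => aLin_id, fun m M M' ψ hψ z => by simp [sg_zero]⟩

theorem mul_mem_natDeg {i j n : ℤ} (hn : i + j = n) {η η' : Fam C A} (h : η ∈ natDeg C A i)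
    (h' : η' ∈ natDeg C A j) : η * η' ∈ natDeg C A n := by
  refine ⟨fun M => DGStr.comp_mem _ _ _ hn (h.1 M) (h'.1 M),
    fun M => aLin_comp (h.2.1 M) (h'.2.1 M), fun m M M' ψ hψ z => ?_⟩
  simp only [Fam.mul_apply, LinearMap.comp_apply, h.2.2 m M M' ψ hψ, h'.2.2 m M M' ψ hψ,
    map_smul, smul_smul, ← sg_add, ← hn, mul_add]

theorem famD_mem {n : ℤ} {η : Fam C A} (h : η ∈ natDeg C A n) :
    famD C A η ∈ natDeg C A (n + 1) := by
  refine ⟨fun M => DGStr.homD_mem _ _ (h.1 M),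
    fun M => aLin_homD (A := A.toDGAlg) _ _ (h.2.1 M) (h.1 M), fun m M M' ψ hψ z => ?_⟩
  have key : ∀ w, LinearMap.rTensor A ψ ((fib M A).d w) = sg k m • ((fib M' A).d
      (LinearMap.rTensor A ψ w) - LinearMap.rTensor A (M.1.str.homD M'.1.str ψ) w) := by
    intro w
    rw [← homD_rTensor M.1.str M'.1.str A.str hψ.1,
      DGStr.homD_apply _ _ (rTensor_mem M.1.str M'.1.str A.str hψ.1), sub_sub_cancel, smul_smul,
      sg_mul_self, one_smul]
  have h1 := h.2.2 m M M' ψ hψ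
  have h2 := h.2.2 (m + 1) M M' _ (comodHom_homD hψ)
  rw [famD_apply, famD_apply, DGStr.homD_apply _ _ (h.1 M), DGStr.homD_apply _ _ (h.1 M')]
  simp only [map_sub, map_smul, h1, h2, key, smul_sub, smul_smul, mul_add, add_mul, sg_add,
    mul_one, one_mul]
  match_scalars <;> ring

theorem famD_famD (η : Fam C A) : famD C A (famD C A η) = 0 := by
  ext1 M
  exact DGStr.homD_homD _ _ _

theorem famD_mul {n : ℤ} {η : Fam C A} (h : η ∈ natDeg C A n) (η' : Fam C A) :
    famD C A (η * η') = famD C A η * η' + sg k n • (η * famD C A η') := by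
  ext1 M
  exact DGStr.homD_comp _ _ _ (h.1 M) _

theorem famD_one : famD C A 1 = 0 := by
  ext1 M
  exact DGStr.homD_id _

theorem natDeg_iSupIndep : iSupIndep (natDeg C A) := by
  refine iSupIndep_of_dfinsupp_lsum_injective _ ?_
  intro x y hxy
  ext n : 2
  refine Fam.ext fun M => ?_
  refine (fib M A).ext_hom fun i z hz => ?_
  have key : ((fib M A).proj (i + n) ∘ₗ LinearMap.applyₗ z ∘ₗ
      Fam.comp M) ∘ₗ (DFinsupp.lsum ℕ fun n => (natDeg C A n).subtype)
      = (LinearMap.applyₗ z ∘ₗ Fam.comp M) ∘ₗ (natDeg C A n).subtype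
        ∘ₗ DFinsupp.lapply n := by
    refine DFinsupp.lhom_ext fun m η => ?_
    have h := (fib M A).proj_apply (i + n) (η.2.1 M i z hz)
    simp only [LinearMap.comp_apply]
    rw [DFinsupp.lsum_single]
    refine h.trans ?_
    by_cases hmn : m = n
    · subst hmn
      simp only [if_true]
      rw [DFinsupp.lapply_apply, DFinsupp.single_eq_same]
      rfl
    · simp [hmn]
  have h := LinearMap.congr_fun key x
  have h' := LinearMap.congr_fun key y
  rw [LinearMap.comp_apply, hxy] at h
  exact h.symm.trans h'

variable (C A)

/-- The algebra `End(ω ⊗ A) = ⨁ₙ End(ω ⊗ A)ⁿ`. -/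
def endAlg : Subalgebra k (Fam C A) :=
  Submodule.toSubalgebra (⨆ n, natDeg C A n)
    (Submodule.mem_iSup_of_mem 0 one_mem_natDeg) <| by
      intro x y hx hy
      refine Submodule.iSup_induction (natDeg C A)
        (motive := fun x => x * y ∈ ⨆ n, natDeg C A n) hx (fun i x hx => ?_)
        (by rw [zero_mul]; exact Submodule.zero_mem _)
        (fun a b ha hb => by rw [add_mul]; exact Submodule.add_mem _ ha hb)
      refine Submodule.iSup_induction (natDeg C A)
        (motive := fun y => x * y ∈ ⨆ n, natDeg C A n) hy (fun j y hy => ?_)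
        (by rw [mul_zero]; exact Submodule.zero_mem _)
        (fun a b ha hb => by rw [mul_add]; exact Submodule.add_mem _ ha hb)
      exact Submodule.mem_iSup_of_mem (i + j) (mul_mem_natDeg rfl hx hy)

variable {C A}

theorem mem_endAlg {η : Fam C A} : η ∈ endAlg C A ↔ η ∈ ⨆ n, natDeg C A n := Iff.rfl

theorem natDeg_le {n : ℤ} {η : Fam C A} (h : η ∈ natDeg C A n) : η ∈ endAlg C A :=
  Submodule.mem_iSup_of_mem n h

theorem endAlg_induction {p : Fam C A → Prop} (hom : ∀ n η, η ∈ natDeg C A n → p η)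
    (add : ∀ η η', p η → p η' → p (η + η')) {η : Fam C A} (h : η ∈ endAlg C A) : p η :=
  Submodule.iSup_induction (natDeg C A) (motive := p) h hom (hom 0 0 (Submodule.zero_mem _)) add

theorem famD_mem_endAlg {η : Fam C A} (h : η ∈ endAlg C A) : famD C A η ∈ endAlg C A :=
  endAlg_induction (p := fun η => famD C A η ∈ endAlg C A)
    (fun _ _ h => natDeg_le (famD_mem h))
    (fun _ _ h h' => by rw [map_add]; exact add_mem h h') h

theorem aLin_of_endAlg {η : Fam C A} (h : η ∈ endAlg C A) (M : C.Obj) :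
    η M ∈ aLin k A M.1 M.1 :=
  endAlg_induction (p := fun η => η M ∈ aLin k A M.1 M.1) (fun _ _ h => h.2.1 M)
    (fun _ _ h h' => Submodule.add_mem _ h h') h

variable (C A)

/-- The homogeneous part of degree `n` of `End(ω ⊗ A)`. -/
def endGr (n : ℤ) : Submodule k (endAlg C A) where
  carrier := {x | x.1 ∈ natDeg C A n}
  add_mem' h h' := (natDeg C A n).add_mem h h'
  zero_mem' := (natDeg C A n).zero_mem
  smul_mem' c _ h := (natDeg C A n).smul_mem c h

theorem endGr_internal : DirectSum.IsInternal (endGr C A) := by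
  refine DirectSum.isInternal_submodule_of_iSupIndep_of_iSup_eq_top ?_ ?_
  · refine iSupIndep_def.2 fun n => Submodule.disjoint_def.2 fun x hx hx' => ?_
    have h := iSupIndep_def.1 (natDeg_iSupIndep (C := C) (A := A)) n
    refine Subtype.ext (Submodule.disjoint_def.1 h x.1 hx ?_)
    refine Submodule.iSup_induction (fun j => ⨆ _ : j ≠ n, endGr C A j)
      (motive := fun x => x.1 ∈ ⨆ j, ⨆ _ : j ≠ n, natDeg C A j) hx' (fun j x hx => ?_)
      (Submodule.zero_mem _) (fun x y h h' => Submodule.add_mem _ h h')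
    by_cases hj : j = n
    · rw [iSup_neg (not_not.2 hj), Submodule.mem_bot] at hx
      rw [hx]; exact Submodule.zero_mem _
    · rw [iSup_pos hj] at hx
      exact Submodule.mem_iSup_of_mem j (by rw [iSup_pos hj]; exact hx)
  · refine eq_top_iff.2 fun x _ => ?_
    obtain ⟨x, hx⟩ := x
    have hx' : x ∈ ⨆ n, natDeg C A n := hx
    refine Submodule.iSup_induction' (natDeg C A)
      (motive := fun x _ => ∀ hx : x ∈ endAlg C A, (⟨x, hx⟩ : endAlg C A) ∈ ⨆ n, endGr C A n)
      (fun n x h _ => Submodule.mem_iSup_of_mem n h) (fun _ => Submodule.zero_mem _)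
      (fun x y hx hy h h' _ => Submodule.add_mem _ (h hx) (h' hy)) hx' hx

/-- The cochain complex `End(ω ⊗ A)`. -/
def endStr : DGStr k (endAlg C A) where
  gr := endGr C A
  internal := endGr_internal C A
  d :=
    { toFun := fun x => ⟨famD C A x.1, famD_mem_endAlg x.2⟩
      map_add' := fun x y => Subtype.ext (map_add (famD C A) x.1 y.1)
      map_smul' := fun c x => Subtype.ext (map_smul (famD C A) c x.1) }
  d_mem h := famD_mem h
  d_d x := Subtype.ext (famD_famD x.1)

/-- The dg-algebra `End(ω ⊗ A)`. -/
def endDGAlg : DGAlg.{u, u + 1} k where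
  carrier := endAlg C A
  str := endStr C A
  one_mem := one_mem_natDeg
  mul_mem h h' := mul_mem_natDeg rfl h h'
  leibniz y h := Subtype.ext (famD_mul h y.1)

variable {A}

/-- The base change of families along a linear map `f : A → A'`. The component of the result at `M`
is linear over `A'` and sends `x ⊗ 1` to `(𝕀 ⊗ f)(η^M(x ⊗ 1))`. -/
def famMap (f : A →ₗ[k] A') : Fam C A →ₗ[k] Fam C A' where
  toFun η M := baseChange (LinearMap.lTensor M.1 f) (η M)
  map_add' η η' := Fam.ext fun M =>
    (baseChange (LinearMap.lTensor M.1 f)).map_add (η M) (η' M)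
  map_smul' c η := Fam.ext fun M => (baseChange (LinearMap.lTensor M.1 f)).map_smul c (η M)

end Nat

section NatMap

variable {k : Type u} [Field k] {B : CDGHopf k} {C : TensorSub B} {A A' A'' : CDGAlg.{u, u} k}

theorem famMap_apply (f : A →ₗ[k] A') (η : Fam C A) (M : C.Obj) :
    famMap C f η M = baseChange (LinearMap.lTensor M.1 f) (η M) := rfl

theorem lTensor_rTensor {M N : Type*} [AddCommGroup M] [Module k M] [AddCommGroup N] [Module k N]
    (ψ : M →ₗ[k] N) (f : A →ₗ[k] A') (z : M ⊗[k] A) :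
    LinearMap.lTensor N f (LinearMap.rTensor A ψ z)
      = LinearMap.rTensor A' ψ (LinearMap.lTensor M f z) := by
  rw [← LinearMap.comp_apply, ← LinearMap.comp_apply, LinearMap.lTensor_comp_rTensor,
    LinearMap.rTensor_comp_lTensor]

theorem lTensor_mem {M : Type*} [AddCommGroup M] [Module k M] (S : DGStr k M) {n : ℤ}
    {f : A →ₗ[k] A'} (hf : f ∈ A.str.homDeg A'.str n) :
    LinearMap.lTensor M f ∈ (S.tensor A.str).homDeg (S.tensor A'.str) n := by
  intro i z hz
  refine S.tensorGr_map A.str (LinearMap.lTensor M f) _ ?_ hz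
  intro i1 i2 x b h hx hb
  exact S.tmul_mem A'.str (by rw [← h]; ring) hx (hf i2 b hb)

theorem baseChange_mem {M : Type*} [AddCommGroup M] [Module k M] (S : DGStr k M) {m n l : ℤ}
    (hl : m + n = l) {β : M ⊗[k] A →ₗ[k] M ⊗[k] A'} {φ : M ⊗[k] A →ₗ[k] M ⊗[k] A}
    (hβ : β ∈ (S.tensor A.str).homDeg (S.tensor A'.str) m)
    (hφ : φ ∈ (S.tensor A.str).homDeg (S.tensor A.str) n) :
    baseChange β φ ∈ (S.tensor A'.str).homDeg (S.tensor A'.str) l := by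
  intro i z hz
  refine S.tensorGr_map A'.str (baseChange β φ) _ ?_ hz
  intro i1 i2 x a h hx ha
  rw [baseChange_apply]
  have h1 := hβ _ _ (hφ _ _ (S.tmul_mem A.str rfl hx A.one_mem))
  have h2 := rmul_mem (A := A'.toDGAlg) S ha h1
  rwa [show i1 + 0 + n + m + i2 = i + l by rw [← h, ← hl]; ring] at h2

theorem famMap_mem {n : ℤ} {f : A →ₗ[k] A'} (hf : f ∈ A.str.homDeg A'.str 0) {η : Fam C A}
    (h : η ∈ natDeg C A n) : famMap C f η ∈ natDeg C A' n := by
  refine ⟨fun M => baseChange_mem _ (zero_add n) (lTensor_mem _ hf) (h.1 M),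
    fun M => baseChange_aLin _ _, fun m M M' ψ hψ z => ?_⟩
  refine LinearMap.congr_fun (f := LinearMap.rTensor A' ψ ∘ₗ famMap C f η M)
    (g := sg k (m * n) • famMap C f η M' ∘ₗ LinearMap.rTensor A' ψ) ?_ z
  refine aLin_ext (aLin_comp (aLin_rTensor ψ) (baseChange_aLin _ _))
    (Submodule.smul_mem _ _ (aLin_comp (baseChange_aLin _ _) (aLin_rTensor ψ))) fun x => ?_
  simp only [LinearMap.comp_apply, LinearMap.smul_apply, famMap_apply, LinearMap.rTensor_tmul,
    baseChange_one, ← lTensor_rTensor, h.2.2 m M M' ψ hψ, map_smul]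

theorem lin_mem (f : A ⟶ A') : CDGAlg.lin f ∈ A.str.homDeg A'.str 0 := fun i x hx => by
  rw [add_zero]; exact CDGAlg.lin_gr f hx

theorem famMap_one (f : A ⟶ A') : famMap C (CDGAlg.lin f) 1 = 1 := by
  refine Fam.ext fun M => aLin_ext (baseChange_aLin _ _) aLin_id fun x => ?_
  rw [famMap_apply, baseChange_one]
  simp

theorem famMap_mul (f : A ⟶ A') {η η' : Fam C A} (h : ∀ M, η M ∈ aLin k A M.1 M.1) :
    famMap C (CDGAlg.lin f) (η * η') = famMap C (CDGAlg.lin f) η * famMap C (CDGAlg.lin f) η' := by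
  refine Fam.ext fun M => aLin_ext (baseChange_aLin _ _)
    (aLin_comp (baseChange_aLin _ _) (baseChange_aLin _ _)) fun x => ?_
  simp only [famMap_apply, Fam.mul_apply, LinearMap.comp_apply, baseChange_one]
  exact (baseChange_lTensor f.toFun (h M) _).symm

theorem lTensor_d {M : Type*} [AddCommGroup M] [Module k M] (S : DGStr k M) (f : A ⟶ A')
    (z : M ⊗[k] A) : LinearMap.lTensor M (CDGAlg.lin f) (S.tensorD A.str z)
      = S.tensorD A'.str (LinearMap.lTensor M (CDGAlg.lin f) z) := by
  refine LinearMap.congr_fun (f := LinearMap.lTensor M (CDGAlg.lin f) ∘ₗ S.tensorD A.str)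
    (g := S.tensorD A'.str ∘ₗ LinearMap.lTensor M (CDGAlg.lin f)) ?_ z
  refine S.ext_tmul A.str fun i j x a hx ha => ?_
  simp [S.tensorD_apply _ hx, CDGAlg.lin_d]

theorem tensorD_tmul_one {M : Type*} [AddCommGroup M] [Module k M] (S : DGStr k M) (x : M) :
    S.tensorD A.str (x ⊗ₜ 1) = S.d x ⊗ₜ 1 := by
  simp [DGStr.tensorD, DGAlg.d_one A.toDGAlg]

theorem famMap_famD (f : A ⟶ A') {n : ℤ} {η : Fam C A} (h : η ∈ natDeg C A n) :
    famMap C (CDGAlg.lin f) (famD C A η) = famD C A' (famMap C (CDGAlg.lin f) η) := by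
  have h' := famMap_mem (lin_mem f) h
  refine Fam.ext fun M => aLin_ext (baseChange_aLin _ _)
    (aLin_homD (A := A'.toDGAlg) _ _ (h'.2.1 M) (h'.1 M)) fun x => ?_
  rw [famMap_apply, baseChange_one, famD_apply, famD_apply, DGStr.homD_apply _ _ (h.1 M),
    DGStr.homD_apply _ _ (h'.1 M)]
  simp only [DGStr.tensor_d, tensorD_tmul_one, famMap_apply, baseChange_one, map_sub, map_smul,
    lTensor_d]

theorem famMap_id {η : Fam C A} (h : ∀ M, η M ∈ aLin k A M.1 M.1) :
    famMap C LinearMap.id η = η := by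
  refine Fam.ext fun M => aLin_ext (baseChange_aLin _ _) (h M) fun x => ?_
  rw [famMap_apply, baseChange_one]
  simp

theorem famMap_comp (f : A →ₗ[k] A') (g : A' →ₗ[k] A'') (η : Fam C A) :
    famMap C (g ∘ₗ f) η = famMap C g (famMap C f η) := by
  refine Fam.ext fun M => aLin_ext (baseChange_aLin _ _) (baseChange_aLin _ _) fun x => ?_
  simp only [famMap_apply, baseChange_one, LinearMap.lTensor_comp, LinearMap.comp_apply]

theorem famMap_mem_endAlg (f : A ⟶ A') {η : Fam C A} (h : η ∈ endAlg C A) :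
    famMap C (CDGAlg.lin f) η ∈ endAlg C A' :=
  endAlg_induction (p := fun η => famMap C (CDGAlg.lin f) η ∈ endAlg C A')
    (fun _ _ h => natDeg_le (famMap_mem (lin_mem f) h))
    (fun _ _ h h' => by rw [map_add]; exact add_mem h h') h

/-- The algebra map `End(ω ⊗ A) → End(ω ⊗ A')` induced by `f : A → A'`. -/
def endMap (C : TensorSub B) (f : A ⟶ A') : endAlg C A →ₐ[k] endAlg C A' :=
  AlgHom.ofLinearMap
    { toFun := fun η => ⟨famMap C (CDGAlg.lin f) η.1, famMap_mem_endAlg f η.2⟩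
      map_add' := fun η η' => Subtype.ext ((famMap C (CDGAlg.lin f)).map_add η.1 η'.1)
      map_smul' := fun c η => Subtype.ext ((famMap C (CDGAlg.lin f)).map_smul c η.1) }
    (Subtype.ext (famMap_one f))
    (fun η _ => Subtype.ext (famMap_mul f fun M => aLin_of_endAlg η.2 M))

/-- The functor `A ↦ End(ω ⊗ A)` from cdg-algebras to dg-algebras, where `ω` is the forgetful functor
on the given category of dg-comodules. -/
def calE (C : TensorSub B) : CDGAlg.{u, u} k ⥤ DGAlg.{u, u + 1} k where
  obj A := endDGAlg C A
  map {A A'} f :=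
    { toFun := endMap C f
      map_gr := fun _ _ h => famMap_mem (lin_mem f) h
      map_d := fun η => Subtype.ext <| endAlg_induction
        (p := fun η => famMap C (CDGAlg.lin f) (famD C A η)
          = famD C A' (famMap C (CDGAlg.lin f) η))
        (fun _ _ h => famMap_famD f h)
        (fun _ _ h h' => by simp only [map_add, h, h']) η.2 }
  map_id A := DGAlg.hom_ext fun η => Subtype.ext (famMap_id fun M => aLin_of_endAlg η.2 M)
  map_comp f g := DGAlg.hom_ext fun η =>
    Subtype.ext (famMap_comp (CDGAlg.lin f) (CDGAlg.lin g) η.1)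

end NatMap

/-! ### Homotopies and the homotopy category of cdg-algebras -/

section Homotopy

variable {k : Type u} [Field k]

/-- The value at `t` of a polynomial with coefficients in `V`, that is `∑ₙ tⁿ pₙ`. -/
def ev {V : Type*} [AddCommGroup V] [Module k V] (t : k) : (ℕ →₀ V) →ₗ[k] V :=
  Finsupp.lsum k fun n => t ^ n • LinearMap.id

/-- The application of a linear map to the coefficients of a polynomial. -/
def mapCoeff {V W : Type*} [AddCommGroup V] [Module k V] [AddCommGroup W] [Module k W]
    (L : V →ₗ[k] W) : (ℕ →₀ V) →ₗ[k] (ℕ →₀ W) :=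
  Finsupp.mapRange.linearMap L

theorem mapCoeff_apply {V W : Type*} [AddCommGroup V] [Module k V] [AddCommGroup W] [Module k W]
    (L : V →ₗ[k] W) (p : ℕ →₀ V) (n : ℕ) : mapCoeff L p n = L (p n) := rfl

theorem ev_mapCoeff {V W : Type*} [AddCommGroup V] [Module k V] [AddCommGroup W] [Module k W]
    (L : V →ₗ[k] W) (p : ℕ →₀ V) (t : k) : ev t (mapCoeff L p) = L (ev t p) := by
  have : ev t ∘ₗ mapCoeff L = L ∘ₗ ev t := by
    refine Finsupp.lhom_ext fun n x => ?_
    simp [ev, mapCoeff]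
  exact LinearMap.congr_fun this p

theorem ev_mem {V : Type*} [AddCommGroup V] [Module k V] (P : Submodule k V) {p : ℕ →₀ V}
    (h : ∀ n, p n ∈ P) (t : k) : ev t p ∈ P := by
  rw [ev, Finsupp.lsum_apply, Finsupp.sum]
  exact Submodule.sum_mem _ fun n _ => P.smul_mem _ (h n)

/-- A homotopy pair `(f(t), ξ(t))` of linear maps `A → A'` of degrees `0` and `-1`, depending
polynomially on `t`: it satisfies the flow equation `df/dt = d ∘ ξ(t) + ξ(t) ∘ d`, the map `f(0)` is a
morphism of cdg-algebras, `ξ(t)(1) = 0` and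
`ξ(t)(ab) = ξ(t)(a) f(t)(b) + (-1)^{|a|} f(t)(a) ξ(t)(b)`. -/
structure CDGAlg.HomotopyPair (A A' : CDGAlg.{u, v} k) where
  f : ℕ →₀ (A →ₗ[k] A')
  ξ : ℕ →₀ (A →ₗ[k] A')
  f_mem : ∀ n, f n ∈ A.str.homDeg A'.str 0
  ξ_mem : ∀ n, ξ n ∈ A.str.homDeg A'.str (-1)
  flow : ∀ n : ℕ, ((n : k) + 1) • f (n + 1) = A.str.homD A'.str (ξ n)
  init : ∃ g : A ⟶ A', ev (0 : k) f = CDGAlg.lin g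
  ξ_one : ∀ t : k, ev t ξ 1 = 0
  ξ_mul : ∀ (t : k) {i : ℤ} {a : A} (b : A), a ∈ A.str.gr i →
    ev t ξ (a * b) = ev t ξ a * ev t f b + sg k i • (ev t f a * ev t ξ b)

/-- Two morphisms of cdg-algebras are homotopic if a homotopy pair connects them. -/
def CDGAlg.Homotopic {A A' : CDGAlg.{u, v} k} (g g' : A ⟶ A') : Prop :=
  ∃ P : CDGAlg.HomotopyPair A A', ev (0 : k) P.f = CDGAlg.lin g ∧ ev (1 : k) P.f = CDGAlg.lin g'

/-- The homotopy relation on morphisms of cdg-algebras. -/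
def CDGAlg.homRel (k : Type u) [Field k] : HomRel (CDGAlg.{u, v} k) :=
  fun _ _ g g' => CDGAlg.Homotopic g g'

/-- The homotopy category of cdg-algebras: the objects are the cdg-algebras and the morphisms are the
classes of morphisms for the congruence generated by homotopy. -/
abbrev HoCDGAlg (k : Type u) [Field k] : Type (max u (v + 1)) :=
  CategoryTheory.Quotient (CDGAlg.homRel.{u, v} k)

/-- A notion of homotopy on a monoid-valued functor that is compatible with multiplication and with
homotopies of morphisms of cdg-algebras. -/
structure HoRel (F : CDGAlg.{u, v} k ⥤ MonCat.{w}) where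
  rel : ∀ A : CDGAlg.{u, v} k, F.obj A → F.obj A → Prop
  mul_left : ∀ {A : CDGAlg.{u, v} k} {x y : F.obj A} (z : F.obj A), rel A x y →
    rel A (z * x) (z * y)
  mul_right : ∀ {A : CDGAlg.{u, v} k} {x y : F.obj A} (z : F.obj A), rel A x y →
    rel A (x * z) (y * z)
  map : ∀ {A A' : CDGAlg.{u, v} k} (f : A ⟶ A') {x y : F.obj A}, rel A x y →
    rel A' ((F.map f).hom x) ((F.map f).hom y)
  homotopic : ∀ {A A' : CDGAlg.{u, v} k} {f f' : A ⟶ A'}, CDGAlg.Homotopic f f' →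
    ∀ x : F.obj A, rel A' ((F.map f).hom x) ((F.map f').hom x)

namespace HoRel

variable {F : CDGAlg.{u, v} k ⥤ MonCat.{w}} (R : HoRel F)

/-- Having the same homotopy type, as a congruence relation. -/
def con (A : CDGAlg.{u, v} k) : Con (F.obj A) where
  toSetoid := Relation.EqvGen.setoid (R.rel A)
  mul' {a b c d} h h' := by
    have h1 : Relation.EqvGen (R.rel A) (a * c) (b * c) := by
      clear h'
      induction h with
      | rel x y h => exact Relation.EqvGen.rel _ _ (R.mul_right _ h)
      | refl x => exact Relation.EqvGen.refl _
      | symm x y _ ih => exact Relation.EqvGen.symm _ _ ih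
      | trans x y z _ _ ih ih' => exact Relation.EqvGen.trans _ _ _ ih ih'
    have h2 : Relation.EqvGen (R.rel A) (b * c) (b * d) := by
      clear h h1
      induction h' with
      | rel x y h => exact Relation.EqvGen.rel _ _ (R.mul_left _ h)
      | refl x => exact Relation.EqvGen.refl _
      | symm x y _ ih => exact Relation.EqvGen.symm _ _ ih
      | trans x y z _ _ ih ih' => exact Relation.EqvGen.trans _ _ _ ih ih'
    exact Relation.EqvGen.trans _ _ _ h1 h2

theorem con_rel {A : CDGAlg.{u, v} k} {x y : F.obj A} (h : R.rel A x y) : R.con A x y :=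
  Relation.EqvGen.rel _ _ h

theorem con_le {A : CDGAlg.{u, v} k} {c : Con (F.obj A)} (h : ∀ x y, R.rel A x y → c x y) :
    R.con A ≤ c := by
  intro x y hxy
  change Relation.EqvGen (R.rel A) x y at hxy
  induction hxy with
  | rel x y hxy => exact h x y hxy
  | refl x => exact c.refl x
  | symm x y _ ih => exact c.symm ih
  | trans x y z _ _ ih ih' => exact c.trans ih ih'

/-- The map of homotopy types induced by a morphism. -/
def conMap {A A' : CDGAlg.{u, v} k} (f : A ⟶ A') : (R.con A).Quotient →* (R.con A').Quotient :=
  (R.con A).lift ((R.con A').mk'.comp (F.map f).hom)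
    (R.con_le fun _ _ h => (Con.eq _).2 (R.con_rel (R.map f h)))

/-- The functor on the homotopy category that sends `A` to the monoid of homotopy types of elements
of `F(A)`. -/
def functor : HoCDGAlg.{u, v} k ⥤ MonCat.{w} :=
  CategoryTheory.Quotient.lift _
    { obj := fun A => MonCat.of (R.con A).Quotient
      map := fun f => MonCat.ofHom (R.conMap f)
      map_id := fun A => by
        refine MonCat.hom_ext (MonoidHom.ext fun x => ?_)
        induction x using Con.induction_on with
        | H x => simp [conMap]
      map_comp := fun f g => by
        refine MonCat.hom_ext (MonoidHom.ext fun x => ?_)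
        induction x using Con.induction_on with
        | H x => simp [conMap] }
    fun A A' f f' h => by
      refine MonCat.hom_ext (MonoidHom.ext fun x => ?_)
      induction x using Con.induction_on with
      | H x => exact (Con.eq _).2 (R.con_rel (R.homotopic h x))

end HoRel

/-- A monoid-valued functor all of whose values are groups, as a group-valued functor. -/
def toGrp {D : Type*} [Category D] (F : D ⥤ MonCat.{w}) (h : ∀ X (x : F.obj X), IsUnit x) :
    D ⥤ GrpCat.{w} where
  obj X := @GrpCat.of (F.obj X) (groupOfIsUnit (h X))
  map {X Y} f :=
    letI := groupOfIsUnit (h X)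
    letI := groupOfIsUnit (h Y)
    GrpCat.ofHom (F.map f).hom
  map_id X := by
    ext x
    simp
  map_comp f g := by
    ext x
    simp

end Homotopy

/-! ### Tensor natural automorphisms -/

section ZEnd

variable {k : Type u} [Field k] {B : CDGHopf k}

/-- The monoid `Z⁰End_⊗(ω ⊗ A)` of the tensor natural transformations `η` of degree `0` with
`δη = 0`. -/
def zEnd (C : TensorSub B) (A : CDGAlg.{u, u} k) : Submonoid (Fam C A) where
  carrier := {η | η ∈ natDeg C A 0 ∧ famD C A η = 0 ∧ η C.one = LinearMap.id ∧
    ∀ M N : C.Obj, η (TensorSub.mul M N) = tensorLin A M.1.str N.1.str 0 (η M) (η N)}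
  one_mem' := ⟨one_mem_natDeg, famD_one, rfl, fun M N => (tensorLin_id _ _).symm⟩
  mul_mem' {η η'} h h' := by
    refine ⟨mul_mem_natDeg (add_zero 0) h.1 h'.1, ?_, ?_, fun M N => ?_⟩
    · rw [famD_mul h.1, h.2.1, h'.2.1, zero_mul, mul_zero, smul_zero, add_zero]
    · rw [Fam.mul_apply, h.2.2.1, h'.2.2.1]; rfl
    · rw [Fam.mul_apply, h.2.2.2, h'.2.2.2]
      have := tensorLin_comp (j' := 0) (ψ' := η' N) M.1.str N.1.str (h.1.2.1 M) (h.1.2.1 N)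
        (h.1.1 N) (h'.1.1 M)
      rw [mul_zero, sg_zero, one_smul, add_zero] at this
      exact this

variable {C : TensorSub B} {A A' : CDGAlg.{u, u} k}

theorem famMap_mem_zEnd (f : A ⟶ A') {η : Fam C A} (h : η ∈ zEnd C A) :
    famMap C (CDGAlg.lin f) η ∈ zEnd C A' := by
  refine ⟨famMap_mem (lin_mem f) h.1, ?_, ?_, fun M N => ?_⟩
  · rw [← famMap_famD f h.1, h.2.1, map_zero]
  · refine aLin_ext (baseChange_aLin _ _) aLin_id fun x => ?_
    rw [famMap_apply, baseChange_one, h.2.2.1]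
    simp
  · rw [famMap_apply, h.2.2.2]
    exact baseChange_tensorLin M.1.str N.1.str f 0 (η M) (η N)

/-- The functor `A ↦ Z⁰End_⊗(ω ⊗ A)`, where `ω` is the forgetful functor on the given category of
dg-comodules. -/
def calG (C : TensorSub B) : CDGAlg.{u, u} k ⥤ MonCat.{u + 1} where
  obj A := MonCat.of (zEnd C A)
  map f := MonCat.ofHom
    { toFun := fun η => ⟨famMap C (CDGAlg.lin f) η.1, famMap_mem_zEnd f η.2⟩
      map_one' := Subtype.ext (famMap_one f)
      map_mul' := fun η _ => Subtype.ext (famMap_mul f η.2.1.2.1) }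
  map_id _ := MonCat.hom_ext (MonoidHom.ext fun η => Subtype.ext (famMap_id η.2.1.2.1))
  map_comp f g := MonCat.hom_ext (MonoidHom.ext fun η =>
    Subtype.ext (famMap_comp (CDGAlg.lin f) (CDGAlg.lin g) η.1))

/-- A homotopy pair `(η(t), χ(t))` on `Z⁰End_⊗(ω ⊗ A)`, a pair of natural transformations of degrees `0`
and `-1` that depend polynomially on `t`: it satisfies the flow equation `dη/dt = δχ(t)`, the initial
value `η(0)` is in `Z⁰End_⊗(ω ⊗ A)`, the component of `χ(t)` at the unit object is zero and
`χ(t)^{M ⊗ N} = χ(t)^M ⊗_{m_A} η(t)^N + η(t)^M ⊗_{m_A} χ(t)^N`. -/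
structure ZEndHomotopyPair (C : TensorSub B) (A : CDGAlg.{u, u} k) where
  η : ℕ →₀ Fam C A
  χ : ℕ →₀ Fam C A
  η_mem : ∀ n, η n ∈ natDeg C A 0
  χ_mem : ∀ n, χ n ∈ natDeg C A (-1)
  flow : ∀ n : ℕ, ((n : k) + 1) • η (n + 1) = famD C A (χ n)
  init : ev (0 : k) η ∈ zEnd C A
  χ_one : ∀ t : k, ev t χ C.one = 0
  χ_tensor : ∀ (t : k) (M N : C.Obj), ev t χ (TensorSub.mul M N)
    = tensorLin A M.1.str N.1.str 0 (ev t χ M) (ev t η N)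
      + tensorLin A M.1.str N.1.str (-1) (ev t η M) (ev t χ N)

/-- Two elements of `Z⁰End_⊗(ω ⊗ A)` are homotopic if a homotopy pair connects them. -/
def ZEndHomotopic (x y : zEnd C A) : Prop :=
  ∃ P : ZEndHomotopyPair C A, ev (0 : k) P.η = x.1 ∧ ev (1 : k) P.η = y.1

theorem ZEndHomotopic.mul_left {x y : zEnd C A} (z : zEnd C A) (h : ZEndHomotopic x y) :
    ZEndHomotopic (z * x) (z * y) := by
  obtain ⟨P, h0, h1⟩ := h
  let L : Fam C A →ₗ[k] Fam C A := LinearMap.mulLeft k z.1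
  have hev : ∀ (t : k) p, ev t (mapCoeff L p) = z.1 * ev t p := fun t p => ev_mapCoeff L p t
  have hη := fun t => ev_mem (natDeg C A 0) P.η_mem t
  have hχ := fun t => ev_mem (natDeg C A (-1)) P.χ_mem t
  refine ⟨⟨mapCoeff L P.η, mapCoeff L P.χ, fun n => mul_mem_natDeg (add_zero 0) z.2.1 (P.η_mem n),
    fun n => mul_mem_natDeg (zero_add _) z.2.1 (P.χ_mem n), fun n => ?_, ?_, fun t => ?_,
    fun t M N => ?_⟩, ?_, ?_⟩
  · simp only [mapCoeff_apply, L, LinearMap.mulLeft_apply]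
    rw [famD_mul z.2.1, z.2.2.1, zero_mul, zero_add, sg_zero, one_smul, ← P.flow,
      mul_smul_comm]
  · rw [hev, h0]
    exact (z * x).2
  · rw [hev, Fam.mul_apply, P.χ_one]
    exact LinearMap.comp_zero _
  · rw [hev, hev, Fam.mul_apply, P.χ_tensor t M N, z.2.2.2.2 M N]
    have e1 := tensorLin_comp (j' := 0) (ψ' := ev t P.η N) M.1.str N.1.str (z.2.1.2.1 M)
      (z.2.1.2.1 N) (z.2.1.1 N) ((hχ t).1 M)
    have e2 := tensorLin_comp (j' := -1) (ψ' := ev t P.χ N) M.1.str N.1.str (z.2.1.2.1 M)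
      (z.2.1.2.1 N) (z.2.1.1 N) ((hη t).1 M)
    rw [zero_mul, sg_zero, one_smul, zero_add] at e1 e2
    refine (LinearMap.comp_add _ _ _).trans ?_
    exact congrArg₂ (· + ·) e1 e2
  · rw [hev, h0]; rfl
  · rw [hev, h1]; rfl

theorem ZEndHomotopic.mul_right {x y : zEnd C A} (z : zEnd C A) (h : ZEndHomotopic x y) :
    ZEndHomotopic (x * z) (y * z) := by
  obtain ⟨P, h0, h1⟩ := h
  let L : Fam C A →ₗ[k] Fam C A := LinearMap.mulRight k z.1
  have hev : ∀ (t : k) p, ev t (mapCoeff L p) = ev t p * z.1 := fun t p => ev_mapCoeff L p t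
  have hη := fun t => ev_mem (natDeg C A 0) P.η_mem t
  have hχ := fun t => ev_mem (natDeg C A (-1)) P.χ_mem t
  refine ⟨⟨mapCoeff L P.η, mapCoeff L P.χ, fun n => mul_mem_natDeg (add_zero 0) (P.η_mem n) z.2.1,
    fun n => mul_mem_natDeg (add_zero _) (P.χ_mem n) z.2.1, fun n => ?_, ?_, fun t => ?_,
    fun t M N => ?_⟩, ?_, ?_⟩
  · simp only [mapCoeff_apply, L, LinearMap.mulRight_apply]
    rw [famD_mul (P.χ_mem n), z.2.2.1, mul_zero, smul_zero, add_zero, ← P.flow, smul_mul_assoc]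
  · rw [hev, h0]
    exact (x * z).2
  · rw [hev, Fam.mul_apply, P.χ_one]
    exact LinearMap.zero_comp _
  · rw [hev, hev, Fam.mul_apply, P.χ_tensor t M N, z.2.2.2.2 M N]
    have e1 := tensorLin_comp (j' := 0) (ψ' := z.1 N) M.1.str N.1.str ((hχ t).2.1 M)
      ((hη t).2.1 N) ((hη t).1 N) (z.2.1.1 M)
    have e2 := tensorLin_comp (j' := 0) (ψ' := z.1 N) M.1.str N.1.str ((hη t).2.1 M)
      ((hχ t).2.1 N) ((hχ t).1 N) (z.2.1.1 M)
    rw [mul_zero, sg_zero, one_smul, add_zero] at e1 e2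
    refine (LinearMap.add_comp _ _ _).trans ?_
    exact congrArg₂ (· + ·) e1 e2
  · rw [hev, h0]; rfl
  · rw [hev, h1]; rfl

theorem ZEndHomotopic.map (f : A ⟶ A') {x y : zEnd C A} (h : ZEndHomotopic x y) :
    ZEndHomotopic (((calG C).map f).hom x) (((calG C).map f).hom y) := by
  obtain ⟨P, h0, h1⟩ := h
  let L := famMap C (CDGAlg.lin f)
  have hev : ∀ (t : k) p, ev t (mapCoeff L p) = famMap C (CDGAlg.lin f) (ev t p) :=
    fun t p => ev_mapCoeff L p t
  refine ⟨⟨mapCoeff L P.η, mapCoeff L P.χ, fun n => famMap_mem (lin_mem f) (P.η_mem n),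
    fun n => famMap_mem (lin_mem f) (P.χ_mem n), fun n => ?_, ?_, fun t => ?_,
    fun t M N => ?_⟩, ?_, ?_⟩
  · simp only [mapCoeff_apply, L]
    rw [← map_smul, P.flow, famMap_famD f (P.χ_mem n)]
  · rw [hev, h0]
    exact famMap_mem_zEnd f x.2
  · rw [hev, famMap_apply, P.χ_one, map_zero]
  · rw [hev, hev, famMap_apply, P.χ_tensor t M N]
    refine (map_add _ _ _).trans ?_
    exact congrArg₂ (· + ·) (baseChange_tensorLin M.1.str N.1.str f 0 _ _)
      (baseChange_tensorLin M.1.str N.1.str f (-1) _ _)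
  · rw [hev, h0]; rfl
  · rw [hev, h1]; rfl

/-- The base change of families along a linear map `s : A → A'` of degree `-1`. -/
def famMapNeg (C : TensorSub B) (η : Fam C A) : (A →ₗ[k] A') →ₗ[k] Fam C A' where
  toFun s M := baseChange (TensorProduct.map (M.1.str.sgn (-1)) s) (η M)
  map_add' s s' := Fam.ext fun M => aLin_ext (baseChange_aLin _ _)
    (Submodule.add_mem _ (baseChange_aLin _ _) (baseChange_aLin _ _)) fun x => by
      refine Eq.trans ?_ (congrArg₂ (· + ·) (baseChange_one _ _ _) (baseChange_one _ _ _)).symm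
      simp [baseChange_one, TensorProduct.map_add_right]
  map_smul' c s := Fam.ext fun M => aLin_ext (baseChange_aLin _ _)
    (Submodule.smul_mem _ c (baseChange_aLin _ _)) fun x => by
      refine Eq.trans ?_ (congrArg (fun y => c • y) (baseChange_one
        (TensorProduct.map (M.1.str.sgn (-1)) s) (η M) x)).symm
      simp [baseChange_one, TensorProduct.map_smul_right]

/-- The base change of families, as a function of the linear map. -/
def famMapLin (C : TensorSub B) (η : Fam C A) : (A →ₗ[k] A') →ₗ[k] Fam C A' where
  toFun f := famMap C f η
  map_add' s s' := Fam.ext fun M => aLin_ext (baseChange_aLin _ _)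
    (Submodule.add_mem _ (baseChange_aLin _ _) (baseChange_aLin _ _)) fun x => by
      simp [baseChange_one, famMap_apply, LinearMap.lTensor_add]
  map_smul' c s := Fam.ext fun M => aLin_ext (baseChange_aLin _ _)
    (Submodule.smul_mem _ _ (baseChange_aLin _ _)) fun x => by
      simp [baseChange_one, famMap_apply, LinearMap.lTensor_smul]

theorem famMapNeg_apply (η : Fam C A) (s : A →ₗ[k] A') (M : C.Obj) :
    famMapNeg C η s M = baseChange (TensorProduct.map (M.1.str.sgn (-1)) s) (η M) := rfl

section

variable {M : Type*} [AddCommGroup M] [Module k M] {N : Type*} [AddCommGroup N] [Module k N]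

theorem sgnMap_mem (S : DGStr k M) {s : A →ₗ[k] A'} (hs : s ∈ A.str.homDeg A'.str (-1)) :
    TensorProduct.map (S.sgn (-1)) s ∈ (S.tensor A.str).homDeg (S.tensor A'.str) (-1) := by
  intro i z hz
  refine S.tensorGr_map A.str (TensorProduct.map (S.sgn (-1)) s) _ ?_ hz
  intro i1 i2 x b h hx hb
  rw [TensorProduct.map_tmul, S.sgn_apply _ hx, ← TensorProduct.smul_tmul']
  exact Submodule.smul_mem _ _ (S.tmul_mem A'.str (by rw [← h]; ring) hx (hs i2 b hb))

theorem homD_sgnMap (S : DGStr k M) {s : A →ₗ[k] A'} (hs : s ∈ A.str.homDeg A'.str (-1)) :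
    (S.tensor A.str).homD (S.tensor A'.str) (TensorProduct.map (S.sgn (-1)) s)
      = LinearMap.lTensor M (A.str.homD A'.str s) := by
  refine S.ext_tmul A.str fun i j x a hx ha => ?_
  rw [DGStr.homD_apply _ _ (sgnMap_mem S hs)]
  simp only [DGStr.tensor_d, TensorProduct.map_tmul, S.sgn_apply _ hx, S.tensorD_apply _ hx,
    S.sgn_apply _ (S.d_mem hx), ← TensorProduct.smul_tmul', map_smul, map_add,
    LinearMap.lTensor_tmul, A.str.homD_apply A'.str hs, TensorProduct.tmul_sub,
    TensorProduct.tmul_smul, smul_add, smul_smul, ← sg_add, mul_add]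
  rw [sg_eq (n := 0) 0 (by ring : -1 * i + i = 0 + (0 + 0)), sg_zero,
    sg_eq (n := -1 * i) (-1) (by ring : -1 + (-1 * i + -1 * 1) = -1 * i + (-1 + -1)),
    show -1 + (i + -1 * i) = -1 by ring, one_smul]
  abel

theorem sgnMap_twMul (S : DGStr k M) (T : DGStr k N) {f s : A →ₗ[k] A'}
    (hf : f ∈ A.str.homDeg A'.str 0) (hs : s ∈ A.str.homDeg A'.str (-1))
    (hmul : ∀ {i : ℤ} {a : A} (b : A), a ∈ A.str.gr i →
      s (a * b) = s a * f b + sg k i • (f a * s b)) (z : M ⊗[k] A) (w : N ⊗[k] A) :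
    TensorProduct.map ((S.tensor T).sgn (-1)) s (twMul M A.str T (z ⊗ₜ w))
      = twMul M A'.str T (TensorProduct.map (S.sgn (-1)) s z ⊗ₜ LinearMap.lTensor N f w)
        + twMul M A'.str T (LinearMap.lTensor M f ((S.tensor A.str).sgn (-1) z)
          ⊗ₜ TensorProduct.map (T.sgn (-1)) s w) := by
  refine LinearMap.congr_fun
    (f := TensorProduct.map ((S.tensor T).sgn (-1)) s ∘ₗ twMul M A.str T)
    (g := twMul M A'.str T ∘ₗ TensorProduct.map (TensorProduct.map (S.sgn (-1)) s)
      (LinearMap.lTensor N f) + twMul M A'.str T ∘ₗ TensorProduct.map (LinearMap.lTensor M f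
        ∘ₗ (S.tensor A.str).sgn (-1)) (TensorProduct.map (T.sgn (-1)) s)) ?_ (z ⊗ₜ w)
  refine ext_four S A.str T A.str fun i1 i2 j1 j2 x a y b hx ha hy hb => ?_
  have hxa : (S.tensor A.str).sgn (-1) (x ⊗ₜ[k] a) = sg k (-1 * (i1 + i2)) • (x ⊗ₜ[k] a) :=
    DGStr.sgn_apply _ _ (S.tmul_mem A.str rfl hx ha)
  have hxy : (S.tensor T).sgn (-1) (x ⊗ₜ[k] y) = sg k (-1 * (i1 + j1)) • (x ⊗ₜ[k] y) :=
    DGStr.sgn_apply _ _ (S.tmul_mem T rfl hx hy)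
  have hfa : f a ∈ A'.str.gr i2 := by simpa using hf _ _ ha
  simp only [LinearMap.comp_apply, LinearMap.add_apply, TensorProduct.map_tmul, map_smul,
    twMul_apply A.str T x b ha hy, hxa, hxy, LinearMap.lTensor_tmul, S.sgn_apply _ hx,
    T.sgn_apply _ hy, ← TensorProduct.smul_tmul', TensorProduct.tmul_smul,
    twMul_apply A'.str T x _ hfa hy, twMul_apply A'.str T x _ (hs _ _ ha) hy, hmul b ha,
    TensorProduct.tmul_add, smul_add, smul_smul, ← sg_add]
  rw [sg_eq (m := i2 * j1 + (i2 + -1 * (i1 + j1))) (n := -1 * j1 + -1 * (i1 + i2) + i2 * j1) i2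
      (by ring),
    sg_eq (m := -1 * i1 + (i2 + -1) * j1) (n := i2 * j1 + -1 * (i1 + j1)) 0 (by ring)]

theorem baseChange_neg_tensorLin (S : DGStr k M) (T : DGStr k N) {f s : A →ₗ[k] A'}
    (hf : f ∈ A.str.homDeg A'.str 0) (hs : s ∈ A.str.homDeg A'.str (-1))
    (hmul : ∀ {i : ℤ} {a : A} (b : A), a ∈ A.str.gr i →
      s (a * b) = s a * f b + sg k i • (f a * s b))
    {φ : M ⊗[k] A →ₗ[k] M ⊗[k] A} (φ' : N ⊗[k] A →ₗ[k] N ⊗[k] A)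
    (hφ : φ ∈ (S.tensor A.str).homDeg (S.tensor A.str) 0) :
    baseChange (TensorProduct.map ((S.tensor T).sgn (-1)) s) (tensorLin A S T 0 φ φ')
      = tensorLin A' S T 0 (baseChange (TensorProduct.map (S.sgn (-1)) s) φ)
          (baseChange (LinearMap.lTensor N f) φ')
        + tensorLin A' S T (-1) (baseChange (LinearMap.lTensor M f) φ)
          (baseChange (TensorProduct.map (T.sgn (-1)) s) φ') := by
  refine aLin_ext (baseChange_aLin _ _) (Submodule.add_mem _
    (tensorLin_aLin S T _ _ (baseChange_aLin _ _))
    (tensorLin_aLin S T _ _ (baseChange_aLin _ _))) fun z => ?_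
  refine LinearMap.congr_fun (f := res (baseChange (TensorProduct.map ((S.tensor T).sgn (-1)) s)
    (tensorLin A S T 0 φ φ'))) (g := res (tensorLin A' S T 0
      (baseChange (TensorProduct.map (S.sgn (-1)) s) φ) (baseChange (LinearMap.lTensor N f) φ')
        + tensorLin A' S T (-1) (baseChange (LinearMap.lTensor M f) φ)
          (baseChange (TensorProduct.map (T.sgn (-1)) s) φ'))) ?_ z
  refine S.ext_tmul T fun l l' x y hx hy => ?_
  have h1 : (S.tensor A.str).sgn (-1) (φ (x ⊗ₜ 1)) = sg k (-1 * l) • φ (x ⊗ₜ 1) := by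
    refine DGStr.sgn_apply _ _ ?_
    simpa using hφ _ _ (S.tmul_mem A.str (j := 0) rfl hx A.one_mem)
  simp only [res_apply, baseChange_one, LinearMap.add_apply, tensorLin_apply S T _ _ _ hx, map_smul,
    sgnMap_twMul S T hf hs hmul, h1, ← TensorProduct.smul_tmul', zero_mul, sg_zero, one_smul]

end

theorem famMapNeg_mem {s : A →ₗ[k] A'} (hs : s ∈ A.str.homDeg A'.str (-1)) {η : Fam C A}
    (h : η ∈ natDeg C A 0) : famMapNeg C η s ∈ natDeg C A' (-1) := by
  refine ⟨fun M => baseChange_mem _ (add_zero _) (sgnMap_mem _ hs) (h.1 M),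
    fun M => baseChange_aLin _ _, fun m M M' ψ hψ z => ?_⟩
  refine LinearMap.congr_fun (f := LinearMap.rTensor A' ψ ∘ₗ famMapNeg C η s M)
    (g := sg k (m * (-1)) • famMapNeg C η s M' ∘ₗ LinearMap.rTensor A' ψ) ?_ z
  refine aLin_ext (aLin_comp (aLin_rTensor ψ) (baseChange_aLin _ _))
    (Submodule.smul_mem _ _ (aLin_comp (baseChange_aLin _ _) (aLin_rTensor ψ))) fun x => ?_
  have h1 := h.2.2 m M M' ψ hψ (x ⊗ₜ 1)
  rw [mul_zero, sg_zero, one_smul, LinearMap.rTensor_tmul] at h1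
  have h2 := LinearMap.congr_fun (DGStr.sgn_comp _ _ (-1) hψ.1)
  simp only [LinearMap.comp_apply, LinearMap.smul_apply, famMapNeg_apply, LinearMap.rTensor_tmul,
    baseChange_one, ← h1]
  refine LinearMap.congr_fun
    (f := LinearMap.rTensor A' ψ ∘ₗ TensorProduct.map (M.1.str.sgn (-1)) s)
    (g := sg k (m * -1) • TensorProduct.map (M'.1.str.sgn (-1)) s ∘ₗ LinearMap.rTensor A ψ)
    (TensorProduct.ext' fun y a => ?_) (η M (x ⊗ₜ 1))
  have h3 := h2 y
  simp only [LinearMap.comp_apply, LinearMap.smul_apply] at h3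
  simp [h3, ← TensorProduct.smul_tmul', smul_smul, ← sg_add, mul_comm]
  rw [sg_eq (n := 0) (-m) (by ring), sg_zero, one_smul]

theorem famD_famMapNeg {s : A →ₗ[k] A'} (hs : s ∈ A.str.homDeg A'.str (-1)) {η : Fam C A}
    (h : η ∈ natDeg C A 0) (hd : famD C A η = 0) :
    famD C A' (famMapNeg C η s) = famMap C (A.str.homD A'.str s) η := by
  have h' := famMapNeg_mem (C := C) hs h
  refine Fam.ext fun M => aLin_ext (aLin_homD (A := A'.toDGAlg) _ _ (h'.2.1 M) (h'.1 M))
    (baseChange_aLin _ _) fun x => ?_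
  have h1 : (fib M A).homD (fib M A) (η M) (x ⊗ₜ 1) = 0 := by
    rw [← famD_apply, hd]; rfl
  rw [DGStr.homD_apply _ _ (h.1 M), sg_zero, one_smul, sub_eq_zero, DGStr.tensor_d,
    tensorD_tmul_one] at h1
  rw [famD_apply, DGStr.homD_apply _ _ (h'.1 M), DGStr.tensor_d, tensorD_tmul_one, famMapNeg_apply,
    famMap_apply, baseChange_one, baseChange_one, baseChange_one, ← homD_sgnMap M.1.str hs,
    DGStr.homD_apply _ _ (sgnMap_mem M.1.str hs), ← h1]
  rfl

theorem ZEndHomotopic.of_homotopic {f f' : A ⟶ A'} (h : CDGAlg.Homotopic f f') (x : zEnd C A) :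
    ZEndHomotopic (((calG C).map f).hom x) (((calG C).map f').hom x) := by
  obtain ⟨P, h0, h1⟩ := h
  have hf : ∀ (t : k), ev t (mapCoeff (famMapLin C x.1) P.f) = famMap C (ev t P.f) x.1 :=
    fun t => ev_mapCoeff (famMapLin C x.1) P.f t
  have hs : ∀ (t : k), ev t (mapCoeff (famMapNeg C x.1) P.ξ) = famMapNeg C x.1 (ev t P.ξ) :=
    fun t => ev_mapCoeff (famMapNeg C x.1) P.ξ t
  refine ⟨⟨mapCoeff (famMapLin C x.1) P.f, mapCoeff (famMapNeg C x.1) P.ξ,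
    fun n => famMap_mem (P.f_mem n) x.2.1, fun n => famMapNeg_mem (P.ξ_mem n) x.2.1,
    fun n => ?_, ?_, fun t => ?_, fun t M N => ?_⟩, ?_, ?_⟩
  · rw [mapCoeff_apply, ← map_smul, P.flow, mapCoeff_apply, famD_famMapNeg (P.ξ_mem n) x.2.1 x.2.2.1]
    rfl
  · rw [hf, h0]
    exact famMap_mem_zEnd f x.2
  · rw [hs]
    refine aLin_ext (baseChange_aLin _ _) (Submodule.zero_mem _) fun c => ?_
    rw [famMapNeg_apply, baseChange_one, x.2.2.2.1, LinearMap.id_apply, TensorProduct.map_tmul,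
      P.ξ_one, TensorProduct.tmul_zero]
    rfl
  · rw [hs, hf, famMapNeg_apply, x.2.2.2.2]
    exact baseChange_neg_tensorLin M.1.str N.1.str (ev_mem _ P.f_mem t) (ev_mem _ P.ξ_mem t)
      (P.ξ_mul t) (x.1 N) (x.2.1.1 M)
  · rw [hf, h0]; rfl
  · rw [hf, h1]; rfl

/-- Homotopy on `Z⁰End_⊗(ω ⊗ A)`. -/
def calGHoRel (C : TensorSub B) : HoRel (calG C) where
  rel A := ZEndHomotopic (C := C) (A := A)
  mul_left z h := h.mul_left z
  mul_right z h := h.mul_right z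
  map f _ _ h := h.map f
  homotopic h x := ZEndHomotopic.of_homotopic h x

/-- The functor `A ↦ hoZ⁰End_⊗(ω ⊗ A)` on the homotopy category of cdg-algebras, where `ω` is the
forgetful functor on the given category of dg-comodules. -/
def hoCalG (C : TensorSub B) : HoCDGAlg.{u, u} k ⥤ MonCat.{u + 1} :=
  (calGHoRel C).functor

end ZEnd

/-! ### The functors represented by a cdg-Hopf algebra -/

section Rep

variable {k : Type u} [Field k] {B : CDGHopf k} {A A' : CDGAlg.{u, u} k}

/-- The convolution `m_A ∘ (g ⊗ h) ∘ Δ_B`. -/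
def convol (g h : B →ₗ[k] A) : B →ₗ[k] A :=
  LinearMap.mul' k A ∘ₗ TensorProduct.map g h ∘ₗ Coalgebra.comul

theorem comul_mem : (Coalgebra.comul : B →ₗ[k] B ⊗[k] B)
    ∈ B.str.homDeg (B.str.tensor B.str) 0 := fun i x hx => by
  rw [add_zero]; exact B.comul_gr hx

theorem mul_map_mem {m n l : ℤ} (h : m + n = l) {p q : B →ₗ[k] A}
    (hp : p ∈ B.str.homDeg A.str m) (hq : q ∈ B.str.homDeg A.str n) :
    LinearMap.mul' k A ∘ₗ TensorProduct.map p q ∈ (B.str.tensor B.str).homDeg A.str l := by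
  intro i z hz
  refine B.str.tensorGr_map B.str (LinearMap.mul' k A ∘ₗ TensorProduct.map p q) _ ?_ hz
  intro i1 i2 x y h' hx hy
  have := A.mul_mem (hp _ _ hx) (hq _ _ hy)
  rw [show i1 + m + (i2 + n) = i + l by rw [← h, ← h']; ring] at this
  simpa using this

theorem convol_mem {m n l : ℤ} (h : m + n = l) {p q : B →ₗ[k] A}
    (hp : p ∈ B.str.homDeg A.str m) (hq : q ∈ B.str.homDeg A.str n) :
    convol p q ∈ B.str.homDeg A.str l := by
  rw [convol, ← LinearMap.comp_assoc]
  exact DGStr.comp_mem _ _ _ (add_zero l) (mul_map_mem h hp hq) comul_mem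

theorem sgn_mem {V : Type*} [AddCommGroup V] [Module k V] (S : DGStr k V) (n : ℤ) :
    S.sgn n ∈ S.homDeg S 0 := fun i x hx => by
  rw [S.sgn_apply n hx, add_zero]; exact Submodule.smul_mem _ _ hx

theorem homD_mul_map_comul {n : ℤ} {G : B ⊗[k] B →ₗ[k] A ⊗[k] A}
    (hG : G ∈ (B.str.tensor B.str).homDeg (A.str.tensor A.str) n) :
    B.str.homD A.str (LinearMap.mul' k A ∘ₗ G ∘ₗ Coalgebra.comul)
      = LinearMap.mul' k A ∘ₗ (B.str.tensor B.str).homD (A.str.tensor A.str) G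
        ∘ₗ Coalgebra.comul := by
  have hm : LinearMap.mul' k A ∈ (A.str.tensor A.str).homDeg A.str 0 := by
    intro i z hz
    refine A.str.tensorGr_map A.str (LinearMap.mul' k A) _ ?_ hz
    intro i1 i2 x y h hx hy
    rw [add_zero, ← h]
    simpa using A.mul_mem hx hy
  have hmd : (A.str.tensor A.str).homD A.str (LinearMap.mul' k A) = 0 := by
    refine A.str.ext_tmul A.str fun i j x y hx hy => ?_
    rw [DGStr.homD_apply _ _ hm]
    simp [A.str.tensorD_apply A.str hx, A.leibniz y hx, sg_zero]
  have hcd : B.str.homD (B.str.tensor B.str) Coalgebra.comul = 0 := by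
    ext x
    rw [DGStr.homD_apply _ _ comul_mem, B.comul_d]
    simp [sg_zero]
  rw [DGStr.homD_comp _ (A.str.tensor A.str) _ hm, hmd, LinearMap.zero_comp, zero_add, sg_zero,
    one_smul, DGStr.homD_comp _ (B.str.tensor B.str) _ hG, hcd, LinearMap.comp_zero, smul_zero,
    add_zero]

theorem map_mem {m n l : ℤ} (h : m + n = l) {p q : B →ₗ[k] A}
    (hp : p ∈ B.str.homDeg A.str m) (hq : q ∈ B.str.homDeg A.str n) :
    TensorProduct.map p q ∈ (B.str.tensor B.str).homDeg (A.str.tensor A.str) l := by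
  intro i z hz
  refine B.str.tensorGr_map B.str (TensorProduct.map p q) _ ?_ hz
  intro i1 i2 x y h' hx hy
  exact A.str.tmul_mem A.str (by rw [← h, ← h']; ring) (hp _ _ hx) (hq _ _ hy)

theorem homD_map_left {n : ℤ} {p q : B →ₗ[k] A} (hp : p ∈ B.str.homDeg A.str n)
    (hq : q ∈ B.str.homDeg A.str 0) (hqd : B.str.homD A.str q = 0) :
    (B.str.tensor B.str).homD (A.str.tensor A.str) (TensorProduct.map p q)
      = TensorProduct.map (B.str.homD A.str p) q := by
  refine B.str.ext_tmul B.str fun i j x y hx hy => ?_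
  have h := LinearMap.congr_fun hqd y
  rw [DGStr.homD_apply _ _ hq, sg_zero, one_smul, LinearMap.zero_apply, sub_eq_zero] at h
  rw [DGStr.homD_apply _ _ (map_mem (add_zero n) hp hq)]
  simp only [DGStr.tensor_d, TensorProduct.map_tmul, A.str.tensorD_apply A.str (hp _ _ hx),
    B.str.tensorD_apply B.str hx, h, map_add, map_smul, smul_add, smul_smul, ← sg_add,
    B.str.homD_apply A.str hp, TensorProduct.sub_tmul, TensorProduct.smul_tmul']
  rw [add_comm n i]
  simp only [← TensorProduct.smul_tmul']
  abel

theorem homD_map_right {p q : B →ₗ[k] A} (hq : q ∈ B.str.homDeg A.str (-1))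
    (hp : p ∈ B.str.homDeg A.str 0) (hpd : B.str.homD A.str p = 0) :
    (B.str.tensor B.str).homD (A.str.tensor A.str) (TensorProduct.map (p ∘ₗ B.str.sgn (-1)) q)
      = TensorProduct.map p (B.str.homD A.str q) := by
  refine B.str.ext_tmul B.str fun i j x y hx hy => ?_
  have h := LinearMap.congr_fun hpd x
  rw [DGStr.homD_apply _ _ hp, sg_zero, one_smul, LinearMap.zero_apply, sub_eq_zero] at h
  have hp' : p x ∈ A.str.gr i := by simpa using hp _ _ hx
  rw [DGStr.homD_apply _ _ (map_mem (zero_add (-1))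
    (DGStr.comp_mem _ _ _ (add_zero 0) hp (sgn_mem _ _)) hq)]
  simp only [DGStr.tensor_d, TensorProduct.map_tmul, LinearMap.comp_apply, B.str.sgn_apply _ hx,
    B.str.sgn_apply _ (B.str.d_mem hx), map_smul, ← TensorProduct.smul_tmul',
    A.str.tensorD_apply A.str hp', B.str.tensorD_apply B.str hx, h, map_add, smul_add, smul_smul,
    ← sg_add, B.str.homD_apply A.str hq, TensorProduct.tmul_sub, TensorProduct.tmul_smul]
  rw [sg_eq (n := 0) 0 (by ring : -1 * i + i = 0 + (0 + 0)), sg_zero,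
    sg_eq (n := -1 * i) (-1) (by ring : -1 + -1 * (i + 1) = -1 * i + (-1 + -1)),
    sg_eq (n := -1) 0 (by ring : -1 + (i + -1 * i) = -1 + (0 + 0)), one_smul]
  abel

theorem mul_map_ext {n : ℤ} {F : (B ⊗[k] B) ⊗[k] (B ⊗[k] B) →ₗ[k] A}
    {G : B ⊗[k] B →ₗ[k] B ⊗[k] B →ₗ[k] A}
    (h : ∀ i i' j j' a a' b b', i + i' = n → a ∈ B.str.gr i → a' ∈ B.str.gr i' →
      b ∈ B.str.gr j → b' ∈ B.str.gr j' →
      F ((a ⊗ₜ a') ⊗ₜ (b ⊗ₜ b')) = G (a ⊗ₜ a') (b ⊗ₜ b'))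
    {z : B ⊗[k] B} (hz : z ∈ B.str.tensorGr B.str n) (w : B ⊗[k] B) : F (z ⊗ₜ w) = G z w := by
  have : TensorProduct.curry F z = G z := by
    refine B.str.tensorGr_ext B.str ?_ hz
    intro i i' a a' hn ha ha'
    exact B.str.ext_tmul B.str fun j j' b b' hb hb' => h i i' j j' a a' b b' hn ha ha' hb hb'
  exact LinearMap.congr_fun this w

/-- The convolution of two morphisms of cdg-algebras is multiplicative. -/
theorem convol_mul {g h : B →ₗ[k] A} (hg : g ∈ B.str.homDeg A.str 0)
    (hh : h ∈ B.str.homDeg A.str 0) (mg : ∀ a b, g (a * b) = g a * g b)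
    (mh : ∀ a b, h (a * b) = h a * h b) (a b : B) :
    convol g h (a * b) = convol g h a * convol g h b := by
  refine B.str.induction (p := fun a => convol g h (a * b) = convol g h a * convol g h b) ?_ ?_ a
  · intro n a ha
    simp only [convol, LinearMap.comp_apply, B.comul_mul]
    refine mul_map_ext (F := LinearMap.mul' k A ∘ₗ TensorProduct.map g h ∘ₗ tensorMul B.str)
      (G := (LinearMap.mul k A).compl₁₂ (LinearMap.mul' k A ∘ₗ TensorProduct.map g h)
        (LinearMap.mul' k A ∘ₗ TensorProduct.map g h)) ?_ (B.comul_gr ha) _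
    intro i i' j j' a a' b b' hn ha ha' hb hb'
    have h1 : g b ∈ A.str.gr j := by simpa using hg _ _ hb
    have h2 : h a' ∈ A.str.gr i' := by simpa using hh _ _ ha'
    simp only [LinearMap.comp_apply, tensorMul_apply B.str a b' ha' hb, map_smul,
      TensorProduct.map_tmul, LinearMap.mul'_apply, mg, mh, LinearMap.compl₁₂_apply,
      LinearMap.mul_apply']
    rw [mul_assoc (g a), ← mul_assoc (g b), A.comm h1 h2, mul_comm j i', smul_mul_assoc,
      mul_smul_comm, smul_smul, sg_mul_self, one_smul]
    simp only [mul_assoc]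
  · intro x y hx hy
    simp only [add_mul, map_add, hx, hy]

theorem convol_deriv_left {f ξ h : B →ₗ[k] A} (hf : f ∈ B.str.homDeg A.str 0)
    (hξ : ξ ∈ B.str.homDeg A.str (-1)) (hh : h ∈ B.str.homDeg A.str 0)
    (mξ : ∀ {i : ℤ} {a : B} (b : B), a ∈ B.str.gr i →
      ξ (a * b) = ξ a * f b + sg k i • (f a * ξ b))
    (mh : ∀ a b, h (a * b) = h a * h b) {n : ℤ} {a : B} (b : B) (ha : a ∈ B.str.gr n) :
    convol ξ h (a * b) = convol ξ h a * convol f h b + sg k n • (convol f h a * convol ξ h b) := by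
  simp only [convol, LinearMap.comp_apply, B.comul_mul]
  refine mul_map_ext (F := LinearMap.mul' k A ∘ₗ TensorProduct.map ξ h ∘ₗ tensorMul B.str)
    (G := (LinearMap.mul k A).compl₁₂ (LinearMap.mul' k A ∘ₗ TensorProduct.map ξ h)
        (LinearMap.mul' k A ∘ₗ TensorProduct.map f h)
      + sg k n • (LinearMap.mul k A).compl₁₂ (LinearMap.mul' k A ∘ₗ TensorProduct.map f h)
        (LinearMap.mul' k A ∘ₗ TensorProduct.map ξ h)) ?_ (B.comul_gr ha) _
  intro i i' j j' a a' b b' hn ha ha' hb hb'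
  have h1 : f b ∈ A.str.gr j := by simpa using hf _ _ hb
  have h2 : h a' ∈ A.str.gr i' := by simpa using hh _ _ ha'
  have h3 := hξ _ _ hb
  simp only [LinearMap.comp_apply, tensorMul_apply B.str a b' ha' hb, map_smul,
    TensorProduct.map_tmul, LinearMap.mul'_apply, mξ b ha, mh, LinearMap.compl₁₂_apply,
    LinearMap.mul_apply', LinearMap.add_apply, LinearMap.smul_apply]
  rw [add_mul, smul_add, smul_mul_assoc, mul_assoc (ξ a), mul_assoc (f a), ← mul_assoc (f b),
    ← mul_assoc (ξ b), A.comm h1 h2, A.comm h3 h2]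
  simp only [smul_mul_assoc, mul_smul_comm, smul_smul, ← sg_add, mul_assoc]
  rw [sg_eq (n := 0) (i' * j) (by ring), sg_zero, one_smul,
    sg_eq (m := i' * j + (i + (j + -1) * i')) (n := n) (i' * j - i') (by rw [← hn]; ring)]

theorem convol_deriv_right {f ξ h : B →ₗ[k] A} (hf : f ∈ B.str.homDeg A.str 0)
    (hξ : ξ ∈ B.str.homDeg A.str (-1)) (hh : h ∈ B.str.homDeg A.str 0)
    (mξ : ∀ {i : ℤ} {a : B} (b : B), a ∈ B.str.gr i →
      ξ (a * b) = ξ a * f b + sg k i • (f a * ξ b))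
    (mh : ∀ a b, h (a * b) = h a * h b) {n : ℤ} {a : B} (b : B) (ha : a ∈ B.str.gr n) :
    convol (h ∘ₗ B.str.sgn (-1)) ξ (a * b) = convol (h ∘ₗ B.str.sgn (-1)) ξ a * convol h f b
      + sg k n • (convol h f a * convol (h ∘ₗ B.str.sgn (-1)) ξ b) := by
  simp only [convol, LinearMap.comp_apply, B.comul_mul]
  refine mul_map_ext (F := LinearMap.mul' k A
      ∘ₗ TensorProduct.map (h ∘ₗ B.str.sgn (-1)) ξ ∘ₗ tensorMul B.str)
    (G := (LinearMap.mul k A).compl₁₂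
        (LinearMap.mul' k A ∘ₗ TensorProduct.map (h ∘ₗ B.str.sgn (-1)) ξ)
        (LinearMap.mul' k A ∘ₗ TensorProduct.map h f)
      + sg k n • (LinearMap.mul k A).compl₁₂ (LinearMap.mul' k A ∘ₗ TensorProduct.map h f)
        (LinearMap.mul' k A ∘ₗ TensorProduct.map (h ∘ₗ B.str.sgn (-1)) ξ)) ?_ (B.comul_gr ha) _
  intro i i' j j' a a' b b' hn ha ha' hb hb'
  have h1 : h b ∈ A.str.gr j := by simpa using hh _ _ hb
  have h2 : f a' ∈ A.str.gr i' := by simpa using hf _ _ ha'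
  have h3 := hξ _ _ ha'
  simp only [LinearMap.comp_apply, tensorMul_apply B.str a b' ha' hb, map_smul,
    TensorProduct.map_tmul, LinearMap.mul'_apply, mξ b' ha', mh, LinearMap.compl₁₂_apply,
    LinearMap.mul_apply', LinearMap.add_apply, LinearMap.smul_apply, B.str.sgn_apply _ ha,
    B.str.sgn_apply _ hb, B.str.sgn_apply _ (B.mul_mem ha hb)]
  simp only [mul_add, smul_add, smul_mul_assoc, mul_smul_comm]
  rw [mul_assoc (h a) (h b), mul_assoc (h a) (h b), ← mul_assoc (h b) (ξ a'), ← mul_assoc (h b) (f a'), A.comm h1 h3, A.comm h1 h2]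
  simp only [smul_mul_assoc, mul_smul_comm, smul_smul, ← sg_add, mul_assoc]
  rw [sg_eq (m := i' * j + (-1 * i + -1 * j + j * (i' + -1))) (n := -1 * i) (i' * j - j) (by ring),
    sg_eq (m := i' * j + (i' + (-1 * i + -1 * j + j * i'))) (n := n + -1 * j) (i' * j - i)
      (by rw [← hn]; ring)]

variable (B A) in
/-- The unit `u_A ∘ ε_B` of the convolution product. -/
def repOne : B.toCDGAlg ⟶ A where
  toFun := AlgHom.ofLinearMap (Algebra.linearMap k A ∘ₗ Coalgebra.counit)
    ((congrArg (algebraMap k A) B.counit_one).trans (map_one _))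
    (fun x y => (congrArg (algebraMap k A) (B.counit_mul x y)).trans (map_mul _ _ _))
  map_gr i x hx := by
    show algebraMap k A (Coalgebra.counit (R := k) x) ∈ A.str.gr i
    by_cases h : i = 0
    · subst h
      rw [Algebra.algebraMap_eq_smul_one]
      exact Submodule.smul_mem _ _ A.one_mem
    · rw [B.counit_gr h hx, map_zero]
      exact Submodule.zero_mem _
  map_d x := by
    show algebraMap k A (Coalgebra.counit (R := k) (B.str.d x))
      = A.str.d (algebraMap k A (Coalgebra.counit (R := k) x))
    rw [B.counit_d, map_zero, Algebra.algebraMap_eq_smul_one, map_smul, DGAlg.d_one A.toDGAlg,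
      smul_zero]

theorem homD_lin {A A' : CDGAlg.{u, v} k} (f : A ⟶ A') : A.str.homD A'.str (CDGAlg.lin f) = 0 := by
  ext x
  rw [DGStr.homD_apply _ _ (n := 0) (fun i x hx => by
    rw [add_zero]; exact CDGAlg.lin_gr f hx), sg_zero, one_smul, CDGAlg.lin_d, sub_self]
  rfl

theorem homD_convol_left {n : ℤ} {p : B →ₗ[k] A} (hp : p ∈ B.str.homDeg A.str n)
    (h : B.toCDGAlg ⟶ A) : B.str.homD A.str (convol p (CDGAlg.lin h))
      = convol (B.str.homD A.str p) (CDGAlg.lin h) := by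
  rw [convol, homD_mul_map_comul (map_mem (add_zero n) hp (lin_mem h)),
    homD_map_left hp (lin_mem h) (homD_lin h)]
  rfl

theorem homD_convol_right {p : B →ₗ[k] A} (hp : p ∈ B.str.homDeg A.str (-1))
    (h : B.toCDGAlg ⟶ A) : B.str.homD A.str (convol (CDGAlg.lin h ∘ₗ B.str.sgn (-1)) p)
      = convol (CDGAlg.lin h) (B.str.homD A.str p) := by
  rw [convol, homD_mul_map_comul (map_mem (zero_add (-1))
      (DGStr.comp_mem _ _ _ (add_zero 0) (lin_mem h) (sgn_mem _ _)) hp),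
    homD_map_right hp (lin_mem h) (homD_lin h)]
  rfl

/-- The convolution product of morphisms of cdg-algebras. -/
def repMul (g h : B.toCDGAlg ⟶ A) : B.toCDGAlg ⟶ A where
  toFun := AlgHom.ofLinearMap (convol (CDGAlg.lin g) (CDGAlg.lin h))
    (by simp [convol, B.comul_one])
    (convol_mul (lin_mem g) (lin_mem h) (CDGAlg.lin_mul g) (CDGAlg.lin_mul h))
  map_gr i x hx := by
    have := convol_mem (add_zero 0) (lin_mem g) (lin_mem h) i x hx
    rwa [add_zero] at this
  map_d x := by
    have h1 := homD_convol_left (lin_mem g) h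
    have h0 : convol (0 : B →ₗ[k] A) (CDGAlg.lin h) = 0 := by
      rw [convol, TensorProduct.map_zero_left, LinearMap.zero_comp, LinearMap.comp_zero]
    rw [homD_lin, h0] at h1
    have h2 := LinearMap.congr_fun h1 x
    rw [DGStr.homD_apply _ _ (convol_mem (add_zero 0) (lin_mem g) (lin_mem h)), sg_zero, one_smul,
      LinearMap.zero_apply, sub_eq_zero] at h2
    exact h2.symm

theorem lin_repMul (g h : B.toCDGAlg ⟶ A) :
    CDGAlg.lin (repMul g h) = convol (CDGAlg.lin g) (CDGAlg.lin h) := rfl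

theorem rep_ext {g h : B.toCDGAlg ⟶ A}
    (e : WithConv.toConv (CDGAlg.lin g) = WithConv.toConv (CDGAlg.lin h)) : g = h :=
  CDGAlg.hom_ext fun x => LinearMap.congr_fun (WithConv.toConv_injective e) x

variable (B A) in
/-- The set of morphisms of cdg-algebras `B → A`. -/
def Rep : Type u := B.toCDGAlg ⟶ A

/-- The monoid structure on the set of morphisms of cdg-algebras `B → A` given by the convolution
product. -/
instance : Monoid (Rep B A) where
  mul := repMul
  one := repOne B A
  mul_assoc f g h := rep_ext (mul_assoc (WithConv.toConv (CDGAlg.lin f))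
    (WithConv.toConv (CDGAlg.lin g)) (WithConv.toConv (CDGAlg.lin h)))
  one_mul f := rep_ext (one_mul (WithConv.toConv (CDGAlg.lin f)))
  mul_one f := rep_ext (mul_one (WithConv.toConv (CDGAlg.lin f)))

theorem comp_convol (f : A ⟶ A') (p q : B →ₗ[k] A) :
    CDGAlg.lin f ∘ₗ convol p q = convol (CDGAlg.lin f ∘ₗ p) (CDGAlg.lin f ∘ₗ q) := by
  have : CDGAlg.lin f ∘ₗ LinearMap.mul' k A
      = LinearMap.mul' k A' ∘ₗ TensorProduct.map (CDGAlg.lin f) (CDGAlg.lin f) := by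
    ext; simp
  rw [convol, convol, TensorProduct.map_comp, ← LinearMap.comp_assoc, this]
  rfl

variable (B) in
/-- The functor `A ↦ Hom(B, A)` represented by `B`, with the convolution product. -/
def repG : CDGAlg.{u, u} k ⥤ MonCat.{u} where
  obj A := MonCat.of (Rep B A)
  map {A A'} f := MonCat.ofHom
    { toFun := fun g => (show B.toCDGAlg ⟶ A from g) ≫ f
      map_one' := CDGAlg.hom_ext (A := B.toCDGAlg) (A' := A') fun _ => AlgHom.commutes f.toFun _
      map_mul' := fun g h => CDGAlg.hom_ext (A := B.toCDGAlg) (A' := A') fun x =>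
        LinearMap.congr_fun (comp_convol f (CDGAlg.lin g) (CDGAlg.lin h)) x }
  map_id A := MonCat.hom_ext (MonoidHom.ext fun g =>
    Category.comp_id (X := B.toCDGAlg) (Y := A) g)
  map_comp {A _ _} f f' := MonCat.hom_ext (MonoidHom.ext fun g =>
    (Category.assoc (W := B.toCDGAlg) (X := A) g f f').symm)

/-- Convolution is bilinear. -/
def convolₗ (B : CDGHopf k) (A : CDGAlg.{u, u} k) :
    (B →ₗ[k] A) →ₗ[k] (B →ₗ[k] A) →ₗ[k] (B →ₗ[k] A) :=
  LinearMap.mk₂ k convol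
    (fun p p' q => by ext; simp [convol, TensorProduct.map_add_left])
    (fun c p q => by ext; simp [convol, TensorProduct.map_smul_left])
    (fun p q q' => by ext; simp [convol, TensorProduct.map_add_right])
    (fun c p q => by ext; simp [convol, TensorProduct.map_smul_right])

theorem rep_mul_right {x y : B.toCDGAlg ⟶ A} (z : B.toCDGAlg ⟶ A)
    (h : CDGAlg.Homotopic x y) : CDGAlg.Homotopic (repMul x z) (repMul y z) := by
  obtain ⟨P, h0, h1⟩ := h
  let L := (convolₗ B A).flip (CDGAlg.lin z)
  have hev : ∀ (t : k) p, ev t (mapCoeff L p) = convol (ev t p) (CDGAlg.lin z) :=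
    fun t p => ev_mapCoeff L p t
  refine ⟨⟨mapCoeff L P.f, mapCoeff L P.ξ, fun n => convol_mem (add_zero 0) (P.f_mem n) (lin_mem z),
    fun n => convol_mem (add_zero (-1)) (P.ξ_mem n) (lin_mem z), fun n => ?_, ⟨repMul x z, ?_⟩,
    fun t => ?_, fun t i a b ha => ?_⟩, ?_, ?_⟩
  · rw [mapCoeff_apply, mapCoeff_apply, ← map_smul, P.flow]
    exact (homD_convol_left (P.ξ_mem n) z).symm
  · rw [hev, h0]; rfl
  · rw [hev]
    simp [convol, B.comul_one, P.ξ_one]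
  · rw [hev, hev]
    exact convol_deriv_left (ev_mem _ P.f_mem t) (ev_mem _ P.ξ_mem t) (lin_mem z) (P.ξ_mul t)
      (CDGAlg.lin_mul z) b ha
  · rw [hev, h0]; rfl
  · rw [hev, h1]; rfl

theorem rep_mul_left {x y : B.toCDGAlg ⟶ A} (z : B.toCDGAlg ⟶ A)
    (h : CDGAlg.Homotopic x y) : CDGAlg.Homotopic (repMul z x) (repMul z y) := by
  obtain ⟨P, h0, h1⟩ := h
  let L := convolₗ B A (CDGAlg.lin z)
  let L' := convolₗ B A (CDGAlg.lin z ∘ₗ B.str.sgn (-1))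
  have hev : ∀ (t : k) p, ev t (mapCoeff L p) = convol (CDGAlg.lin z) (ev t p) :=
    fun t p => ev_mapCoeff L p t
  have hev' : ∀ (t : k) p, ev t (mapCoeff L' p)
      = convol (CDGAlg.lin z ∘ₗ B.str.sgn (-1)) (ev t p) := fun t p => ev_mapCoeff L' p t
  refine ⟨⟨mapCoeff L P.f, mapCoeff L' P.ξ, fun n => convol_mem (add_zero 0) (lin_mem z) (P.f_mem n),
    fun n => convol_mem (zero_add (-1)) (DGStr.comp_mem _ _ _ (add_zero 0) (lin_mem z) (sgn_mem _ _))
      (P.ξ_mem n), fun n => ?_, ⟨repMul z x, ?_⟩, fun t => ?_, fun t i a b ha => ?_⟩, ?_, ?_⟩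
  · rw [mapCoeff_apply, mapCoeff_apply, ← map_smul, P.flow]
    exact (homD_convol_right (P.ξ_mem n) z).symm
  · rw [hev, h0]; rfl
  · rw [hev']
    simp [convol, B.comul_one, P.ξ_one]
  · rw [hev, hev']
    exact convol_deriv_right (ev_mem _ P.f_mem t) (ev_mem _ P.ξ_mem t) (lin_mem z) (P.ξ_mul t)
      (CDGAlg.lin_mul z) b ha
  · rw [hev, h0]; rfl
  · rw [hev, h1]; rfl

theorem CDGAlg.Homotopic.comp_right {D A A' : CDGAlg.{u, v} k} {x y : D ⟶ A} (f : A ⟶ A')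
    (h : CDGAlg.Homotopic x y) : CDGAlg.Homotopic (x ≫ f) (y ≫ f) := by
  obtain ⟨P, h0, h1⟩ := h
  let L : (D →ₗ[k] A) →ₗ[k] (D →ₗ[k] A') := LinearMap.llcomp k D A A' (CDGAlg.lin f)
  have hev : ∀ (t : k) p, ev t (mapCoeff L p) = CDGAlg.lin f ∘ₗ ev t p :=
    fun t p => ev_mapCoeff L p t
  have hf : CDGAlg.lin f ∈ A.str.homDeg A'.str 0 := fun i x hx => by
    rw [add_zero]; exact CDGAlg.lin_gr f hx
  refine ⟨⟨mapCoeff L P.f, mapCoeff L P.ξ, fun n => DGStr.comp_mem _ _ _ (add_zero 0) hf (P.f_mem n),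
    fun n => DGStr.comp_mem _ _ _ (zero_add (-1)) hf (P.ξ_mem n), fun n => ?_, ⟨x ≫ f, ?_⟩,
    fun t => ?_, fun t i a b ha => ?_⟩, ?_, ?_⟩
  · rw [mapCoeff_apply, mapCoeff_apply, ← map_smul, P.flow]
    have := DGStr.homD_comp D.str A.str A'.str hf (P.ξ n)
    rw [homD_lin, LinearMap.zero_comp, zero_add, sg_zero, one_smul] at this
    exact this.symm
  · rw [hev, h0]; rfl
  · rw [hev, LinearMap.comp_apply, P.ξ_one, map_zero]
  · rw [hev, hev]
    simp only [LinearMap.comp_apply, P.ξ_mul t b ha, map_add, map_smul, CDGAlg.lin_mul]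
  · rw [hev, h0]; rfl
  · rw [hev, h1]; rfl

theorem CDGAlg.Homotopic.comp_left {D A A' : CDGAlg.{u, v} k} {f f' : A ⟶ A'}
    (h : CDGAlg.Homotopic f f') (x : D ⟶ A) : CDGAlg.Homotopic (x ≫ f) (x ≫ f') := by
  obtain ⟨P, h0, h1⟩ := h
  let L : (A →ₗ[k] A') →ₗ[k] (D →ₗ[k] A') := LinearMap.lcomp k A' (CDGAlg.lin x)
  have hev : ∀ (t : k) p, ev t (mapCoeff L p) = ev t p ∘ₗ CDGAlg.lin x :=
    fun t p => ev_mapCoeff L p t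
  have hx : CDGAlg.lin x ∈ D.str.homDeg A.str 0 := fun i y hy => by
    rw [add_zero]; exact CDGAlg.lin_gr x hy
  refine ⟨⟨mapCoeff L P.f, mapCoeff L P.ξ, fun n => DGStr.comp_mem _ _ _ (add_zero 0) (P.f_mem n) hx,
    fun n => DGStr.comp_mem _ _ _ (add_zero (-1)) (P.ξ_mem n) hx, fun n => ?_, ⟨x ≫ f, ?_⟩,
    fun t => ?_, fun t i a b ha => ?_⟩, ?_, ?_⟩
  · rw [mapCoeff_apply, mapCoeff_apply, ← map_smul, P.flow]
    have := DGStr.homD_comp D.str A.str A'.str (P.ξ_mem n) (CDGAlg.lin x)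
    rw [homD_lin, LinearMap.comp_zero, smul_zero, add_zero] at this
    exact this.symm
  · rw [hev, h0]; rfl
  · rw [hev, LinearMap.comp_apply, CDGAlg.lin_one, P.ξ_one]
  · rw [hev, hev]
    simp only [LinearMap.comp_apply, CDGAlg.lin_mul, P.ξ_mul t _ (CDGAlg.lin_gr x ha)]
  · rw [hev, h0]; rfl
  · rw [hev, h1]; rfl

/-- Homotopy of morphisms of cdg-algebras `B → A`, on the functor represented by `B`. -/
def repHoRel (B : CDGHopf k) : HoRel (repG B) where
  rel A x y := CDGAlg.Homotopic (A := B.toCDGAlg) (A' := A) x y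
  mul_left z h := rep_mul_left z h
  mul_right z h := rep_mul_right z h
  map f _ _ h := h.comp_right f
  homotopic h x := h.comp_left (D := B.toCDGAlg) x

/-- The functor on the homotopy category of cdg-algebras represented by `B`. -/
def hoRepG (B : CDGHopf k) : HoCDGAlg.{u, u} k ⥤ MonCat.{u} :=
  (repHoRel B).functor

end Rep

end DGRec

end

/-!
Everything is compared with the functors represented by `B`. Let `C` be a category of dg-comodules
that contains the finite-dimensional ones. The coactions `γ^M`, extended linearly over `B`, form an
element `univFam C` of `Z⁰End_⊗(ω ⊗ B)` that is universal, in the manner of the Yoneda lemma. A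
linear map `p : B → A` of degree `n` yields a natural family `coFam C A n p` of degree `n`, with
`x ⊗ 1 ↦ (𝕀 ⊗ p)(γ(x))`, and every natural family arises in this way from a unique `p`
(`coFam_injective`, `exists_coFam`).

The map `p` is recovered from a family `η` as `b ↦ (ε ⊗ 𝕀)(η^V(b ⊗ 1))`, where `V` is any
finite-dimensional dg-subcomodule of `B` that contains `b`. Two facts make this work. By the
fundamental theorem on comodules (`exists_finite_subcomod`) each element of a dg-comodule lies in a
finite-dimensional dg-subcomodule, so that the values for different `V` glue to a map on `B`, and
natural families are determined by their components at finite-dimensional comodules (`endAlg_ext`).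
And for a functional `e` on a finite-dimensional `M`, concentrated in one degree, the map
`(e ⊗ 𝕀) ∘ γ` is a morphism from `M` to such a `V` whose composite with `ε` is `e`; naturality with
respect to it expresses `(e ⊗ 𝕀)(η^M(x ⊗ 1))` through `p`, and these functionals separate the points
of `M ⊗ A`.

As `B` enters alike for all `C`, the restriction of natural families from all comodules to the
finite-dimensional ones is bijective (`nonempty_calE_iso`). Under `p ↦ coFam C A n p` the
differential corresponds to that of `Hom(B, A)` (`famD_coFam`), composition to convolution
(`coFam_convol`), and the compatibility with tensor products to multiplicativity, or to the
derivation rule in the case of homotopies (`map_mul_of_tensor`, `deriv_of_tensor`, both of which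
evaluate the tensor condition with `ε ⊗ ε`). Hence `Hom(B, A) ≃ Z⁰End_⊗(ω ⊗ A)`, naturally in `A`
(`repEquiv`), and homotopies on the two sides correspond (`zEndHomotopic_iff`).

The multiplicativity of the antipode `S` is not needed to see that these monoids are groups: the
family attached to `g ∘ S` is inverse to the one attached to `g`, and the inverse of a closed tensor
natural transformation is again one (`mem_zEnd_of_inverse`, `isUnit_zEnd`).
-/

noncomputable section

namespace DGRec

/-! ### Contraction with linear functionals -/

section Contract

variable {k : Type u} [Field k]
variable {M : Type*} [AddCommGroup M] [Module k M] {N : Type*} [AddCommGroup N] [Module k N]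

/-- The contraction `e ⊗ 𝕀 : M ⊗ A → A` with a linear functional `e` on the left factor. -/
def contract (A : Type*) [AddCommGroup A] [Module k A] (e : M →ₗ[k] k) : M ⊗[k] A →ₗ[k] A :=
  (TensorProduct.lid k A).toLinearMap ∘ₗ LinearMap.rTensor A e

/-- The contraction `𝕀 ⊗ f : M ⊗ A → M` with a linear functional `f` on the right factor. -/
def rcontract (M : Type*) [AddCommGroup M] [Module k M] {A : Type*} [AddCommGroup A] [Module k A]
    (f : A →ₗ[k] k) : M ⊗[k] A →ₗ[k] M :=
  (TensorProduct.rid k M).toLinearMap ∘ₗ LinearMap.lTensor M f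

section

variable {A : Type*} [AddCommGroup A] [Module k A] {A' : Type*} [AddCommGroup A'] [Module k A']

@[simp] theorem contract_tmul (e : M →ₗ[k] k) (x : M) (a : A) :
    contract A e (x ⊗ₜ a) = e x • a := by simp [contract]

@[simp] theorem rcontract_tmul (f : A →ₗ[k] k) (x : M) (a : A) :
    rcontract M f (x ⊗ₜ a) = f a • x := by simp [rcontract]

theorem contract_rTensor (e : N →ₗ[k] k) (ψ : M →ₗ[k] N) (z : M ⊗[k] A) :
    contract A e (LinearMap.rTensor A ψ z) = contract A (e ∘ₗ ψ) z := by
  refine LinearMap.congr_fun (f := contract A e ∘ₗ LinearMap.rTensor A ψ) ?_ z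
  ext; simp

theorem contract_lTensor (e : M →ₗ[k] k) (f : A →ₗ[k] A') (z : M ⊗[k] A) :
    contract A' e (LinearMap.lTensor M f z) = f (contract A e z) := by
  refine LinearMap.congr_fun (f := contract A' e ∘ₗ LinearMap.lTensor M f)
    (g := f ∘ₗ contract A e) ?_ z
  ext; simp

theorem rcontract_rTensor (f : A →ₗ[k] k) (ψ : M →ₗ[k] N) (z : M ⊗[k] A) :
    rcontract N f (LinearMap.rTensor A ψ z) = ψ (rcontract M f z) := by
  refine LinearMap.congr_fun (f := rcontract N f ∘ₗ LinearMap.rTensor A ψ)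
    (g := ψ ∘ₗ rcontract M f) ?_ z
  ext; simp

/-- The functionals on `A` separate the points of `M ⊗ A`. -/
theorem eq_zero_of_rcontract {z : M ⊗[k] A} (h : ∀ f : A →ₗ[k] k, rcontract M f z = 0) :
    z = 0 := by
  classical
  let b := Module.Basis.ofVectorSpace k A
  refine (TensorProduct.equivFinsuppOfBasisRight (M := M) b).injective (Finsupp.ext fun i => ?_)
  rw [map_zero, Finsupp.zero_apply, ← h (b.coord i)]
  refine LinearMap.congr_fun (f := Finsupp.lapply i ∘ₗ
    (TensorProduct.equivFinsuppOfBasisRight (M := M) b).toLinearMap) ?_ z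
  ext; simp

/-- An element of `M ⊗ A` lies in `V ⊗ A` if all its contractions lie in `V`. -/
theorem mem_range_of_rcontract {V : Submodule k M} {z : M ⊗[k] A}
    (h : ∀ f : A →ₗ[k] k, rcontract M f z ∈ V) :
    z ∈ LinearMap.range (LinearMap.rTensor A V.subtype) := by
  have hex := rTensor_exact A (LinearMap.exact_subtype_mkQ V) V.mkQ_surjective
  refine (hex z).1 (eq_zero_of_rcontract fun f => ?_)
  rw [rcontract_rTensor]
  simpa using h f

theorem exists_finite_rcontract (z : M ⊗[k] A) :
    ∃ V : Submodule k M, FiniteDimensional k V ∧ ∀ f : A →ₗ[k] k, rcontract M f z ∈ V := by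
  induction z with
  | zero => exact ⟨⊥, inferInstance, by simp⟩
  | tmul x a =>
    refine ⟨Submodule.span k {x}, inferInstance, fun f => ?_⟩
    rw [rcontract_tmul]
    exact Submodule.smul_mem _ _ (Submodule.mem_span_singleton_self x)
  | add x y hx hy =>
    obtain ⟨V, hV, h⟩ := hx
    obtain ⟨W, hW, h'⟩ := hy
    refine ⟨V ⊔ W, inferInstance, fun f => ?_⟩
    rw [map_add]
    exact add_mem (Submodule.mem_sup_left (h f)) (Submodule.mem_sup_right (h' f))

/-- The functionals on `M` that are concentrated in one degree separate the points of `M ⊗ A`. -/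
theorem eq_of_contract (S : DGStr k M) {z w : M ⊗[k] A}
    (h : ∀ (i : ℤ) (e : M →ₗ[k] k), (∀ j x, j ≠ i → x ∈ S.gr j → e x = 0) →
      contract A e z = contract A e w) : z = w := by
  classical
  let b := S.internal.collectedBasis fun i => Module.Basis.ofVectorSpace k (S.gr i)
  have hb : ∀ i (z : M ⊗[k] A), TensorProduct.equivFinsuppOfBasisLeft b z i
      = contract A (b.coord i) z := fun i z => by
    refine LinearMap.congr_fun (f := Finsupp.lapply i ∘ₗ
      (TensorProduct.equivFinsuppOfBasisLeft b).toLinearMap) ?_ z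
    ext; simp
  refine (TensorProduct.equivFinsuppOfBasisLeft b).injective (Finsupp.ext fun i => ?_)
  rw [hb, hb]
  refine h i.1 _ fun j x hj hx => ?_
  exact S.internal.collectedBasis_repr_of_mem_ne _ hj hx

theorem contract_mem (S : DGStr k M) (T : DGStr k A) {i n m : ℤ} {e : M →ₗ[k] k}
    (he : ∀ j x, j ≠ i → x ∈ S.gr j → e x = 0) (hn : i + m = n) {z : M ⊗[k] A}
    (hz : z ∈ S.tensorGr T n) : contract A e z ∈ T.gr m := by
  refine S.tensorGr_map T (contract A e) _ ?_ hz
  intro j j' x a h hx ha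
  rw [contract_tmul]
  by_cases hj : j = i
  · obtain rfl : j' = m := by omega
    exact Submodule.smul_mem _ _ ha
  · rw [he j x hj hx, zero_smul]
    exact Submodule.zero_mem _

theorem contract_map_sgn (S : DGStr k M) {i : ℤ} (n : ℤ) {e : M →ₗ[k] k}
    (he : ∀ j x, j ≠ i → x ∈ S.gr j → e x = 0) (p : A →ₗ[k] A') (z : M ⊗[k] A) :
    contract A' e (TensorProduct.map (S.sgn n) p z) = sg k (n * i) • p (contract A e z) := by
  refine LinearMap.congr_fun (f := contract A' e ∘ₗ TensorProduct.map (S.sgn n) p)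
    (g := sg k (n * i) • p ∘ₗ contract A e) ?_ z
  refine TensorProduct.ext (S.ext_hom fun j x hx => LinearMap.ext fun a => ?_)
  by_cases hj : j = i
  · subst hj; simp [S.sgn_apply n hx, mul_smul]
  · simp [S.sgn_apply n hx, he j x hj hx]

end

/-- Contraction is multiplicative. The functional on the second factor is concentrated in degree
`0`, so no sign appears. -/
theorem contract_twMul {A : Type*} [Ring A] [Algebra k A] (S : DGStr k A) (T : DGStr k N)
    (e : M →ₗ[k] k) {e' : N →ₗ[k] k} (he' : ∀ j y, j ≠ 0 → y ∈ T.gr j → e' y = 0)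
    (z : M ⊗[k] A) (w : N ⊗[k] A) :
    contract A (LinearMap.mul' k k ∘ₗ TensorProduct.map e e') (twMul M S T (z ⊗ₜ w))
      = contract A e z * contract A e' w := by
  refine LinearMap.congr_fun (f := contract A (LinearMap.mul' k k ∘ₗ TensorProduct.map e e')
      ∘ₗ twMul M S T)
    (g := LinearMap.mul' k A ∘ₗ TensorProduct.map (contract A e) (contract A e')) ?_ (z ⊗ₜ w)
  refine TensorProduct.ext (TensorProduct.ext (LinearMap.ext fun x => S.ext_hom
      fun i c hc => T.ext_tmul S fun j j' y b hy hb => ?_))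
  by_cases hj : j = 0
  · subst hj
    simp [twMul_apply S T x b hc hy, sg_zero, mul_smul, smul_comm (e' y)]
  · simp [twMul_apply S T x b hc hy, he' j y hj hy]

end Contract

/-! ### Finite-dimensional subcomodules -/

section Sub

variable {k : Type u} [Field k]

namespace DGStr

variable {V : Type*} [AddCommGroup V] [Module k V] {W : Type*} [AddCommGroup W] [Module k W]

theorem proj_mem (S : DGStr k V) (n : ℤ) (x : V) : S.proj n x ∈ S.gr n := by
  refine S.induction (p := fun x => S.proj n x ∈ S.gr n) ?_ ?_ x
  · intro i x hx
    rw [S.proj_apply n hx]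
    split_ifs with h
    · exact h ▸ hx
    · exact Submodule.zero_mem _
  · intro x y hx hy
    rw [map_add]; exact add_mem hx hy

/-- Each element is the sum of its homogeneous components, over any large enough set of degrees. -/
theorem exists_sum_proj (S : DGStr k V) (x : V) :
    ∃ F : Finset ℤ, ∀ F', F ⊆ F' → ∑ i ∈ F', S.proj i x = x := by
  refine S.induction (p := fun x => ∃ F : Finset ℤ, ∀ F', F ⊆ F' → ∑ i ∈ F', S.proj i x = x)
    ?_ ?_ x
  · intro i x hx
    refine ⟨{i}, fun F' h => ?_⟩
    simp only [S.proj_apply _ hx, Finset.sum_ite_eq]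
    rw [if_pos (h (Finset.mem_singleton_self i))]
  · rintro x y ⟨F, hF⟩ ⟨G, hG⟩
    refine ⟨F ∪ G, fun F' h => ?_⟩
    simp only [map_add, Finset.sum_add_distrib]
    rw [hF F' (Finset.union_subset_left h), hG F' (Finset.union_subset_right h)]

theorem proj_map (S : DGStr k V) (T : DGStr k W) {f : V →ₗ[k] W} (hf : f ∈ S.homDeg T 0) (n : ℤ)
    (x : V) : T.proj n (f x) = f (S.proj n x) := by
  refine LinearMap.congr_fun (f := T.proj n ∘ₗ f) (g := f ∘ₗ S.proj n) ?_ x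
  refine S.ext_hom fun i x hx => ?_
  have h := hf i x hx
  rw [add_zero] at h
  simp only [LinearMap.comp_apply, S.proj_apply n hx, T.proj_apply n h]
  split_ifs <;> simp

/-- Injective maps of degree `0` reflect degrees. -/
theorem mem_gr_of_injective (S : DGStr k V) (T : DGStr k W) {f : V →ₗ[k] W}
    (hf : f ∈ S.homDeg T 0) (hi : Function.Injective f) {n : ℤ} {x : V} (hx : f x ∈ T.gr n) :
    x ∈ S.gr n := by
  have h := S.proj_map T hf n x
  rw [T.proj_apply n hx, if_pos rfl] at h
  rw [hi h]
  exact S.proj_mem n x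

/-- The cochain complex on a graded subspace that is stable under the differential. -/
def restrict (S : DGStr k V) (U : Submodule k V) (hp : ∀ n, ∀ x ∈ U, S.proj n x ∈ U)
    (hd : ∀ x ∈ U, S.d x ∈ U) : DGStr k U where
  gr n := (S.gr n).comap U.subtype
  internal := by
    refine DirectSum.isInternal_submodule_of_iSupIndep_of_iSup_eq_top ?_ ?_
    · refine iSupIndep_def.2 fun n => Submodule.disjoint_def.2 fun x hx hx' => ?_
      have h := iSupIndep_def.1 S.internal.submodule_iSupIndep n
      refine Subtype.ext (Submodule.disjoint_def.1 h x.1 hx ?_)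
      have hle : (⨆ j, ⨆ _ : j ≠ n, (S.gr j).comap U.subtype)
          ≤ (⨆ j, ⨆ _ : j ≠ n, S.gr j).comap U.subtype :=
        iSup₂_le fun j hj => Submodule.comap_mono (le_iSup₂_of_le j hj le_rfl)
      exact hle hx'
    · refine eq_top_iff.2 fun x _ => ?_
      obtain ⟨F, hF⟩ := S.exists_sum_proj x.1
      have hx : x = ∑ i ∈ F, (⟨S.proj i x.1, hp i _ x.2⟩ : U) :=
        Subtype.ext (by rw [AddSubmonoidClass.coe_finsetSum, hF F subset_rfl])
      rw [hx]
      exact Submodule.sum_mem _ fun i _ => Submodule.mem_iSup_of_mem i (S.proj_mem i x.1)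
  d := S.d.restrict hd
  d_mem h := S.d_mem h
  d_d x := Subtype.ext (S.d_d x.1)

end DGStr

variable {B : CDGHopf k}

/-- The subspace `V` of `M` is a dg-subcomodule: it is graded, stable under the differential, and
the coaction sends it to `V ⊗ B`. -/
structure IsSubcomod (M : DGComod B) (V : Submodule k M) : Prop where
  proj_mem : ∀ n, ∀ x ∈ V, M.str.proj n x ∈ V
  d_mem : ∀ x ∈ V, M.str.d x ∈ V
  coact_mem : ∀ x ∈ V, M.coact x ∈ LinearMap.range (LinearMap.rTensor B V.subtype)

theorem range_rTensor_mono {M : Type*} [AddCommGroup M] [Module k M] {A : Type*} [AddCommGroup A]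
    [Module k A] {V W : Submodule k M} (h : V ≤ W) :
    LinearMap.range (LinearMap.rTensor A V.subtype)
      ≤ LinearMap.range (LinearMap.rTensor A W.subtype) := by
  rintro _ ⟨z, rfl⟩
  refine ⟨LinearMap.rTensor A (Submodule.inclusion h) z, ?_⟩
  rw [← LinearMap.rTensor_comp_apply]
  rfl

theorem IsSubcomod.bot (M : DGComod B) : IsSubcomod M ⊥ where
  proj_mem n x hx := by
    rw [Submodule.mem_bot] at hx ⊢
    rw [hx, map_zero]
  d_mem x hx := by
    rw [Submodule.mem_bot] at hx ⊢
    rw [hx, map_zero]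
  coact_mem x hx := by
    rw [Submodule.mem_bot] at hx
    rw [hx, map_zero]
    exact Submodule.zero_mem _

theorem IsSubcomod.sup {M : DGComod B} {V W : Submodule k M} (hV : IsSubcomod M V)
    (hW : IsSubcomod M W) : IsSubcomod M (V ⊔ W) where
  proj_mem n x hx := by
    obtain ⟨y, hy, z, hz, rfl⟩ := Submodule.mem_sup.1 hx
    rw [map_add]
    exact add_mem (Submodule.mem_sup_left (hV.proj_mem n y hy))
      (Submodule.mem_sup_right (hW.proj_mem n z hz))
  d_mem x hx := by
    obtain ⟨y, hy, z, hz, rfl⟩ := Submodule.mem_sup.1 hx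
    rw [map_add]
    exact add_mem (Submodule.mem_sup_left (hV.d_mem y hy))
      (Submodule.mem_sup_right (hW.d_mem z hz))
  coact_mem x hx := by
    obtain ⟨y, hy, z, hz, rfl⟩ := Submodule.mem_sup.1 hx
    rw [map_add]
    exact add_mem (range_rTensor_mono le_sup_left (hV.coact_mem y hy))
      (range_rTensor_mono le_sup_right (hW.coact_mem z hz))

/-- Coassociativity, as the statement that the functionals on `B` act on `M` through the
convolution product. -/
theorem rcontract_coact (M : DGComod B) (f g : B →ₗ[k] k) (x : M) :
    rcontract M g (M.coact (rcontract M f (M.coact x)))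
      = rcontract M (LinearMap.mul' k k ∘ₗ TensorProduct.map g f ∘ₗ Coalgebra.comul)
        (M.coact x) := by
  have h1 : ∀ z : M ⊗[k] B, rcontract M g (M.coact (rcontract M f z))
      = rcontract M (LinearMap.mul' k k ∘ₗ TensorProduct.map g f)
        (TensorProduct.assoc k M B B (LinearMap.rTensor B M.coact z)) := by
    intro z
    induction z with
    | zero => simp
    | add z w hz hw => simp only [map_add, hz, hw]
    | tmul y b =>
      rw [rcontract_tmul, map_smul, map_smul, LinearMap.rTensor_tmul]
      generalize M.coact y = w
      induction w with
      | zero => simp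
      | add z w hz hw => simp only [map_add, TensorProduct.add_tmul, smul_add, hz, hw]
      | tmul y c => simp [mul_smul, smul_comm (f b)]
  rw [h1, M.coact_coact]
  generalize M.coact x = w
  induction w with
  | zero => simp
  | add z w hz hw => simp only [map_add, hz, hw]
  | tmul y c => simp

theorem proj_rcontract (M : DGComod B) (f : B →ₗ[k] k) {i : ℤ} (n : ℤ) {z : M ⊗[k] B}
    (hz : z ∈ M.str.tensorGr B.str i) : M.str.proj n (rcontract M f z)
      = rcontract M (f ∘ₗ B.str.proj (i - n)) z := by
  refine M.str.tensorGr_ext B.str (f := M.str.proj n ∘ₗ rcontract M f) ?_ hz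
  intro j j' x b h hx hb
  simp only [LinearMap.comp_apply, rcontract_tmul, map_smul, M.str.proj_apply n hx,
    B.str.proj_apply _ hb]
  by_cases hj : j = n
  · rw [if_pos hj, if_pos (by omega)]
  · rw [if_neg hj, if_neg (by omega), map_zero, smul_zero, zero_smul]

theorem d_rcontract (M : DGComod B) (f : B →ₗ[k] k) {i : ℤ} {z : M ⊗[k] B}
    (hz : z ∈ M.str.tensorGr B.str i) : M.str.d (rcontract M f z)
      = rcontract M f (M.str.tensorD B.str z)
        - rcontract M (sg k i • f ∘ₗ B.str.d ∘ₗ B.str.sgn 1) z := by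
  refine M.str.tensorGr_ext B.str (f := M.str.d ∘ₗ rcontract M f)
    (g := rcontract M f ∘ₗ M.str.tensorD B.str
      - rcontract M (sg k i • f ∘ₗ B.str.d ∘ₗ B.str.sgn 1)) ?_ hz
  intro j j' x b h hx hb
  simp only [LinearMap.comp_apply, LinearMap.sub_apply, LinearMap.smul_apply, rcontract_tmul,
    map_smul, map_add, M.str.tensorD_apply B.str hx, B.str.sgn_apply 1 hb, smul_smul, smul_eq_mul]
  rw [one_mul, ← mul_assoc, ← sg_add, sg_eq (m := i + j') (n := j) j' (by rw [← h]; ring),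
    add_sub_cancel_right]

/-- The subspace spanned by the coefficients of `γ(x)`, as the orbit of `x` under the functionals
on `B`. -/
def coeffSpace (M : DGComod B) (x : M) : Submodule k M where
  carrier := {y | ∃ f : B →ₗ[k] k, rcontract M f (M.coact x) = y}
  add_mem' := by
    rintro _ _ ⟨f, rfl⟩ ⟨g, rfl⟩
    exact ⟨f + g, by simp [rcontract, LinearMap.lTensor_add]⟩
  zero_mem' := ⟨0, by simp [rcontract]⟩
  smul_mem' := by
    rintro c _ ⟨f, rfl⟩
    exact ⟨c • f, by simp [rcontract, LinearMap.lTensor_smul]⟩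

theorem self_mem_coeffSpace (M : DGComod B) (x : M) : x ∈ coeffSpace M x :=
  ⟨Coalgebra.counit, by simp [rcontract, M.counit_coact]⟩

theorem finite_coeffSpace (M : DGComod B) (x : M) : FiniteDimensional k (coeffSpace M x) := by
  obtain ⟨V, hV, h⟩ := exists_finite_rcontract (M.coact x)
  refine Submodule.finiteDimensional_of_le (S₂ := V) ?_
  rintro _ ⟨f, rfl⟩
  exact h f

theorem rcontract_mem_coeffSpace (M : DGComod B) (x : M) (f : B →ₗ[k] k) {y : M}
    (hy : y ∈ coeffSpace M x) : rcontract M f (M.coact y) ∈ coeffSpace M x := by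
  obtain ⟨g, rfl⟩ := hy
  exact ⟨_, (rcontract_coact M g f x).symm⟩

/-- The coefficients of a homogeneous `x` and of `dx` together span a dg-subcomodule: a homogeneous
component of a coefficient of `x` is again a coefficient of `x` by `proj_rcontract`, and its
differential is a sum of coefficients of `dx` and `x` by `d_rcontract`. -/
theorem isSubcomod_coeffSpace (M : DGComod B) {i : ℤ} {x : M} (hx : x ∈ M.str.gr i) :
    IsSubcomod M (coeffSpace M x ⊔ coeffSpace M (M.str.d x)) where
  proj_mem n y hy := by
    obtain ⟨_, ⟨f, rfl⟩, _, ⟨g, rfl⟩, rfl⟩ := Submodule.mem_sup.1 hy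
    rw [map_add, proj_rcontract M f n (M.coact_gr hx),
      proj_rcontract M g n (M.coact_gr (M.str.d_mem hx))]
    exact add_mem (Submodule.mem_sup_left ⟨_, rfl⟩) (Submodule.mem_sup_right ⟨_, rfl⟩)
  d_mem y hy := by
    obtain ⟨_, ⟨f, rfl⟩, _, ⟨g, rfl⟩, rfl⟩ := Submodule.mem_sup.1 hy
    have h1 : M.str.tensorD B.str (M.coact x) = M.coact (M.str.d x) := (M.coact_d x).symm
    have h2 : M.str.tensorD B.str (M.coact (M.str.d x)) = M.coact (M.str.d (M.str.d x)) :=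
      (M.coact_d _).symm
    rw [map_add, d_rcontract M f (M.coact_gr hx), d_rcontract M g (M.coact_gr (M.str.d_mem hx)),
      h1, h2, M.str.d_d, map_zero, map_zero, zero_sub]
    exact add_mem (sub_mem (Submodule.mem_sup_right ⟨_, rfl⟩) (Submodule.mem_sup_left ⟨_, rfl⟩))
      (neg_mem (Submodule.mem_sup_right ⟨_, rfl⟩))
  coact_mem y hy := by
    refine mem_range_of_rcontract fun f => ?_
    obtain ⟨a, ha, b, hb, rfl⟩ := Submodule.mem_sup.1 hy
    rw [map_add, map_add]
    exact add_mem (Submodule.mem_sup_left (rcontract_mem_coeffSpace M x f ha))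
      (Submodule.mem_sup_right (rcontract_mem_coeffSpace M _ f hb))

/-- The fundamental theorem on comodules: each element lies in a finite-dimensional
dg-subcomodule. -/
theorem exists_finite_subcomod (M : DGComod B) (x : M) :
    ∃ V : Submodule k M, FiniteDimensional k V ∧ IsSubcomod M V ∧ x ∈ V := by
  refine M.str.induction (p := fun x => ∃ V : Submodule k M, FiniteDimensional k V ∧
    IsSubcomod M V ∧ x ∈ V) ?_ ?_ x
  · intro i x hx
    have := finite_coeffSpace M x
    have := finite_coeffSpace M (M.str.d x)
    exact ⟨_, inferInstance, isSubcomod_coeffSpace M hx,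
      Submodule.mem_sup_left (self_mem_coeffSpace M x)⟩
  · rintro x y ⟨V, hV, hV', hx⟩ ⟨W, hW, hW', hy⟩
    exact ⟨V ⊔ W, inferInstance, hV'.sup hW',
      add_mem (Submodule.mem_sup_left hx) (Submodule.mem_sup_right hy)⟩

theorem exists_finite_subcomod_of_finite (M : DGComod B) (U : Submodule k M)
    [FiniteDimensional k U] :
    ∃ V : Submodule k M, FiniteDimensional k V ∧ IsSubcomod M V ∧ U ≤ V := by
  obtain ⟨s, hs⟩ := (Submodule.fg_iff_finiteDimensional U).2 inferInstance
  suffices h : ∀ s : Finset M, ∃ V : Submodule k M, FiniteDimensional k V ∧ IsSubcomod M V ∧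
      ∀ x ∈ s, x ∈ V by
    obtain ⟨V, h1, h2, h3⟩ := h s
    exact ⟨V, h1, h2, hs ▸ Submodule.span_le.2 h3⟩
  classical
  intro s
  induction s using Finset.induction_on with
  | empty => exact ⟨⊥, inferInstance, IsSubcomod.bot M, by simp⟩
  | insert x s _ ih =>
    obtain ⟨V, h1, h2, h3⟩ := ih
    obtain ⟨W, h4, h5, h6⟩ := exists_finite_subcomod M x
    refine ⟨V ⊔ W, inferInstance, h2.sup h5, fun y hy => ?_⟩
    rcases Finset.mem_insert.1 hy with rfl | hy
    · exact Submodule.mem_sup_right h6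
    · exact Submodule.mem_sup_left (h3 y hy)

theorem lTensor_rTensor_apply {M N A A' : Type*} [AddCommGroup M] [Module k M] [AddCommGroup N]
    [Module k N] [AddCommGroup A] [Module k A] [AddCommGroup A'] [Module k A'] (ψ : M →ₗ[k] N)
    (f : A →ₗ[k] A') (z : M ⊗[k] A) : LinearMap.lTensor N f (LinearMap.rTensor A ψ z)
      = LinearMap.rTensor A' ψ (LinearMap.lTensor M f z) := by
  rw [← LinearMap.comp_apply, ← LinearMap.comp_apply, LinearMap.lTensor_comp_rTensor,
    LinearMap.rTensor_comp_lTensor]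

theorem rTensor_subtype_injective {M : Type*} [AddCommGroup M] [Module k M] (A : Type*)
    [AddCommGroup A] [Module k A] (V : Submodule k M) :
    Function.Injective (LinearMap.rTensor A V.subtype) :=
  Module.Flat.rTensor_preserves_injective_linearMap _ V.injective_subtype

/-- The coaction on a dg-subcomodule. -/
def subCoact (M : DGComod B) (V : Submodule k M) (h : IsSubcomod M V) : V →ₗ[k] V ⊗[k] B :=
  (LinearEquiv.ofInjective _ (rTensor_subtype_injective B V)).symm.toLinearMap
    ∘ₗ LinearMap.codRestrict _ (M.coact ∘ₗ V.subtype) fun x => h.coact_mem x.1 x.2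

theorem rTensor_subCoact (M : DGComod B) (V : Submodule k M) (h : IsSubcomod M V) (x : V) :
    LinearMap.rTensor B V.subtype (subCoact M V h x) = M.coact x.1 := by
  have := LinearEquiv.apply_symm_apply
    (LinearEquiv.ofInjective _ (rTensor_subtype_injective B V)) ⟨M.coact x.1, h.coact_mem x.1 x.2⟩
  exact congrArg Subtype.val this

/-- A dg-subcomodule, as a dg-comodule. -/
def subComod (M : DGComod B) (V : Submodule k M) (h : IsSubcomod M V) : DGComod B where
  carrier := V
  str := M.str.restrict V h.proj_mem h.d_mem
  coact := subCoact M V h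
  coact_gr {i x} hx := by
    refine DGStr.mem_gr_of_injective _ (M.str.tensor B.str)
      (rTensor_mem (A := B.toDGAlg) _ M.str B.str (n := 0) (ψ := V.subtype) ?_)
      (rTensor_subtype_injective B V) (by rw [rTensor_subCoact]; exact M.coact_gr hx)
    intro j y hy
    rw [add_zero]; exact hy
  coact_d x := by
    apply rTensor_subtype_injective B V
    rw [rTensor_subCoact]
    refine (M.coact_d x.1).trans ?_
    rw [← rTensor_subCoact M V h]
    exact LinearMap.congr_fun (tensorD_map (M.str.restrict V h.proj_mem h.d_mem) B.str M.str B.str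
      V.subtype LinearMap.id (fun i x hx => hx) (fun _ => rfl) (fun _ => rfl)) _
  coact_coact x := by
    apply rTensor_subtype_injective (B ⊗[k] B) V
    have e1 : ∀ z : (V ⊗[k] B) ⊗[k] B, LinearMap.rTensor (B ⊗[k] B) V.subtype
        (TensorProduct.assoc k V B B z) = TensorProduct.assoc k M B B
          (LinearMap.rTensor B (LinearMap.rTensor B V.subtype) z) := fun z => by
      refine LinearMap.congr_fun (f := LinearMap.rTensor (B ⊗[k] B) V.subtype
          ∘ₗ (TensorProduct.assoc k V B B).toLinearMap)
        (g := (TensorProduct.assoc k M B B).toLinearMap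
          ∘ₗ LinearMap.rTensor B (LinearMap.rTensor B V.subtype)) ?_ z
      ext; simp
    have e2 : LinearMap.rTensor B V.subtype ∘ₗ subCoact M V h = M.coact ∘ₗ V.subtype :=
      LinearMap.ext fun x => rTensor_subCoact M V h x
    rw [e1, ← LinearMap.rTensor_comp_apply, e2, LinearMap.rTensor_comp_apply, rTensor_subCoact,
      M.coact_coact, ← rTensor_subCoact M V h]
    exact lTensor_rTensor_apply V.subtype Coalgebra.comul _
  counit_coact x := by
    apply rTensor_subtype_injective k V
    rw [← lTensor_rTensor_apply, rTensor_subCoact, M.counit_coact]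
    rfl

theorem subtype_mem_comodHom (M : DGComod B) (V : Submodule k M) (h : IsSubcomod M V) :
    (V.subtype : subComod M V h →ₗ[k] M) ∈ comodHom (subComod M V h) M 0 :=
  ⟨fun i x hx => by rw [add_zero]; exact hx, fun x => (rTensor_subCoact M V h x).symm⟩

theorem inclusion_mem_comodHom (M : DGComod B) {V W : Submodule k M} (h : IsSubcomod M V)
    (h' : IsSubcomod M W) (hVW : V ≤ W) :
    (Submodule.inclusion hVW : subComod M V h →ₗ[k] subComod M W h')
      ∈ comodHom (subComod M V h) (subComod M W h') 0 := by
  refine ⟨fun i x hx => by rw [add_zero]; exact hx, fun x => ?_⟩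
  apply rTensor_subtype_injective B W
  refine (rTensor_subCoact M W h' _).trans ((rTensor_subCoact M V h x).symm.trans ?_)
  exact LinearMap.rTensor_comp_apply (M := B) W.subtype (Submodule.inclusion hVW) (subCoact M V h x)

end Sub

/-! ### The universal family and the families attached to linear maps `B → A` -/

section Universal

variable {k : Type u} [Field k] {B : CDGHopf k}

/-- The extension by linearity over `B` of the coaction, `x ⊗ b ↦ γ(x) · b`. -/
def coactExt (M : DGComod B) : M ⊗[k] B →ₗ[k] M ⊗[k] B :=
  LinearMap.lTensor M (LinearMap.mul' k B) ∘ₗ (TensorProduct.assoc k M B B).toLinearMap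
    ∘ₗ LinearMap.rTensor B M.coact

theorem coactExt_tmul (M : DGComod B) (x : M) (b : B) :
    coactExt M (x ⊗ₜ b) = rmul M b (M.coact x) := by
  have : LinearMap.lTensor M (LinearMap.mul' k B) ∘ₗ (TensorProduct.assoc k M B B).toLinearMap
      ∘ₗ (TensorProduct.mk k (M ⊗[k] B) B).flip b = rmul M b := by
    ext; simp
  simpa [coactExt] using LinearMap.congr_fun this (M.coact x)

theorem coactExt_one (M : DGComod B) (x : M) : coactExt M (x ⊗ₜ 1) = M.coact x := by
  rw [coactExt_tmul, rmul_one]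

theorem coactExt_aLin (M : DGComod B) : coactExt M ∈ aLin k B M M := by
  intro a z
  induction z with
  | zero => simp
  | add x y hx hy => simp [hx, hy]
  | tmul x b => rw [rmul_tmul, coactExt_tmul, coactExt_tmul, rmul_rmul]

theorem coactExt_mem (M : DGComod B) :
    coactExt M ∈ (M.str.tensor B.str).homDeg (M.str.tensor B.str) 0 := by
  intro i z hz
  refine M.str.tensorGr_map B.str (coactExt M) _ ?_ hz
  intro i1 i2 x b h hx hb
  rw [coactExt_tmul, add_zero, ← h]
  exact rmul_mem (A := B.toDGAlg) M.str hb (M.coact_gr hx)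

/-- The family of the maps `M ⊗ B → M ⊗ B` given by the coactions. It is the universal element of
the functors `A ↦ End(ω ⊗ A)` and `A ↦ Z⁰End_⊗(ω ⊗ A)`. -/
def univFam (C : TensorSub B) : Fam C B.toCDGAlg := fun M => coactExt M.1

theorem univFam_mem_zEnd (C : TensorSub B) : univFam C ∈ zEnd C B.toCDGAlg := by
  refine ⟨⟨fun M => coactExt_mem M.1, fun M => coactExt_aLin M.1, fun m M M' ψ hψ z => ?_⟩, ?_, ?_,
    fun M N => ?_⟩
  · rw [mul_zero, sg_zero, one_smul]
    refine LinearMap.congr_fun (f := LinearMap.rTensor B ψ ∘ₗ coactExt M.1)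
      (g := coactExt M'.1 ∘ₗ LinearMap.rTensor B ψ) ?_ z
    refine aLin_ext (aLin_comp (aLin_rTensor ψ) (coactExt_aLin _))
      (aLin_comp (coactExt_aLin _) (aLin_rTensor ψ)) fun x => ?_
    simp only [LinearMap.comp_apply, LinearMap.rTensor_tmul, coactExt_one, hψ.2]
  · refine Fam.ext fun M => aLin_ext (aLin_homD (A := B.toDGAlg) _ _ (coactExt_aLin M.1)
      (coactExt_mem M.1)) (Submodule.zero_mem _) fun x => ?_
    refine (DGStr.homD_apply _ _ (coactExt_mem M.1) _).trans ?_
    rw [DGStr.tensor_d, tensorD_tmul_one (A := B.toCDGAlg), coactExt_one, coactExt_one, sg_zero,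
      one_smul, M.1.coact_d]
    exact sub_self _
  · refine aLin_ext (coactExt_aLin _) aLin_id fun x => ?_
    refine (coactExt_one _ x).trans ?_
    have h : ∀ c : k, (1 : k) ⊗ₜ[k] algebraMap k B c = c ⊗ₜ (1 : B) := fun c => by
      rw [Algebra.algebraMap_eq_smul_one, TensorProduct.tmul_smul, TensorProduct.smul_tmul',
        smul_eq_mul, mul_one]
    exact h x
  · refine aLin_ext (coactExt_aLin _) (tensorLin_aLin _ _ _ _ (coactExt_aLin N.1)) fun z => ?_
    refine (coactExt_one _ z).trans ?_
    refine LinearMap.congr_fun (f := tensorCoact M.1 N.1) (g := res (tensorLin B.toCDGAlg M.1.str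
      N.1.str 0 (univFam C M) (univFam C N))) (M.1.str.ext_tmul N.1.str fun i j x y hx hy => ?_) z
    rw [res_apply, tensorLin_apply _ _ _ _ _ hx, zero_mul, sg_zero, one_smul]
    exact congrArg₂ (fun a b => twMul M.1 B.str N.1.str (a ⊗ₜ b)) (coactExt_one _ x).symm
      (coactExt_one _ y).symm

variable (C : TensorSub B) (A : CDGAlg.{u, u} k)

/-- The family attached to a linear map `p : B → A`, thought of as having degree `n`: its component
at `M` is linear over `A` and sends `x ⊗ 1` to `(𝕀 ⊗ p)(γ(x))`, where `𝕀 ⊗ p` carries the Koszul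
sign `(-1)^{n|x|}`. -/
def coFam (n : ℤ) : (B →ₗ[k] A) →ₗ[k] Fam C A where
  toFun p M := baseChange (A := B) (TensorProduct.map (M.1.str.sgn n) p) (univFam C M)
  map_add' p q := Fam.ext fun M => aLin_ext (baseChange_aLin _ _)
    (Submodule.add_mem _ (baseChange_aLin _ _) (baseChange_aLin _ _)) fun x => by
      refine Eq.trans ?_ (congrArg₂ (· + ·) (baseChange_one _ _ _) (baseChange_one _ _ _)).symm
      simp [baseChange_one, TensorProduct.map_add_right]
  map_smul' c p := Fam.ext fun M => aLin_ext (baseChange_aLin _ _)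
    (Submodule.smul_mem _ c (baseChange_aLin _ _)) fun x => by
      refine Eq.trans ?_ (congrArg (fun y => c • y) (baseChange_one (A := B)
        (TensorProduct.map (M.1.str.sgn n) p) (univFam C M) x)).symm
      simp [baseChange_one, TensorProduct.map_smul_right]

variable {C A}

theorem coFam_one (n : ℤ) (p : B →ₗ[k] A) (M : C.Obj) (x : M.1) :
    coFam C A n p M (x ⊗ₜ 1) = TensorProduct.map (M.1.str.sgn n) p (M.1.coact x) :=
  (baseChange_one _ _ _).trans (congrArg _ (coactExt_one M.1 x))

theorem coFam_aLin (n : ℤ) (p : B →ₗ[k] A) (M : C.Obj) : coFam C A n p M ∈ aLin k A M.1 M.1 :=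
  baseChange_aLin _ _

theorem coFam_zero (p : B →ₗ[k] A) :
    coFam C A 0 p = famMap (A := B.toCDGAlg) C p (univFam C) := by
  refine Fam.ext fun M => ?_
  show baseChange (A := B) (TensorProduct.map (M.1.str.sgn 0) p) (univFam C M) = _
  rw [DGStr.sgn_zero]
  rfl

section

variable {M : Type*} [AddCommGroup M] [Module k M]

theorem map_sgn_mem (S : DGStr k M) {n : ℤ} {p : B →ₗ[k] A} (hp : p ∈ B.str.homDeg A.str n) :
    TensorProduct.map (S.sgn n) p ∈ (S.tensor B.str).homDeg (S.tensor A.str) n := by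
  intro i z hz
  refine S.tensorGr_map B.str (TensorProduct.map (S.sgn n) p) _ ?_ hz
  intro i1 i2 x b h hx hb
  rw [TensorProduct.map_tmul, S.sgn_apply _ hx, ← TensorProduct.smul_tmul']
  exact Submodule.smul_mem _ _ (S.tmul_mem A.str (by rw [← h]; ring) hx (hp i2 b hb))

theorem homD_map_sgn (S : DGStr k M) {n : ℤ} {p : B →ₗ[k] A} (hp : p ∈ B.str.homDeg A.str n) :
    (S.tensor B.str).homD (S.tensor A.str) (TensorProduct.map (S.sgn n) p)
      = TensorProduct.map (S.sgn (n + 1)) (B.str.homD A.str p) := by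
  refine S.ext_tmul B.str fun i j x a hx ha => ?_
  rw [DGStr.homD_apply _ _ (map_sgn_mem S hp)]
  simp only [DGStr.tensor_d, TensorProduct.map_tmul, S.sgn_apply _ hx, S.tensorD_apply _ hx,
    S.sgn_apply _ (S.d_mem hx), ← TensorProduct.smul_tmul', map_smul, map_add,
    B.str.homD_apply A.str hp, TensorProduct.tmul_sub,
    TensorProduct.tmul_smul, smul_add, smul_smul, ← sg_add]
  rw [sg_eq (m := n + n * (i + 1)) (n := n * i) n (by ring),
    show n * i + i = (n + 1) * i by ring, show n + (i + n * i) = n + (n + 1) * i by ring]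
  abel

end

theorem coFam_mem {n : ℤ} {p : B →ₗ[k] A} (hp : p ∈ B.str.homDeg A.str n) :
    coFam C A n p ∈ natDeg C A n := by
  refine ⟨fun M => baseChange_mem (A := B.toCDGAlg) _ (add_zero n) (map_sgn_mem _ hp)
    (coactExt_mem M.1), fun M => coFam_aLin n p M, fun m M M' ψ hψ z => ?_⟩
  refine LinearMap.congr_fun (f := LinearMap.rTensor A ψ ∘ₗ coFam C A n p M)
    (g := sg k (m * n) • coFam C A n p M' ∘ₗ LinearMap.rTensor A ψ) ?_ z
  refine aLin_ext (aLin_comp (aLin_rTensor ψ) (coFam_aLin n p M))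
    (Submodule.smul_mem _ _ (aLin_comp (coFam_aLin n p M') (aLin_rTensor ψ))) fun x => ?_
  have h2 := LinearMap.congr_fun (DGStr.sgn_comp _ _ n hψ.1)
  simp only [LinearMap.comp_apply, LinearMap.smul_apply, LinearMap.rTensor_tmul, coFam_one, hψ.2]
  refine LinearMap.congr_fun
    (f := LinearMap.rTensor A ψ ∘ₗ TensorProduct.map (M.1.str.sgn n) p)
    (g := sg k (m * n) • TensorProduct.map (M'.1.str.sgn n) p ∘ₗ LinearMap.rTensor B ψ)
    (TensorProduct.ext' fun y a => ?_) (M.1.coact x)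
  have h3 := h2 y
  simp only [LinearMap.comp_apply, LinearMap.smul_apply] at h3
  simp only [LinearMap.comp_apply, LinearMap.smul_apply, TensorProduct.map_tmul,
    LinearMap.rTensor_tmul, h3, ← TensorProduct.smul_tmul', smul_smul, mul_comm m n, sg_mul_self,
    one_smul]

theorem famD_coFam {n : ℤ} {p : B →ₗ[k] A} (hp : p ∈ B.str.homDeg A.str n) :
    famD C A (coFam C A n p) = coFam C A (n + 1) (B.str.homD A.str p) := by
  have h' := coFam_mem (C := C) hp
  refine Fam.ext fun M => aLin_ext (aLin_homD (A := A.toDGAlg) _ _ (h'.2.1 M) (h'.1 M))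
    (coFam_aLin _ _ M) fun x => ?_
  rw [famD_apply, DGStr.homD_apply _ _ (h'.1 M), DGStr.tensor_d, tensorD_tmul_one, coFam_one,
    coFam_one, coFam_one, ← homD_map_sgn M.1.str hp, DGStr.homD_apply _ _ (map_sgn_mem M.1.str hp),
    M.1.coact_d]
  rfl

/-- Convolution of linear maps corresponds to composition of families. -/
theorem coFam_convol (p q : B →ₗ[k] A) :
    coFam C A 0 (convol p q) = coFam C A 0 p * coFam C A 0 q := by
  refine Fam.ext fun M => aLin_ext (coFam_aLin _ _ M)
    (aLin_comp (coFam_aLin _ _ M) (coFam_aLin _ _ M)) fun x => ?_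
  -- evaluate the family of `p` on `(𝕀 ⊗ q)(z)`; for `z = γ(x)` coassociativity applies
  have h : ∀ z : M.1 ⊗[k] B, coFam C A 0 p M (LinearMap.lTensor M.1 q z)
      = LinearMap.lTensor M.1 (LinearMap.mul' k A ∘ₗ TensorProduct.map p q)
        (TensorProduct.assoc k M.1 B B (LinearMap.rTensor B M.1.coact z)) := by
    intro z
    induction z with
    | zero => simp
    | add z w hz hw => simp only [map_add, hz, hw]
    | tmul y b =>
      have := coFam_aLin 0 p M (q b) (y ⊗ₜ 1)
      rw [rmul_tmul, one_mul, coFam_one, DGStr.sgn_zero] at this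
      rw [LinearMap.lTensor_tmul, this, LinearMap.rTensor_tmul]
      generalize M.1.coact y = w
      induction w with
      | zero => simp
      | add z w hz hw => simp only [map_add, TensorProduct.add_tmul, hz, hw]
      | tmul y c => simp
  rw [Fam.mul_apply, LinearMap.comp_apply, coFam_one, coFam_one, DGStr.sgn_zero]
  refine Eq.trans ?_ (h (M.1.coact x)).symm
  rw [M.1.coact_coact]
  exact LinearMap.lTensor_comp_apply (M := M.1) (LinearMap.mul' k A ∘ₗ TensorProduct.map p q)
    Coalgebra.comul (M.1.coact x)

/-- The unit of the convolution product corresponds to the identity. -/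
theorem coFam_counit : coFam C A 0 (Algebra.linearMap k A ∘ₗ Coalgebra.counit) = 1 := by
  refine Fam.ext fun M => aLin_ext (coFam_aLin _ _ M) aLin_id fun x => ?_
  rw [coFam_one, DGStr.sgn_zero]
  change LinearMap.lTensor M.1 _ _ = _
  rw [LinearMap.lTensor_comp, LinearMap.comp_apply, M.1.counit_coact]
  simp

end Universal

/-! ### Reconstruction of linear maps `B → A` from natural families -/

section Reconstruct

variable {k : Type u} [Field k] {B : CDGHopf k}

/-- The cdg-Hopf algebra `B` as a right dg-comodule over itself. -/
abbrev regComod (B : CDGHopf k) : DGComod B where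
  carrier := B
  str := B.str
  coact := Coalgebra.comul
  coact_gr := B.comul_gr
  coact_d := B.comul_d
  coact_coact := Coalgebra.coassoc_apply
  counit_coact := Coalgebra.lTensor_counit_comul

/-- The restriction of the counit to a dg-subcomodule of `B`. -/
def subCounit {V : Submodule k B} (h : IsSubcomod (regComod B) V) :
    subComod (regComod B) V h →ₗ[k] k :=
  Coalgebra.counit ∘ₗ V.subtype

theorem subCounit_eq_zero {V : Submodule k B} (h : IsSubcomod (regComod B) V) (j : ℤ)
    (x : subComod (regComod B) V h) (hj : j ≠ 0) (hx : x ∈ (subComod (regComod B) V h).str.gr j) :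
    subCounit h x = 0 :=
  B.counit_gr hj hx

theorem contract_subCounit {V : Submodule k B} (h : IsSubcomod (regComod B) V)
    (x : subComod (regComod B) V h) :
    contract B (subCounit h) ((subComod (regComod B) V h).coact x) = V.subtype x := by
  refine (contract_rTensor (Coalgebra.counit : B →ₗ[k] k) V.subtype _).symm.trans ?_
  refine (congrArg (contract B Coalgebra.counit) (rTensor_subCoact (regComod B) V h x)).trans ?_
  show TensorProduct.lid k B (LinearMap.rTensor B Coalgebra.counit (Coalgebra.comul (x.1 : B))) = _
  rw [Coalgebra.rTensor_counit_comul, TensorProduct.lid_tmul, one_smul]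
  rfl

/-- The map `(e ⊗ 𝕀) ∘ γ : M → B` attached to a functional `e` on `M` is a map of comodules. -/
theorem comul_contract_coact (M : DGComod B) (e : M →ₗ[k] k) (x : M) :
    Coalgebra.comul (contract B e (M.coact x))
      = LinearMap.rTensor B (contract B e ∘ₗ M.coact) (M.coact x) := by
  have h : ∀ z : M ⊗[k] B, contract (B ⊗[k] B) e
      (TensorProduct.assoc k M B B (LinearMap.rTensor B M.coact z))
        = LinearMap.rTensor B (contract B e ∘ₗ M.coact) z := by
    intro z
    induction z with
    | zero => simp
    | add z w hz hw => simp only [map_add, hz, hw]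
    | tmul y b =>
      rw [LinearMap.rTensor_tmul, LinearMap.rTensor_tmul, LinearMap.comp_apply]
      generalize M.coact y = w
      induction w with
      | zero => simp
      | add z w hz hw => simp only [map_add, TensorProduct.add_tmul, hz, hw]
      | tmul y c => simp [TensorProduct.smul_tmul']
  rw [← h, M.coact_coact, contract_lTensor]

theorem counit_contract_coact (M : DGComod B) (e : M →ₗ[k] k) (x : M) :
    Coalgebra.counit (R := k) (contract B e (M.coact x)) = e x := by
  rw [← contract_lTensor, M.counit_coact, contract_tmul, smul_eq_mul, mul_one]

variable {C : TensorSub B} {A : CDGAlg.{u, u} k}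

/-- A finite-dimensional dg-subcomodule, as an object of a category of dg-comodules that contains
all finite-dimensional ones. -/
def finObj (hC : ∀ M : DGComod B, FiniteDimensional k M → C.mem M) (M : DGComod B)
    (V : Submodule k M) (hV : FiniteDimensional k V) (h : IsSubcomod M V) : C.Obj :=
  ⟨subComod M V h, hC _ hV⟩

variable (hC : ∀ M : DGComod B, FiniteDimensional k M → C.mem M)

/-- The map `V → A`, `b ↦ (ε ⊗ 𝕀)(η^V(b ⊗ 1))`, for a finite-dimensional dg-subcomodule `V`
of `B`. -/
def famEval (η : Fam C A) (V : Submodule k B) (hV : FiniteDimensional k V)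
    (h : IsSubcomod (regComod B) V) : V →ₗ[k] A :=
  contract A (subCounit h) ∘ₗ res (η (finObj hC (regComod B) V hV h))

theorem famEval_coFam (n : ℤ) (p : B →ₗ[k] A) (V : Submodule k B) (hV : FiniteDimensional k V)
    (h : IsSubcomod (regComod B) V) (b : V) : famEval hC (coFam C A n p) V hV h b = p b := by
  refine (congrArg (contract A (subCounit h))
    (coFam_one n p (finObj hC (regComod B) V hV h) b)).trans ?_
  refine (contract_map_sgn _ n (subCounit_eq_zero h) p _).trans ?_
  rw [mul_zero, sg_zero, one_smul]
  exact congrArg p (contract_subCounit h b)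

include hC in
theorem coFam_injective (n : ℤ) : Function.Injective (coFam C A n) := by
  intro p q h
  ext b
  obtain ⟨V, hV, hs, hb⟩ := exists_finite_subcomod (regComod B) b
  rw [← famEval_coFam hC n p V hV hs ⟨b, hb⟩, h, famEval_coFam]

/-- Naturality of `η` with respect to an inclusion `V ≤ W`. -/
theorem famEval_mono {n : ℤ} {η : Fam C A} (hη : η ∈ natDeg C A n) {V W : Submodule k B}
    (hV : FiniteDimensional k V) (hW : FiniteDimensional k W) (h : IsSubcomod (regComod B) V)
    (h' : IsSubcomod (regComod B) W) (hVW : V ≤ W) (b : V) :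
    famEval hC η V hV h b = famEval hC η W hW h' (Submodule.inclusion hVW b) := by
  have hn := hη.2.2 0 (finObj hC (regComod B) V hV h) (finObj hC (regComod B) W hW h') _
    (inclusion_mem_comodHom (regComod B) h h' hVW) (b ⊗ₜ 1)
  rw [zero_mul, sg_zero, one_smul] at hn
  refine Eq.trans ?_ (congrArg (contract A (subCounit h')) hn)
  exact (contract_rTensor (subCounit h') (Submodule.inclusion hVW) _).symm

/-- Compatible linear maps on the members of a directed family of subspaces that covers the space
glue. -/
theorem exists_linearMap_of_directed {M N : Type*} [AddCommGroup M] [Module k M] [AddCommGroup N]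
    [Module k N] {P : Submodule k M → Prop} (hsup : ∀ V W, P V → P W → P (V ⊔ W))
    (hex : ∀ x, ∃ V, P V ∧ x ∈ V) (F : ∀ V : Submodule k M, P V → V →ₗ[k] N)
    (hF : ∀ V W (hV : P V) (hW : P W) (h : V ≤ W) (x : V),
      F V hV x = F W hW (Submodule.inclusion h x)) :
    ∃ p : M →ₗ[k] N, ∀ V (hV : P V) (x : V), p x = F V hV x := by
  choose U hU hmem using hex
  have key : ∀ V (hV : P V) (x : V), F (U x) (hU x) ⟨x, hmem x⟩ = F V hV x := by
    intro V hV x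
    have hW := hsup _ _ (hU x) hV
    rw [hF _ _ (hU x) hW le_sup_left, hF _ _ hV hW le_sup_right]
    rfl
  refine ⟨{ toFun := fun x => F (U x) (hU x) ⟨x, hmem x⟩
            map_add' := fun x y => ?_
            map_smul' := fun c x => ?_ }, fun V hV x => key V hV x⟩
  · have hW := hsup _ _ (hU x) (hU y)
    have hx : x ∈ U x ⊔ U y := Submodule.mem_sup_left (hmem x)
    have hy : y ∈ U x ⊔ U y := Submodule.mem_sup_right (hmem y)
    have h := key _ hW (⟨x, hx⟩ + ⟨y, hy⟩)
    rw [map_add, ← key _ hW ⟨x, hx⟩, ← key _ hW ⟨y, hy⟩] at h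
    exact h
  · exact (key _ (hU x) (c • ⟨x, hmem x⟩)).trans (map_smul _ _ _)

/-- The maps `V → A` defined by a natural family glue to a map `B → A`. -/
theorem exists_glue {n : ℤ} {η : Fam C A} (hη : η ∈ natDeg C A n) :
    ∃ p : B →ₗ[k] A, ∀ (V : Submodule k B) (hV : FiniteDimensional k V)
      (h : IsSubcomod (regComod B) V) (b : V), p b = famEval hC η V hV h b := by
  obtain ⟨p, hp⟩ := exists_linearMap_of_directed
    (P := fun V : Submodule k B => FiniteDimensional k V ∧ IsSubcomod (regComod B) V)
    (fun V W hV hW => ⟨by have := hV.1; have := hW.1; infer_instance, hV.2.sup hW.2⟩)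
    (fun b => let ⟨V, hV, hs, hb⟩ := exists_finite_subcomod (regComod B) b; ⟨V, ⟨hV, hs⟩, hb⟩)
    (fun V h => famEval hC η V h.1 h.2)
    (fun V W hV hW hVW b => famEval_mono hC hη hV.1 hW.1 hV.2 hW.2 hVW b)
  exact ⟨p, fun V hV h b => hp V ⟨hV, h⟩ b⟩

include hC in
/-- Natural families agree if they agree on the finite-dimensional dg-comodules. -/
theorem endAlg_ext {η η' : Fam C A} (hη : η ∈ endAlg C A) (hη' : η' ∈ endAlg C A)
    (h : ∀ M : C.Obj, FiniteDimensional k M.1 → ∀ x : M.1, η M (x ⊗ₜ 1) = η' M (x ⊗ₜ 1)) :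
    η = η' := by
  refine Fam.ext fun M => aLin_ext (aLin_of_endAlg hη M) (aLin_of_endAlg hη' M) fun x => ?_
  obtain ⟨V, hV, hs, hx⟩ := exists_finite_subcomod M.1 x
  have key : ∀ {θ : Fam C A}, θ ∈ endAlg C A → LinearMap.rTensor A V.subtype
      (θ (finObj hC M.1 V hV hs) ((⟨x, hx⟩ : V) ⊗ₜ 1)) = θ M (x ⊗ₜ 1) := by
    intro θ hθ
    refine endAlg_induction (p := fun θ => LinearMap.rTensor A V.subtype
      (θ (finObj hC M.1 V hV hs) ((⟨x, hx⟩ : V) ⊗ₜ 1)) = θ M (x ⊗ₜ 1)) ?_ ?_ hθ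
    · intro n θ hθ
      have := hθ.2.2 0 (finObj hC M.1 V hV hs) M _ (subtype_mem_comodHom M.1 V hs)
        ((⟨x, hx⟩ : V) ⊗ₜ 1)
      rw [zero_mul, sg_zero, one_smul] at this
      exact this
    · intro θ θ' h1 h2
      exact (map_add (LinearMap.rTensor A V.subtype) _ _).trans (congrArg₂ (· + ·) h1 h2)
  exact (key hη).symm.trans ((congrArg (LinearMap.rTensor A V.subtype)
    (h (finObj hC M.1 V hV hs) hV ⟨x, hx⟩)).trans (key hη'))

include hC in
/-- Every natural family of degree `n` comes from a linear map `B → A` of degree `n`. -/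
theorem exists_coFam {n : ℤ} {η : Fam C A} (hη : η ∈ natDeg C A n) :
    ∃ p ∈ B.str.homDeg A.str n, coFam C A n p = η := by
  obtain ⟨p, hp⟩ := exists_glue hC hη
  have hdeg : p ∈ B.str.homDeg A.str n := by
    intro i b hb
    obtain ⟨V, hV, hs, hbV⟩ := exists_finite_subcomod (regComod B) b
    have h1 := hp V hV hs ⟨b, hbV⟩
    rw [show p b = _ from h1]
    refine contract_mem _ A.str (subCounit_eq_zero hs) (zero_add _)
      (hη.1 (finObj hC (regComod B) V hV hs) i _ ?_)
    exact DGStr.tmul_mem _ _ (add_zero i) hb A.one_mem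
  refine ⟨p, hdeg, endAlg_ext hC (natDeg_le (coFam_mem hdeg)) (natDeg_le hη) fun M hM x => ?_⟩
  -- compare after contraction with functionals `e` concentrated in one degree `i`
  refine eq_of_contract M.1.str fun i e he => ?_
  rw [coFam_one, contract_map_sgn M.1.str n he]
  -- the range of `(e ⊗ 𝕀) ∘ γ : M → B` lies in a finite-dimensional dg-subcomodule of `B`
  obtain ⟨V, hV, hs, hle⟩ := exists_finite_subcomod_of_finite (regComod B)
    (LinearMap.range (contract B e ∘ₗ M.1.coact))
  let φ : M.1 →ₗ[k] V := LinearMap.codRestrict V (contract B e ∘ₗ M.1.coact)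
    fun x => hle ⟨x, rfl⟩
  have hφ : (φ : M.1 →ₗ[k] subComod (regComod B) V hs)
      ∈ comodHom M.1 (subComod (regComod B) V hs) (-i) := by
    refine ⟨fun j x hx => ?_, fun x => ?_⟩
    · exact contract_mem M.1.str B.str he (by ring) (M.1.coact_gr hx)
    · apply rTensor_subtype_injective B V
      refine (rTensor_subCoact (regComod B) V hs (φ x)).trans
        ((comul_contract_coact M.1 e x).trans ?_)
      exact LinearMap.rTensor_comp_apply (M := B) V.subtype φ (M.1.coact x)
  have h1 := hη.2.2 (-i) M (finObj hC (regComod B) V hV hs) φ hφ (x ⊗ₜ 1)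
  have h2 := (congrArg (contract A (subCounit hs)) h1).trans
    (map_smul (contract A (subCounit hs)) _ _)
  have he' : subCounit hs ∘ₗ φ = e := LinearMap.ext fun x => counit_contract_coact M.1 e x
  have h3 : contract A (subCounit hs) (LinearMap.rTensor A φ (η M (x ⊗ₜ 1)))
      = contract A e (η M (x ⊗ₜ 1)) := (contract_rTensor _ _ _).trans (by rw [he'])
  refine Eq.trans ?_ (h2.symm.trans h3)
  rw [show -i * n = -(n * i) by ring, sg_neg]
  exact congrArg (fun y => sg k (n * i) • y) (hp V hV hs (φ x))

/-! ### Tensor compatibility and multiplicativity -/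

theorem coFam_unit (n : ℤ) (p : B →ₗ[k] A) :
    coFam C A n p C.one ((1 : k) ⊗ₜ 1) = (1 : k) ⊗ₜ p 1 := by
  refine (coFam_one n p C.one (1 : k)).trans ?_
  show TensorProduct.map ((DGStr.unit k).sgn n) p ((1 : k) ⊗ₜ algebraMap k B 1) = _
  have h0 : (1 : k) ∈ (DGStr.unit k).gr 0 := by simp [DGStr.unit]
  rw [map_one, TensorProduct.map_tmul, DGStr.sgn_apply _ n h0, mul_zero, sg_zero, one_smul]
  rfl

theorem tmul_one_injective {a b : A} (h : (1 : k) ⊗ₜ[k] a = (1 : k) ⊗ₜ b) : a = b := by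
  simpa using congrArg (TensorProduct.lid k A) h

theorem contract_tensorLin_apply {M N : Type*} [AddCommGroup M] [Module k M] [AddCommGroup N]
    [Module k N] (S : DGStr k M) (T : DGStr k N) (j : ℤ) (φ : M ⊗[k] A →ₗ[k] M ⊗[k] A)
    (φ' : N ⊗[k] A →ₗ[k] N ⊗[k] A) (e : M →ₗ[k] k) {e' : N →ₗ[k] k}
    (he' : ∀ j y, j ≠ 0 → y ∈ T.gr j → e' y = 0) {i : ℤ} {x : M} (hx : x ∈ S.gr i) (y : N) :
    contract A (LinearMap.mul' k k ∘ₗ TensorProduct.map e e')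
      (tensorLin A S T j φ φ' ((x ⊗ₜ y) ⊗ₜ 1))
      = sg k (j * i) • (contract A e (φ (x ⊗ₜ 1)) * contract A e' (φ' (y ⊗ₜ 1))) := by
  rw [tensorLin_apply S T j φ φ' hx, map_smul, contract_twMul A.str T e he']

variable {V W : Submodule k B}

/-- The left side of the tensor condition at `V ⊗ W`, evaluated with `ε ⊗ ε`. -/
theorem contract_coFam_mul (hV : FiniteDimensional k V) (hW : FiniteDimensional k W)
    (h : IsSubcomod (regComod B) V) (h' : IsSubcomod (regComod B) W) (n : ℤ) (p : B →ₗ[k] A)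
    (a : V) (b : W) :
    contract A (LinearMap.mul' k k ∘ₗ TensorProduct.map (subCounit h) (subCounit h'))
      (coFam C A n p (TensorSub.mul (finObj hC (regComod B) V hV h)
        (finObj hC (regComod B) W hW h')) ((a ⊗ₜ b) ⊗ₜ 1)) = p (a * b) := by
  -- `ε ⊗ ε` is concentrated in degree `0`
  have hvan : ∀ j x, j ≠ 0 → x ∈ ((subComod (regComod B) V h).str.tensor
      (subComod (regComod B) W h').str).gr j →
      (LinearMap.mul' k k ∘ₗ TensorProduct.map (subCounit h) (subCounit h')) x = 0 := by
    intro j x hj hx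
    refine (Submodule.mem_bot k).1 (DGStr.tensorGr_map _ _
      (LinearMap.mul' k k ∘ₗ TensorProduct.map (subCounit h) (subCounit h')) ⊥ ?_ hx)
    intro i i' y z hi hy hz
    rw [Submodule.mem_bot, LinearMap.comp_apply, TensorProduct.map_tmul, LinearMap.mul'_apply]
    by_cases h0 : i = 0
    · rw [subCounit_eq_zero h' i' z (by omega) hz, mul_zero]
    · rw [subCounit_eq_zero h i y h0 hy, zero_mul]
  refine (congrArg _ (coFam_one n p (TensorSub.mul (finObj hC (regComod B) V hV h)
        (finObj hC (regComod B) W hW h')) (a ⊗ₜ b))).trans ?_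
  refine (contract_map_sgn _ n hvan p _).trans ?_
  rw [mul_zero, sg_zero, one_smul]
  refine congrArg p ((contract_twMul B.str _ _ (subCounit_eq_zero h') _ _).trans ?_)
  exact congrArg₂ (· * ·) (contract_subCounit h a) (contract_subCounit h' b)

/-- The right side of the tensor condition at `V ⊗ W`, evaluated with `ε ⊗ ε`. -/
theorem contract_tensorLin_coFam (hV : FiniteDimensional k V) (hW : FiniteDimensional k W)
    (h : IsSubcomod (regComod B) V) (h' : IsSubcomod (regComod B) W) (j m n : ℤ)
    (p q : B →ₗ[k] A) {i : ℤ} (a : V) (b : W) (ha : a.1 ∈ B.str.gr i) :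
    contract A (LinearMap.mul' k k ∘ₗ TensorProduct.map (subCounit h) (subCounit h'))
      (tensorLin A (subComod (regComod B) V h).str (subComod (regComod B) W h').str j
        (coFam C A m p (finObj hC (regComod B) V hV h))
        (coFam C A n q (finObj hC (regComod B) W hW h')) ((a ⊗ₜ b) ⊗ₜ 1))
      = sg k (j * i) • (p a * q b) := by
  have h1 := contract_tensorLin_apply (A := A) (M := subComod (regComod B) V h)
    (N := subComod (regComod B) W h') (subComod (regComod B) V h).str
    (subComod (regComod B) W h').str j (coFam C A m p (finObj hC (regComod B) V hV h))
    (coFam C A n q (finObj hC (regComod B) W hW h')) (subCounit h) (subCounit_eq_zero h')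
    (i := i) (x := a) ha b
  have h2 := famEval_coFam hC m p V hV h a
  have h3 := famEval_coFam hC n q W hW h' b
  rw [← h2, ← h3]
  exact h1

include hC in
/-- If the family of `p` is compatible with tensor products, `p` is multiplicative. -/
theorem map_mul_of_tensor {p : B →ₗ[k] A}
    (h : ∀ M N : C.Obj, coFam C A 0 p (TensorSub.mul M N)
      = tensorLin A M.1.str N.1.str 0 (coFam C A 0 p M) (coFam C A 0 p N)) (a b : B) :
    p (a * b) = p a * p b := by
  refine B.str.induction (p := fun a => p (a * b) = p a * p b) ?_ ?_ a
  · intro i a ha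
    obtain ⟨V, hV, hs, haV⟩ := exists_finite_subcomod (regComod B) a
    obtain ⟨W, hW, hs', hbW⟩ := exists_finite_subcomod (regComod B) b
    have h1 := contract_coFam_mul hC hV hW hs hs' 0 p ⟨a, haV⟩ ⟨b, hbW⟩
    have h2 := contract_tensorLin_coFam hC hV hW hs hs' 0 0 0 p p ⟨a, haV⟩ ⟨b, hbW⟩ ha
    rw [h] at h1
    rw [zero_mul, sg_zero, one_smul] at h2
    exact h1.symm.trans h2
  · intro x y hx hy
    simp only [add_mul, map_add, hx, hy]

include hC in
/-- The tensor condition on the second entry of a homotopy pair of families gives the derivation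
rule for the corresponding maps `B → A`. -/
theorem deriv_of_tensor {f ξ : B →ₗ[k] A}
    (h : ∀ M N : C.Obj, coFam C A (-1) ξ (TensorSub.mul M N)
      = tensorLin A M.1.str N.1.str 0 (coFam C A (-1) ξ M) (coFam C A 0 f N)
        + tensorLin A M.1.str N.1.str (-1) (coFam C A 0 f M) (coFam C A (-1) ξ N))
    {i : ℤ} {a : B} (b : B) (ha : a ∈ B.str.gr i) :
    ξ (a * b) = ξ a * f b + sg k i • (f a * ξ b) := by
  obtain ⟨V, hV, hs, haV⟩ := exists_finite_subcomod (regComod B) a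
  obtain ⟨W, hW, hs', hbW⟩ := exists_finite_subcomod (regComod B) b
  have h1 := contract_coFam_mul hC hV hW hs hs' (-1) ξ ⟨a, haV⟩ ⟨b, hbW⟩
  have h2 := contract_tensorLin_coFam hC hV hW hs hs' 0 (-1) 0 ξ f ⟨a, haV⟩ ⟨b, hbW⟩ ha
  have h3 := contract_tensorLin_coFam hC hV hW hs hs' (-1) 0 (-1) f ξ ⟨a, haV⟩ ⟨b, hbW⟩ ha
  rw [h] at h1
  rw [zero_mul, sg_zero, one_smul] at h2
  rw [neg_one_mul, sg_neg] at h3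
  exact h1.symm.trans ((map_add (contract A (LinearMap.mul' k k
    ∘ₗ TensorProduct.map (subCounit hs) (subCounit hs'))) _ _).trans (congrArg₂ (· + ·) h2 h3))

include hC in
/-- Every element of `Z⁰End_⊗(ω ⊗ A)` comes from a morphism of cdg-algebras `B → A`. -/
theorem exists_hom_of_zEnd {p : B →ₗ[k] A} (hp : p ∈ B.str.homDeg A.str 0)
    (h : coFam C A 0 p ∈ zEnd C A) : ∃ g : B.toCDGAlg ⟶ A, CDGAlg.lin g = p := by
  have h1 : p 1 = 1 := by
    refine tmul_one_injective (k := k) ((coFam_unit (C := C) 0 p).symm.trans ?_)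
    rw [h.2.2.1]
    rfl
  have hd : B.str.homD A.str p = 0 := by
    refine coFam_injective hC (0 + 1) ?_
    rw [← famD_coFam hp, h.2.1, map_zero]
  refine ⟨⟨AlgHom.ofLinearMap p h1 (map_mul_of_tensor hC h.2.2.2), fun i x hx => ?_, fun x => ?_⟩,
    rfl⟩
  · have := hp i x hx
    rwa [add_zero] at this
  · have := LinearMap.congr_fun hd x
    rw [DGStr.homD_apply _ _ hp, sg_zero, one_smul, LinearMap.zero_apply, sub_eq_zero] at this
    exact this.symm

end Reconstruct

/-! ### Restriction of natural families to a smaller category of dg-comodules -/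

section Restrict

variable {k : Type u} [Field k] {B : CDGHopf k}

theorem DGAlg.isIso_of_bijective {E E' : DGAlg.{u, v} k} (f : E ⟶ E')
    (hf : Function.Bijective f.toFun)
    (hgr : ∀ (i : ℤ) (y : E'), y ∈ E'.str.gr i → ∃ x ∈ E.str.gr i, f.toFun x = y) : IsIso f := by
  let e := AlgEquiv.ofBijective f.toFun hf
  have he : ∀ x, e.symm (f.toFun x) = x := fun x => e.symm_apply_apply x
  have he' : ∀ y, f.toFun (e.symm y) = y := fun y => e.apply_symm_apply y
  refine ⟨⟨⟨e.symm.toAlgHom, fun i y hy => ?_, fun y => ?_⟩, DGAlg.hom_ext he,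
    DGAlg.hom_ext he'⟩⟩
  · obtain ⟨x, hx, rfl⟩ := hgr i y hy
    exact (he x).symm ▸ hx
  · refine hf.1 ?_
    refine (he' _).trans ((congrArg _ (he' y).symm).trans (f.map_d _).symm)

variable {C C' : TensorSub B} (hCC : ∀ M, C.mem M → C'.mem M)

/-- The restriction of families along an inclusion of categories of dg-comodules. -/
def famRestrict (A : CDGAlg.{u, u} k) : Fam C' A →ₐ[k] Fam C A where
  toFun η M := η ⟨M.1, hCC M.1 M.2⟩
  map_one' := rfl
  map_mul' _ _ := rfl
  map_zero' := rfl
  map_add' _ _ := rfl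
  commutes' _ := rfl

variable {A : CDGAlg.{u, u} k}

theorem famRestrict_mem {n : ℤ} {η : Fam C' A} (h : η ∈ natDeg C' A n) :
    famRestrict hCC A η ∈ natDeg C A n :=
  ⟨fun M => h.1 ⟨M.1, hCC M.1 M.2⟩, fun M => h.2.1 ⟨M.1, hCC M.1 M.2⟩,
    fun m M M' => h.2.2 m ⟨M.1, hCC M.1 M.2⟩ ⟨M'.1, hCC M'.1 M'.2⟩⟩

theorem famRestrict_mem_endAlg {η : Fam C' A} (h : η ∈ endAlg C' A) :
    famRestrict hCC A η ∈ endAlg C A :=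
  endAlg_induction (p := fun η => famRestrict hCC A η ∈ endAlg C A)
    (fun _ _ h => natDeg_le (famRestrict_mem hCC h))
    (fun _ _ h h' => by rw [map_add]; exact add_mem h h') h

theorem famRestrict_coFam (n : ℤ) (p : B →ₗ[k] A) :
    famRestrict hCC A (coFam C' A n p) = coFam C A n p := rfl

variable (A) in
/-- The restriction `End(ω ⊗ A) → End(ω' ⊗ A)` as a morphism of dg-algebras. -/
def endRestrict : endDGAlg C' A ⟶ endDGAlg C A where
  toFun := ((famRestrict hCC A).comp (endAlg C' A).val).codRestrict (endAlg C A)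
    fun η => famRestrict_mem_endAlg hCC η.2
  map_gr _ _ h := famRestrict_mem hCC h
  map_d _ := rfl

/-- In each degree both sides are identified with the linear maps `B → A` of that degree. -/
theorem isIso_endRestrict (hC : ∀ M : DGComod B, FiniteDimensional k M → C.mem M) :
    IsIso (endRestrict hCC A) := by
  have hC' : ∀ M : DGComod B, FiniteDimensional k M → C'.mem M := fun M hM => hCC M (hC M hM)
  have hgr : ∀ (n : ℤ) (η : Fam C A), η ∈ natDeg C A n →
      ∃ η' ∈ natDeg C' A n, famRestrict hCC A η' = η := by
    intro n η hη
    obtain ⟨p, hp, rfl⟩ := exists_coFam hC hη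
    exact ⟨coFam C' A n p, coFam_mem hp, famRestrict_coFam hCC n p⟩
  refine DGAlg.isIso_of_bijective _ ⟨fun η η' h => ?_, fun η => ?_⟩ fun n η hη => ?_
  · refine Subtype.ext (endAlg_ext hC' η.2 η'.2 fun M hM x => ?_)
    exact LinearMap.congr_fun (congrFun (congrArg Subtype.val h) ⟨M.1, hC M.1 hM⟩) (x ⊗ₜ 1)
  · obtain ⟨η', h, h'⟩ := endAlg_induction
      (p := fun η => ∃ η' ∈ endAlg C' A, famRestrict hCC A η' = η)
      (fun n η hη => let ⟨η', h, h'⟩ := hgr n η hη; ⟨η', natDeg_le h, h'⟩)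
      (fun η₁ η₂ ⟨η₁', h₁, h₁'⟩ ⟨η₂', h₂, h₂'⟩ =>
        ⟨η₁' + η₂', add_mem h₁ h₂, by rw [map_add, h₁', h₂']⟩) η.2
    exact ⟨⟨η', h⟩, Subtype.ext h'⟩
  · obtain ⟨η', h, h'⟩ := hgr n η.1 hη
    exact ⟨⟨η', natDeg_le h⟩, h, Subtype.ext h'⟩

/-- The restriction of natural families, as a morphism of functors. -/
def calERestrict : calE C' ⟶ calE C where
  app A := endRestrict hCC A
  naturality _ _ _ := rfl

include hCC in
theorem nonempty_calE_iso (hC : ∀ M : DGComod B, FiniteDimensional k M → C.mem M) :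
    Nonempty (calE C ≅ calE C') := by
  have : ∀ A, IsIso ((calERestrict hCC).app A) := fun A => isIso_endRestrict hCC hC
  have := NatIso.isIso_of_isIso_app (calERestrict hCC)
  exact ⟨(asIso (calERestrict hCC)).symm⟩

end Restrict

/-! ### Invertibility of tensor natural transformations -/

section Units

variable {k : Type u} [Field k] {B : CDGHopf k} {C : TensorSub B} {A : CDGAlg.{u, u} k}

/-- A natural inverse of a closed tensor natural transformation is again one. -/
theorem mem_zEnd_of_inverse {η η' : Fam C A} (h : η ∈ zEnd C A) (h' : η' ∈ natDeg C A 0)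
    (h1 : η * η' = 1) (h2 : η' * η = 1) : η' ∈ zEnd C A := by
  refine ⟨h', ?_, ?_, fun M N => ?_⟩
  · have h3 := famD_mul h.1 η'
    rw [h1, famD_one, h.2.1, zero_mul, zero_add, sg_zero, one_smul] at h3
    rw [← one_mul (famD C A η'), ← h2, mul_assoc, ← h3, mul_zero]
  · have h3 := congrFun h1 C.one
    rw [Fam.mul_apply, h.2.2.1] at h3
    exact h3
  · have h3 := tensorLin_comp (j' := 0) (ψ' := η' N) M.1.str N.1.str (h.1.2.1 M) (h.1.2.1 N)
      (h.1.1 N) (h'.1 M)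
    have h4 : η M ∘ₗ η' M = LinearMap.id := congrFun h1 M
    have h5 : η N ∘ₗ η' N = LinearMap.id := congrFun h1 N
    have h6 : η' (TensorSub.mul M N) ∘ₗ η (TensorSub.mul M N) = LinearMap.id :=
      congrFun h2 (TensorSub.mul M N)
    rw [mul_zero, sg_zero, one_smul, add_zero, h4, h5, tensorLin_id] at h3
    have h7 := h.2.2.2 M N
    refine LinearMap.ext fun z => ?_
    have h8 := LinearMap.congr_fun h6 (tensorLin A M.1.str N.1.str 0 (η' M) (η' N) z)
    have h9 := LinearMap.congr_fun h3 z
    rw [h7] at h8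
    exact (congrArg (η' (TensorSub.mul M N)) h9).symm.trans h8

theorem lin_comp_counit {A' : CDGAlg.{u, u} k} (g : A ⟶ A') :
    CDGAlg.lin g ∘ₗ Algebra.linearMap k A ∘ₗ (Coalgebra.counit : B →ₗ[k] k)
      = Algebra.linearMap k A' ∘ₗ Coalgebra.counit :=
  LinearMap.ext fun _ => g.toFun.commutes _

theorem convol_id_antipode :
    convol (A := B.toCDGAlg) LinearMap.id B.antipode
      = Algebra.linearMap k B ∘ₗ Coalgebra.counit :=
  LinearMap.ext fun x => B.mul_antipode_right x

theorem convol_antipode_id :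
    convol (A := B.toCDGAlg) B.antipode LinearMap.id
      = Algebra.linearMap k B ∘ₗ Coalgebra.counit :=
  LinearMap.ext fun x => B.mul_antipode_left x

/-- The family attached to `g ∘ S` is inverse to the one attached to `g`. -/
theorem isUnit_zEnd (hC : ∀ M : DGComod B, FiniteDimensional k M → C.mem M) (η : zEnd C A) :
    IsUnit η := by
  obtain ⟨p, hp, hpη⟩ := exists_coFam hC η.2.1
  obtain ⟨g, rfl⟩ := exists_hom_of_zEnd hC hp (hpη ▸ η.2)
  have hS : CDGAlg.lin g ∘ₗ B.antipode ∈ B.str.homDeg A.str 0 :=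
    DGStr.comp_mem _ B.str _ (add_zero 0) hp fun i x hx => by
      rw [add_zero]; exact B.antipode_gr hx
  have h1 : η.1 * coFam C A 0 (CDGAlg.lin g ∘ₗ B.antipode) = 1 := by
    rw [← hpη, ← coFam_convol, ← coFam_counit, ← lin_comp_counit g]
    have := comp_convol (B := B) g LinearMap.id B.antipode
    rw [convol_id_antipode] at this
    exact congrArg _ this.symm
  have h2 : coFam C A 0 (CDGAlg.lin g ∘ₗ B.antipode) * η.1 = 1 := by
    rw [← hpη, ← coFam_convol, ← coFam_counit, ← lin_comp_counit g]
    have := comp_convol (B := B) g B.antipode LinearMap.id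
    rw [convol_antipode_id] at this
    exact congrArg _ this.symm
  exact ⟨⟨η, ⟨_, mem_zEnd_of_inverse η.2 (coFam_mem hS) h1 h2⟩, Subtype.ext h1, Subtype.ext h2⟩,
    rfl⟩

end Units

/-! ### Comparison with the functors represented by `B` -/

section Compare

/-- A multiplicative bijection that preserves and reflects homotopy preserves and reflects homotopy
types. -/
theorem HoRel.con_eq_comap {k : Type u} [Field k] {F : CDGAlg.{u, v} k ⥤ MonCat.{u}}
    {G : CDGAlg.{u, v} k ⥤ MonCat.{w}} {R : HoRel F} {S : HoRel G} {A : CDGAlg.{u, v} k}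
    (e : F.obj A ≃* G.obj A) (h : ∀ x y, S.rel A (e x) (e y) ↔ R.rel A x y) :
    R.con A = Con.comap e (map_mul e) (S.con A) := by
  refine le_antisymm (R.con_le fun x y hxy => S.con_rel ((h x y).2 hxy)) ?_
  have hle : S.con A ≤ Con.comap e.symm (map_mul e.symm) (R.con A) := by
    refine S.con_le fun x y hxy => ?_
    obtain ⟨x, rfl⟩ := e.surjective x
    obtain ⟨y, rfl⟩ := e.surjective y
    rw [Con.comap_rel, e.symm_apply_apply, e.symm_apply_apply]
    exact R.con_rel ((h x y).1 hxy)
  intro x y hxy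
  have h2 := hle hxy
  rwa [Con.comap_rel, e.symm_apply_apply, e.symm_apply_apply] at h2

variable {k : Type u} [Field k] {B : CDGHopf k} {C : TensorSub B}
variable (hC : ∀ M : DGComod B, FiniteDimensional k M → C.mem M)

/-- The universal family, as an element of `Z⁰End_⊗(ω ⊗ B)`. -/
def univElt (C : TensorSub B) : zEnd C B.toCDGAlg := ⟨univFam C, univFam_mem_zEnd C⟩

/-- The map `Hom(B, A) → Z⁰End_⊗(ω ⊗ A)` that sends `g` to the base change of the universal family
along `g`. -/
def repToZEnd (C : TensorSub B) (A : CDGAlg.{u, u} k) : Rep B A →* zEnd C A where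
  toFun g := ((calG C).map (show B.toCDGAlg ⟶ A from g)).hom (univElt C)
  map_one' := Subtype.ext ((coFam_zero _).symm.trans coFam_counit)
  map_mul' g h := Subtype.ext <| (coFam_zero _).symm.trans <|
    (coFam_convol (CDGAlg.lin (show B.toCDGAlg ⟶ A from g))
      (CDGAlg.lin (show B.toCDGAlg ⟶ A from h))).trans
      (congrArg₂ (· * ·) (coFam_zero _) (coFam_zero _))

theorem repToZEnd_val {A : CDGAlg.{u, u} k} (g : B.toCDGAlg ⟶ A) :
    (repToZEnd C A g).1 = coFam C A 0 (CDGAlg.lin g) := (coFam_zero _).symm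

include hC in
theorem repToZEnd_bijective (A : CDGAlg.{u, u} k) : Function.Bijective (repToZEnd C A) := by
  refine ⟨fun g h e => ?_, fun η => ?_⟩
  · refine CDGAlg.hom_ext (A := B.toCDGAlg) (A' := A) fun x => ?_
    have := (repToZEnd_val g).symm.trans ((congrArg Subtype.val e).trans (repToZEnd_val h))
    exact LinearMap.congr_fun (coFam_injective hC 0 this) x
  · obtain ⟨p, hp, hpη⟩ := exists_coFam hC η.2.1
    obtain ⟨g, rfl⟩ := exists_hom_of_zEnd hC hp (hpη ▸ η.2)
    exact ⟨g, Subtype.ext ((repToZEnd_val g).trans hpη)⟩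

/-- The isomorphism `Hom(B, A) ≃ Z⁰End_⊗(ω ⊗ A)`. -/
def repEquiv (A : CDGAlg.{u, u} k) : (repG B).obj A ≃* (calG C).obj A :=
  MulEquiv.ofBijective (repToZEnd C A) (repToZEnd_bijective hC A)

/-- Both sides are base changes of the universal family. -/
theorem repEquiv_naturality {A A' : CDGAlg.{u, u} k} (f : A ⟶ A') (g : (repG B).obj A) :
    repEquiv hC A' (((repG B).map f).hom g) = ((calG C).map f).hom (repEquiv hC A g) :=
  Subtype.ext (famMap_comp (A := B.toCDGAlg) (CDGAlg.lin (show B.toCDGAlg ⟶ A from g))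
    (CDGAlg.lin f) (univFam C))

include hC in
/-- A homotopy pair of families comes from a homotopy pair of maps `B → A`. -/
theorem homotopic_of_zEndHomotopic {A : CDGAlg.{u, u} k} {g g' : B.toCDGAlg ⟶ A}
    (h : ZEndHomotopic (repToZEnd C A g) (repToZEnd C A g')) : CDGAlg.Homotopic g g' := by
  obtain ⟨P, h0, h1⟩ := h
  -- a linear retraction of `coFam` pulls polynomials in families back to polynomials in maps
  obtain ⟨L, hL⟩ := LinearMap.exists_leftInverse_of_injective (coFam C A 0)
    (LinearMap.ker_eq_bot.2 (coFam_injective hC 0))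
  obtain ⟨L', hL'⟩ := LinearMap.exists_leftInverse_of_injective (coFam C A (-1))
    (LinearMap.ker_eq_bot.2 (coFam_injective hC (-1)))
  have hη : ∀ η ∈ natDeg C A 0, L η ∈ B.str.homDeg A.str 0 ∧ coFam C A 0 (L η) = η := by
    intro η hη
    obtain ⟨p, hp, rfl⟩ := exists_coFam hC hη
    have : L (coFam C A 0 p) = p := LinearMap.congr_fun hL p
    rw [this]
    exact ⟨hp, rfl⟩
  have hχ : ∀ χ ∈ natDeg C A (-1),
      L' χ ∈ B.str.homDeg A.str (-1) ∧ coFam C A (-1) (L' χ) = χ := by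
    intro χ hχ
    obtain ⟨p, hp, rfl⟩ := exists_coFam hC hχ
    have : L' (coFam C A (-1) p) = p := LinearMap.congr_fun hL' p
    rw [this]
    exact ⟨hp, rfl⟩
  have ef : ∀ t : k, ev t (mapCoeff L P.η) = L (ev t P.η) := fun t => ev_mapCoeff L P.η t
  have eξ : ∀ t : k, ev t (mapCoeff L' P.χ) = L' (ev t P.χ) := fun t => ev_mapCoeff L' P.χ t
  have cf : ∀ t : k, coFam C A 0 (L (ev t P.η)) = ev t P.η :=
    fun t => (hη _ (ev_mem _ P.η_mem t)).2
  have cξ : ∀ t : k, coFam C A (-1) (L' (ev t P.χ)) = ev t P.χ :=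
    fun t => (hχ _ (ev_mem _ P.χ_mem t)).2
  have e0 : L (ev (0 : k) P.η) = CDGAlg.lin g := by
    rw [h0, repToZEnd_val]; exact LinearMap.congr_fun hL _
  have e1 : L (ev (1 : k) P.η) = CDGAlg.lin g' := by
    rw [h1, repToZEnd_val]; exact LinearMap.congr_fun hL _
  refine ⟨⟨mapCoeff L P.η, mapCoeff L' P.χ, fun n => (hη _ (P.η_mem n)).1,
    fun n => (hχ _ (P.χ_mem n)).1, fun n => ?_, ⟨g, (ef 0).trans e0⟩, fun t => ?_,
    fun t i a b ha => ?_⟩, (ef 0).trans e0, (ef 1).trans e1⟩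
  · rw [mapCoeff_apply, mapCoeff_apply]
    refine coFam_injective (C := C) hC 0 ?_
    have h2 := famD_coFam (C := C) (hχ _ (P.χ_mem n)).1
    rw [(hχ _ (P.χ_mem n)).2, ← P.flow n] at h2
    rw [map_smul, (hη _ (P.η_mem (n + 1))).2]
    exact h2
  · rw [eξ]
    refine tmul_one_injective (k := k) ((coFam_unit (C := C) (-1) _).symm.trans ?_)
    rw [cξ, P.χ_one t, TensorProduct.tmul_zero]
    rfl
  · rw [ef, eξ]
    refine deriv_of_tensor hC (fun M N => ?_) b ha
    rw [cf, cξ]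
    exact P.χ_tensor t M N

/-- One direction is the compatibility of base change with homotopies, applied to the universal
family. -/
theorem zEndHomotopic_iff {A : CDGAlg.{u, u} k} (g g' : B.toCDGAlg ⟶ A) :
    ZEndHomotopic (repEquiv hC A g) (repEquiv hC A g') ↔ CDGAlg.Homotopic g g' :=
  ⟨fun h => homotopic_of_zEndHomotopic hC h,
    fun h => ZEndHomotopic.of_homotopic h (univElt C)⟩

theorem rep_con_eq_comap (A : CDGAlg.{u, u} k) :
    (repHoRel B).con A
      = Con.comap (repEquiv hC A) (map_mul (repEquiv hC A)) ((calGHoRel C).con A) :=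
  HoRel.con_eq_comap (R := repHoRel B) (S := calGHoRel C) (repEquiv hC A)
    (zEndHomotopic_iff hC)

/-- The isomorphism of monoids of homotopy types induced by `Hom(B, A) ≃ Z⁰End_⊗(ω ⊗ A)`. -/
def hoRepEquiv (X : HoCDGAlg.{u, u} k) : (hoRepG B).obj X ≃* (hoCalG C).obj X :=
  Con.congr (repEquiv hC X.as) (rep_con_eq_comap hC X.as)

theorem hoRepEquiv_naturality {X Y : HoCDGAlg.{u, u} k} (f : X ⟶ Y) (x : (hoRepG B).obj X) :
    hoRepEquiv hC Y (((hoRepG B).map f).hom x) = ((hoCalG C).map f).hom (hoRepEquiv hC X x) := by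
  obtain ⟨A⟩ := X
  obtain ⟨A'⟩ := Y
  obtain ⟨f, rfl⟩ := (CategoryTheory.Quotient.functor (CDGAlg.homRel.{u, u} k)).map_surjective f
  induction x using Con.induction_on with
  | H g => exact congrArg ((calGHoRel C).con A').mk' (repEquiv_naturality hC f g)

end Compare

/-! ### Group-valued functors -/

section Groups

/-- The homotopy types of a group-valued functor form groups. -/
theorem HoRel.isUnit {k : Type u} [Field k] {F : CDGAlg.{u, v} k ⥤ MonCat.{w}} (R : HoRel F)
    (h : ∀ A (x : F.obj A), IsUnit x) (X : HoCDGAlg.{u, v} k) (x : R.functor.obj X) :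
    IsUnit x := by
  obtain ⟨A⟩ := X
  induction x using Con.induction_on with
  | H y => exact (h A y).map (R.con A).mk'

/-- Natural multiplicative bijections give an isomorphism of group-valued functors. -/
theorem nonempty_toGrp_iso {D : Type*} [Category D] {F : D ⥤ MonCat.{u + 1}}
    {G : D ⥤ MonCat.{u}} (hF : ∀ X (x : F.obj X), IsUnit x) (hG : ∀ X (x : G.obj X), IsUnit x)
    (e : ∀ X, G.obj X ≃* F.obj X)
    (he : ∀ {X Y : D} (f : X ⟶ Y) (x : G.obj X),
      e Y ((G.map f).hom x) = (F.map f).hom (e X x)) :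
    Nonempty (toGrp F hF ≅ toGrp G hG ⋙ GrpCat.uliftFunctor.{u + 1, u}) := by
  have he' : ∀ {X Y : D} (f : X ⟶ Y) (x : F.obj X),
      (e Y).symm ((F.map f).hom x) = (G.map f).hom ((e X).symm x) := fun f x => by
    rw [MulEquiv.symm_apply_eq, he, MulEquiv.apply_symm_apply]
  refine ⟨NatIso.ofComponents (fun X => ?_) ?_⟩
  · letI := groupOfIsUnit (hF X)
    letI := groupOfIsUnit (hG X)
    exact MulEquiv.toGrpIso (X := (toGrp F hF).obj X)
      (Y := (toGrp G hG ⋙ GrpCat.uliftFunctor.{u + 1, u}).obj X)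
      ((e X).symm.trans MulEquiv.ulift.symm)
  · intro X Y f
    ext x
    exact congrArg ULift.up (he' f x)

end Groups

end DGRec

end

theorem mainTheorem2 (k : Type u) [Field k] [CharZero k] (B : DGRec.CDGHopf k) :
    Nonempty (DGRec.calE (DGRec.finComod B) ≅ DGRec.calE (DGRec.allComod B)) ∧
    ∃ (hGf : ∀ A (x : (DGRec.calG (DGRec.finComod B)).obj A), IsUnit x)
      (hG : ∀ A (x : (DGRec.calG (DGRec.allComod B)).obj A), IsUnit x)
      (hGB : ∀ A (x : (DGRec.repG B).obj A), IsUnit x)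
      (hHf : ∀ A (x : (DGRec.hoCalG (DGRec.finComod B)).obj A), IsUnit x)
      (hH : ∀ A (x : (DGRec.hoCalG (DGRec.allComod B)).obj A), IsUnit x)
      (hHB : ∀ A (x : (DGRec.hoRepG B).obj A), IsUnit x),
      Nonempty (DGRec.toGrp (DGRec.calG (DGRec.finComod B)) hGf
        ≅ DGRec.toGrp (DGRec.calG (DGRec.allComod B)) hG) ∧
      Nonempty (DGRec.toGrp (DGRec.hoCalG (DGRec.finComod B)) hHf
        ≅ DGRec.toGrp (DGRec.hoCalG (DGRec.allComod B)) hH) ∧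
      Nonempty (DGRec.toGrp (DGRec.calG (DGRec.finComod B)) hGf
        ≅ DGRec.toGrp (DGRec.repG B) hGB ⋙ GrpCat.uliftFunctor.{u + 1, u}) ∧
      Nonempty (DGRec.toGrp (DGRec.hoCalG (DGRec.finComod B)) hHf
        ≅ DGRec.toGrp (DGRec.hoRepG B) hHB ⋙ GrpCat.uliftFunctor.{u + 1, u}) := by 
  have hf : ∀ M : DGRec.DGComod B, FiniteDimensional k M → (DGRec.finComod B).mem M :=
    fun _ h => h
  have ha : ∀ M : DGRec.DGComod B, FiniteDimensional k M → (DGRec.allComod B).mem M :=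
    fun _ _ => trivial
  have hGf : ∀ A (x : (DGRec.calG (DGRec.finComod B)).obj A), IsUnit x :=
    fun A x => DGRec.isUnit_zEnd (A := A) hf x
  have hG : ∀ A (x : (DGRec.calG (DGRec.allComod B)).obj A), IsUnit x :=
    fun A x => DGRec.isUnit_zEnd (A := A) ha x
  have hGB : ∀ A (x : (DGRec.repG B).obj A), IsUnit x := fun A x =>
    (MulEquiv.isUnit_map (DGRec.repEquiv hf A)).1 (hGf A (DGRec.repEquiv hf A x))
  have hHf := (DGRec.calGHoRel (DGRec.finComod B)).isUnit hGf
  have hH := (DGRec.calGHoRel (DGRec.allComod B)).isUnit hG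
  have hHB := (DGRec.repHoRel B).isUnit hGB
  obtain ⟨i₁⟩ := DGRec.nonempty_toGrp_iso hGf hGB (DGRec.repEquiv hf)
    (fun f g => DGRec.repEquiv_naturality hf f g)
  obtain ⟨i₂⟩ := DGRec.nonempty_toGrp_iso hG hGB (DGRec.repEquiv ha)
    (fun f g => DGRec.repEquiv_naturality ha f g)
  obtain ⟨j₁⟩ := DGRec.nonempty_toGrp_iso hHf hHB (DGRec.hoRepEquiv hf)
    (fun f x => DGRec.hoRepEquiv_naturality hf f x)
  obtain ⟨j₂⟩ := DGRec.nonempty_toGrp_iso hH hHB (DGRec.hoRepEquiv ha)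
    (fun f x => DGRec.hoRepEquiv_naturality ha f x)
  exact ⟨DGRec.nonempty_calE_iso (fun _ _ => trivial) hf, hGf, hG, hGB, hHf, hH, hHB,
    ⟨i₁ ≪≫ i₂.symm⟩, ⟨j₁ ≪≫ j₂.symm⟩, ⟨i₁⟩, ⟨j₁⟩⟩
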